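/- **Setting.** Formulas of the modal $\mu$-calculus are given by $\varphi ::= p \mid \bar p \mid \bot \mid \top \mid \varphi\vee\varphi \mid \varphi\wedge\varphi \mid \Diamond\varphi \mid \Box\varphi \mid \mu x.\varphi \mid \nu x.\varphi$, where $\bar x$ does not occur in $\varphi$ in the last two cases. A formula is *tidy* if no variable is both free and bound in it. Write $\varphi\to_C\psi$ if $\psi$ is a direct boolean or modal subformula of $\varphi$, or $\varphi=\eta x.\chi$ ($\eta\in\{\mu,\nu\}$) and $\psi=\chi[\eta x.\chi/x]$; $\mathrm{Clos}(\Gamma)$ is the set of formulas reachable from $\Gamma$ by $\to_C$. A *sequent* is a finite set of tidy formulas. A *priority function* for $\Gamma$ is a map $\Omega$ into $\mathbb N$ that is even on the $\nu$-formulas and odd on the $\mu$-formulas of $\mathrm{Clos}(\Gamma)$, and such that $\Omega(\varphi)\le\Omega(\psi)$ whenever $\varphi,\psi\in\mathrm{Clos}(\Gamma)$ are fixpoint formulas reachable from each other by $\to_C$ and $\varphi$ is a subformula of $\psi$. Let $m$ be the highest even priority of a $\nu$-formula in $\mathrm{Clos}(\Gamma)$ ($m=0$ if there is none). **Annotated sequents.**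 An annotation is a tuple $\sigma=(\sigma_0,\sigma_2,\dots,\sigma_m)$ of binary strings; annotations are ordered lexicographically, and so are strings. An annotated sequent $\Theta$ is a finite set of annotated formulas $\varphi^\sigma$. A string $s$ is *in play* at $k$ in $\Theta$ if $s$ is a prefix of $\sigma_k$ for some $\varphi^\sigma\in\Theta$. Let $\mathrm{minL}_k(\Theta)$ be the shortest string $0\cdots0$ without a proper extension in play at $k$. Let $\sigma{\restriction}k$ be $\sigma$ with $\sigma_l$ replaced by $\mathrm{minL}_l$ of the conclusion of the rule for each $l>k$, and let $\sigma\cdot b_k$ be $\sigma$ with the bit $b$ appended to $\sigma_k$. **Rules of $\mathsf{BT}^\infty$** (conclusion $\Leftarrow$ premises): * axioms $p^\sigma,\bar p^\tau,\Theta$ and $\top^\sigma,\Theta$; * $(\varphi\vee\psi)^\sigma,\Theta\Leftarrow\varphi^\sigma,\psi^\sigma,\Theta$; * $(\varphi\wedge\psi)^\sigma,\Theta\Leftarrow\varphi^\sigma,\Theta$ and $\psi^\sigma,\Theta$; * $\Box\varphi^\sigma,\Diamond\Theta,\Delta\Leftarrow\varphi^\sigma,\Theta$; * $(\mu x.\varphi)^\sigma,\Theta\Leftarrow\varphi[\mu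 x.\varphi/x]^{\sigma\restriction k},\Theta$, where $k=\Omega(\mu x.\varphi)$; * $(\nu x.\varphi)^\sigma,\Theta\Leftarrow\varphi[\nu x.\varphi/x]^{\sigma\restriction k\cdot1_k},\{\psi^{\tau\cdot0_k}\mid\psi^\tau\in\Theta\}$, where $k=\Omega(\nu x.\varphi)$; * $\mathsf{Resolve}$: from a conclusion containing $\varphi^\sigma$ and $\varphi^\tau$ with $\sigma<\tau$, the premise arises by removing $\varphi^\sigma$; * $\mathsf{Compress}_k^{s0}$, applicable if $s0$ is and $s1$ is not in play at $k$: in each annotation whose $k$-th string has the form $s0t$, this string is replaced by $st$; * $\mathsf{Compress}_k^{s1}$, applicable if $s1$ is and $s0$ is not in play at $k$ and $s$ is not of the form $0\cdots0$ (in particular $s\neq\epsilon$): each $k$-th string of the form $s1t$ is replaced by $st$. **Proofs.** A $\mathsf{BT}^\infty$ proof of a sequent $\Gamma$ (with respect to $\Omega$) is a possibly infinite tree, whose nodes are labelled with annotated sequents and rules, that is built according to these rules (so all leaves are axioms), whose root is labelled with $\Gamma$ with all formulas annotated by $(\epsilon,\dots,\epsilon)$, and in which each infinite branch $v_0v_1\cdots$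 is successful: there are an even $k\le m$, a binary string $s$ and $N$ such that $s$ is in play at $k$ in each $v_i$, $i\ge N$; no $\mathsf{Compress}_k^{u0}$ or $\mathsf{Compress}_k^{u1}$ with $u$ a proper prefix of $s$ is applied at any $v_i$, $i\ge N$; and for infinitely many $i$ a rule $\mathsf{Compress}_k^{t1}$ with $t=s0\cdots0$ (possibly $t=s$) is applied at $v_i$. A proof is *regular* if it has only finitely many distinct subtrees. **Lemma.** Let $\Gamma$ be a sequent and $\Omega$ a priority function for $\Gamma$. There is a $\mathsf{BT}^\infty$ proof of $\Gamma$ if and only if there is a regular $\mathsf{BT}^\infty$ proof of $\Gamma$. -/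

import Mathlib

namespace MuBT

/-! ### Formulas of the modal mu-calculus (in negation normal form) -/

inductive Formula (α : Type*) where
  | pos (p : α)
  | neg (p : α)
  | bot
  | top
  | or (φ ψ : Formula α)
  | and (φ ψ : Formula α)
  | dia (φ : Formula α)
  | box (φ : Formula α)
  | mu (x : α) (φ : Formula α)
  | nu (x : α) (φ : Formula α)
  deriving DecidableEq

namespace Formula

variable {α : Type*}

/-- Free variables. -/
def freeVars : Formula α → Set α
  | pos p => {p}
  | neg p => {p}
  | bot => ∅
  | top => ∅
  | or φ ψ => freeVars φ ∪ freeVars ψ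
  | and φ ψ => freeVars φ ∪ freeVars ψ
  | dia φ => freeVars φ
  | box φ => freeVars φ
  | mu x φ => freeVars φ \ {x}
  | nu x φ => freeVars φ \ {x}

/-- Bound variables. -/
def boundVars : Formula α → Set α
  | pos _ => ∅
  | neg _ => ∅
  | bot => ∅
  | top => ∅
  | or φ ψ => boundVars φ ∪ boundVars ψ
  | and φ ψ => boundVars φ ∪ boundVars ψ
  | dia φ => boundVars φ
  | box φ => boundVars φ
  | mu x φ => insert x (boundVars φ)
  | nu x φ => insert x (boundVars φ)

/-- The variables `p` such that the negative literal of `p` occurs in the formula. -/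
def negVars : Formula α → Set α
  | pos _ => ∅
  | neg p => {p}
  | bot => ∅
  | top => ∅
  | or φ ψ => negVars φ ∪ negVars ψ
  | and φ ψ => negVars φ ∪ negVars ψ
  | dia φ => negVars φ
  | box φ => negVars φ
  | mu _ φ => negVars φ
  | nu _ φ => negVars φ

/-- The formation condition on fixpoint formulas: below a binder of `x` the variable `x` does not
occur negatively. -/
def WellFormed : Formula α → Prop
  | pos _ => True
  | neg _ => True
  | bot => True
  | top => True
  | or φ ψ => WellFormed φ ∧ WellFormed ψ
  | and φ ψ => WellFormed φ ∧ WellFormed ψ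
  | dia φ => WellFormed φ
  | box φ => WellFormed φ
  | mu x φ => x ∉ negVars φ ∧ WellFormed φ
  | nu x φ => x ∉ negVars φ ∧ WellFormed φ

/-- Tidy formulas: no variable is both free and bound. -/
def Tidy (φ : Formula α) : Prop := Disjoint (freeVars φ) (boundVars φ)

/-- `φ.subst x χ` replaces the free occurrences of `x` in `φ` by `χ`. It is only applied to unfold
tidy fixpoint formulas, where no variable can be captured. -/
def subst [DecidableEq α] (x : α) (χ : Formula α) : Formula α → Formula α
  | pos p => if p = x then χ else pos p
  | neg p => neg p
  | bot => bot
  | top => top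
  | or φ ψ => or (subst x χ φ) (subst x χ ψ)
  | and φ ψ => and (subst x χ φ) (subst x χ ψ)
  | dia φ => dia (subst x χ φ)
  | box φ => box (subst x χ φ)
  | mu y φ => if y = x then mu y φ else mu y (subst x χ φ)
  | nu y φ => if y = x then nu y φ else nu y (subst x χ φ)

/-- The subformula relation: `Subformula φ ψ` says that `φ` is a subformula of `ψ`. -/
inductive Subformula (φ : Formula α) : Formula α → Prop
  | refl : Subformula φ φ
  | or_left {ψ χ} : Subformula φ ψ → Subformula φ (or ψ χ)
  | or_right {ψ χ} : Subformula φ χ → Subformula φ (or ψ χ)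
  | and_left {ψ χ} : Subformula φ ψ → Subformula φ (and ψ χ)
  | and_right {ψ χ} : Subformula φ χ → Subformula φ (and ψ χ)
  | dia {ψ} : Subformula φ ψ → Subformula φ (dia ψ)
  | box {ψ} : Subformula φ ψ → Subformula φ (box ψ)
  | mu {x ψ} : Subformula φ ψ → Subformula φ (mu x ψ)
  | nu {x ψ} : Subformula φ ψ → Subformula φ (nu x ψ)

/-- Fixpoint formulas. -/
def IsFixpoint (φ : Formula α) : Prop := ∃ x χ, φ = mu x χ ∨ φ = nu x χ

/-- The one-step trace relation: from a formula to its direct boolean or modal subformulas, and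
from a fixpoint formula to its unfolding. -/
inductive TraceStep [DecidableEq α] : Formula α → Formula α → Prop
  | or_left (φ ψ) : TraceStep (or φ ψ) φ
  | or_right (φ ψ) : TraceStep (or φ ψ) ψ
  | and_left (φ ψ) : TraceStep (and φ ψ) φ
  | and_right (φ ψ) : TraceStep (and φ ψ) ψ
  | dia (φ) : TraceStep (dia φ) φ
  | box (φ) : TraceStep (box φ) φ
  | mu (x φ) : TraceStep (mu x φ) (subst x (mu x φ) φ)
  | nu (x φ) : TraceStep (nu x φ) (subst x (nu x φ) φ)

/-- The (Fischer-Ladner) closure of a set of formulas. -/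
def Clos [DecidableEq α] (Γ : Finset (Formula α)) : Set (Formula α) :=
  {ψ | ∃ φ ∈ Γ, Relation.ReflTransGen TraceStep φ ψ}

/-- Size of a formula. -/
def size : Formula α → ℕ
  | pos _ => 1
  | neg _ => 1
  | bot => 1
  | top => 1
  | or φ ψ => size φ + size ψ + 1
  | and φ ψ => size φ + size ψ + 1
  | dia φ => size φ + 1
  | box φ => size φ + 1
  | mu _ φ => size φ + 1
  | nu _ φ => size φ + 1

end Formula

open Formula

/-- `Ω` is a priority function for the fixpoint formulas in the closure of `Γ` (smaller numbers
being more significant): greatest fixpoints have even and least fixpoints odd priority, and if two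
fixpoint formulas lie in the same cluster of the trace graph, then the one that is a subformula of
the other is at least as significant. -/
structure IsPriorityFunction {α : Type*} [DecidableEq α] (Γ : Finset (Formula α))
    (Ω : Formula α → ℕ) : Prop where
  even_nu : ∀ x φ, nu x φ ∈ Clos Γ → Even (Ω (nu x φ))
  odd_mu : ∀ x φ, mu x φ ∈ Clos Γ → Odd (Ω (mu x φ))
  mono : ∀ φ ∈ Clos Γ, ∀ ψ ∈ Clos Γ, IsFixpoint φ → IsFixpoint ψ →
    Relation.ReflTransGen TraceStep φ ψ → Relation.ReflTransGen TraceStep ψ φ →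
    Subformula φ ψ → Ω φ ≤ Ω ψ

theorem Formula.Subformula.eq_or_size_lt {α : Type*} {φ ψ : Formula α} (h : Subformula φ ψ) :
    φ = ψ ∨ size φ < size ψ := by
  induction h with
  | refl => exact Or.inl rfl
  | _ _ ih => right; rcases ih with rfl | h <;> simp only [size] <;> omega

/-- Priority functions exist. -/
theorem exists_isPriorityFunction {α : Type*} [DecidableEq α] (Γ : Finset (Formula α)) :
    ∃ Ω, IsPriorityFunction Γ Ω := by
  refine ⟨fun φ => match φ with
    | mu x χ => 2 * size (mu x χ) + 1
    | nu x χ => 2 * size (nu x χ)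
    | _ => 0, ⟨fun x φ _ => ?_, fun x φ _ => ?_, ?_⟩⟩
  · exact even_two_mul _
  · exact odd_two_mul_add_one _
  · rintro φ - ψ - ⟨x, χ, rfl | rfl⟩ ⟨y, θ, rfl | rfl⟩ - - h <;>
      rcases h.eq_or_size_lt with h | h <;> simp_all <;> omega

/-- The highest even priority of (the greatest fixpoint formulas in) the closure of `Γ`; it is `0`
if there is no greatest fixpoint formula. -/
noncomputable def maxEven {α : Type*} [DecidableEq α] (Ω : Formula α → ℕ)
    (Γ : Finset (Formula α)) : ℕ :=
  sSup {k | Even k ∧ ∃ x φ, nu x φ ∈ Clos Γ ∧ Ω (nu x φ) = k}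

/-- The number of even priorities `0, 2, …, m`, where `m` is the highest one. -/
noncomputable def numEven {α : Type*} [DecidableEq α] (Ω : Formula α → ℕ)
    (Γ : Finset (Formula α)) : ℕ :=
  maxEven Ω Γ / 2 + 1

/-! ### Annotated sequents

Annotations are tuples `(s_0, s_2, …, s_m)` of binary strings (`false` is `0`, `true` is `1`); the
string for the even priority `2 * l` is stored at the index `l : Fin n`. -/

abbrev Annotation (n : ℕ) := Fin n → List Bool

abbrev AnnSequent (α : Type*) (n : ℕ) := Finset (Formula α × Annotation n)

/-- The lexicographic order on annotations; strings are compared lexicographically, `0` before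
`1`. -/
def AnnLT {n : ℕ} (σ τ : Annotation n) : Prop :=
  ∃ l, (∀ j < l, σ j = τ j) ∧ σ l < τ l

/-- `s` is in play at position `l`: it is a prefix of the `l`-th string of some annotated formula. -/
def InPlay {α : Type*} {n : ℕ} (Θ : AnnSequent α n) (l : Fin n) (s : List Bool) : Prop :=
  ∃ q ∈ Θ, s <+: q.2 l

/-- The minimal leaf at position `l`: the shortest string of the form `0…0` that has no proper
extension in play. It is the leftmost leaf of the tree of strings in play, when the position `0…0`
of the formulas that have no `1` is counted as occupied. -/
noncomputable def minLeaf {α : Type*} {n : ℕ} (Θ : AnnSequent α n) (l : Fin n) : List Bool :=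
  List.replicate (sInf {j | ∀ b, ¬ InPlay Θ l (List.replicate j false ++ [b])}) false

/-- Keeps the strings for priorities up to `k` and resets the others to the minimal leaf. -/
noncomputable def restrict {α : Type*} {n : ℕ} (Θ : AnnSequent α n) (k : ℕ) (σ : Annotation n) :
    Annotation n :=
  fun l => if k < 2 * (l : ℕ) then minLeaf Θ l else σ l

/-- Appends the bit `b` to the string at position `l`. -/
def appendBit {n : ℕ} (l : Fin n) (b : Bool) (σ : Annotation n) : Annotation n :=
  Function.update σ l (σ l ++ [b])

/-- Replaces the string `sbt` by `st`; all other strings are kept. -/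
def compressString (s : List Bool) (b : Bool) (w : List Bool) : List Bool :=
  if (s ++ [b]) <+: w then s ++ w.drop (s.length + 1) else w

def compressAnn {n : ℕ} (l : Fin n) (s : List Bool) (b : Bool) (σ : Annotation n) : Annotation n :=
  Function.update σ l (compressString s b (σ l))

/-! ### The rules -/

inductive Rule (n : ℕ) where
  | ax
  | axTop
  | or
  | and
  | box
  | mu
  | nu
  | resolve
  | compress (l : Fin n) (s : List Bool) (b : Bool)

/-- `Step Ω r Θ prem`: the annotated sequent `Θ` is the conclusion of an instance of the rule `r`
with premises `prem`. -/
inductive Step {α : Type*} [DecidableEq α] {n : ℕ} (Ω : Formula α → ℕ) :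
    Rule n → AnnSequent α n → List (AnnSequent α n) → Prop
  | ax (p : α) (σ τ : Annotation n) (Θ : AnnSequent α n) :
      Step Ω .ax (insert (pos p, σ) (insert (neg p, τ) Θ)) []
  | axTop (σ : Annotation n) (Θ : AnnSequent α n) :
      Step Ω .axTop (insert (top, σ) Θ) []
  | or (φ ψ : Formula α) (σ : Annotation n) (Θ : AnnSequent α n) :
      Step Ω .or (insert (or φ ψ, σ) Θ) [insert (φ, σ) (insert (ψ, σ) Θ)]
  | and (φ ψ : Formula α) (σ : Annotation n) (Θ : AnnSequent α n) :
      Step Ω .and (insert (and φ ψ, σ) Θ) [insert (φ, σ) Θ, insert (ψ, σ) Θ]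
  | box (φ : Formula α) (σ : Annotation n) (Θ Δ : AnnSequent α n) :
      Step Ω .box (insert (box φ, σ) (Θ.image (fun q => (dia q.1, q.2)) ∪ Δ))
        [insert (φ, σ) Θ]
  | mu (x : α) (φ : Formula α) (σ : Annotation n) (Θ : AnnSequent α n) :
      Step Ω .mu (insert (mu x φ, σ) Θ)
        [insert (subst x (mu x φ) φ,
          restrict (insert (mu x φ, σ) Θ) (Ω (mu x φ)) σ) Θ]
  | nu (x : α) (φ : Formula α) (σ : Annotation n) (Θ : AnnSequent α n) (l : Fin n)
      (hl : Ω (nu x φ) = 2 * (l : ℕ)) :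
      Step Ω .nu (insert (nu x φ, σ) Θ)
        [insert (subst x (nu x φ) φ,
          appendBit l true (restrict (insert (nu x φ, σ) Θ) (Ω (nu x φ)) σ))
          (Θ.image (fun q => (q.1, appendBit l false q.2)))]
  | resolve (φ : Formula α) (σ τ : Annotation n) (Θ : AnnSequent α n)
      (hσ : (φ, σ) ∈ Θ) (hτ : (φ, τ) ∈ Θ) (h : AnnLT σ τ) :
      Step Ω .resolve Θ [Θ.erase (φ, σ)]
  | compress_zero (l : Fin n) (s : List Bool) (Θ : AnnSequent α n)
      (h : InPlay Θ l (s ++ [false])) (h' : ¬ InPlay Θ l (s ++ [true])) :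
      Step Ω (.compress l s false) Θ [Θ.image (fun q => (q.1, compressAnn l s false q.2))]
  | compress_one (l : Fin n) (s : List Bool) (Θ : AnnSequent α n)
      (h : InPlay Θ l (s ++ [true])) (h' : ¬ InPlay Θ l (s ++ [false])) (hs : true ∈ s) :
      Step Ω (.compress l s true) Θ [Θ.image (fun q => (q.1, compressAnn l s true q.2))]

/-! ### Possibly infinite proof trees -/

/-- A (possibly infinite, at most binary) tree whose nodes are labelled with an annotated sequent
and the rule applied there. Nodes are addressed by the path from the root. -/
abbrev ProofTree (α : Type*) (n : ℕ) := List Bool → Option (AnnSequent α n × Rule n)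

/-- The subtree rooted at `v`. -/
def ProofTree.subtree {α : Type*} {n : ℕ} (π : ProofTree α n) (v : List Bool) : ProofTree α n :=
  fun w => π (v ++ w)

/-- A tree is regular if it has finitely many distinct subtrees. -/
def ProofTree.Regular {α : Type*} {n : ℕ} (π : ProofTree α n) : Prop :=
  {ρ : ProofTree α n | ∃ v, π v ≠ none ∧ ρ = π.subtree v}.Finite

/-- The tree `π` is locally correct with root sequent `Θ₀`: at each node, the children are labelled
with the premises of an instance of the rule applied there; leaves are therefore axioms. -/
structure IsDerivation {α : Type*} [DecidableEq α] {n : ℕ} (Ω : Formula α → ℕ)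
    (Θ₀ : AnnSequent α n) (π : ProofTree α n) : Prop where
  root : (π []).map Prod.fst = some Θ₀
  closed : ∀ v b, π v = none → π (v ++ [b]) = none
  step : ∀ v Θ r, π v = some (Θ, r) → ∃ prem, Step Ω r Θ prem ∧
    ∀ b : Bool, (π (v ++ [b])).map Prod.fst = prem[b.toNat]?

/-- The pair `(l, s)` is preserved on the set `S` of nodes: `s` is in play at position `l`
everywhere, and no string properly below `s` is compressed. -/
def Preserved {α : Type*} {n : ℕ} (π : ProofTree α n) (l : Fin n) (s : List Bool)
    (S : Set (List Bool)) : Prop :=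
  ∀ v ∈ S, ∃ Θ r, π v = some (Θ, r) ∧ InPlay Θ l s ∧
    ∀ u b, r = .compress l u b → ¬ (u <+: s ∧ u ≠ s)

/-- The pair `(l, s)` progresses at the node `v`: for some `t = s0…0`, the string `t1` is compressed
to `t` there. -/
def ProgressesAt {α : Type*} {n : ℕ} (π : ProofTree α n) (l : Fin n) (s : List Bool)
    (v : List Bool) : Prop :=
  ∃ Θ j, π v = some (Θ, .compress l (s ++ List.replicate j false) true)

/-- The `i`-th node on the path `β`. -/
def pathNode (β : ℕ → Bool) (i : ℕ) : List Bool := (List.range i).map β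

/-- The infinite path `β` is successful. -/
def Successful {α : Type*} {n : ℕ} (π : ProofTree α n) (β : ℕ → Bool) : Prop :=
  ∃ (l : Fin n) (s : List Bool) (N : ℕ),
    Preserved π l s {v | ∃ i, N ≤ i ∧ v = pathNode β i} ∧
    ∀ M, ∃ i, M ≤ i ∧ ProgressesAt π l s (pathNode β i)

/-- `π` is an infinitary proof of the sequent `Γ`: a derivation of `Γ`, all formulas being annotated
with empty strings, in which each infinite branch is successful. -/
structure IsProof {α : Type*} [DecidableEq α] (Ω : Formula α → ℕ) (Γ : Finset (Formula α))
    (π : ProofTree α (numEven Ω Γ)) : Prop where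
  derivation : IsDerivation Ω (Γ.image (fun φ => (φ, fun _ => []))) π
  successful : ∀ β : ℕ → Bool, (∀ i, π (pathNode β i) ≠ none) → Successful π β

end MuBT

namespace MuBT

open Relation Formula

/-! ### Infinite paths -/

/-! Only the passage from an arbitrary proof to a regular one needs an argument. Success of a branch
is a Rabin condition on the labels of its nodes, and Rabin objectives need no memory: if a branching
system has finitely many labels and all its infinite paths satisfy the condition, then a strategy
depending on the current label alone can imitate it (`exists_wins`). Unfolding such a strategy gives
a tree whose subtrees are determined by their root labels, hence a regular one
(`exists_regular_of_wins`).

The given proof may contain infinitely many labels, since its strings may grow without bound. It is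
replaced by a system that follows its logical rules and ignores its resolutions and compressions,
normalizing eagerly instead (`Config.exists_next`). In a normal sequent each formula has one
annotation and a string is at most one longer than the number of formulas (`Normal.length_le`). As
the closure is finite (`clos_finite`), only finitely many labels remain.

The annotations of the new system differ from the old ones, so success has to be transferred through
traces, which do not depend on annotations. A successful branch carries a trace on which eventually
nothing of priority below some `2 * l` is unfolded, while greatest fixpoints of priority `2 * l` are
unfolded infinitely often (`exists_trace_of_successful`). Conversely, such a trace makes any path of
prefix-free sequents with bounded strings successful (`exists_progress_of_trace`).
`Config.rabinAccepts` lifts the trace from the one to the other. -/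

theorem exists_path_of_transGen_step {S : Type*} {r : S → S → Prop} {x y : S}
    (h : TransGen r x y) :
    ∃ (n : ℕ) (p : ℕ → S), 0 < n ∧ p 0 = x ∧ p n = y ∧ ∀ i < n, r (p i) (p (i + 1)) := by
  induction h with
  | @single y h =>
    refine ⟨1, fun i => if i = 0 then x else y, by simp, by simp, by simp, fun i hi => ?_⟩
    obtain rfl : i = 0 := by omega
    simpa using h
  | @tail y z _ h ih =>
    obtain ⟨n, p, hn, h0, h1, hp⟩ := ih
    refine ⟨n + 1, fun i => if i ≤ n then p i else z, by simp, by simpa using h0, by simp,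
      fun i hi => ?_⟩
    rcases Nat.lt_succ_iff_lt_or_eq.1 hi with hi | rfl
    · simpa [hi.le, Nat.succ_le_of_lt hi] using hp i hi
    · simpa [h1] using h

/-- Milestones joined by nonempty finite paths can be joined to an infinite path. -/
theorem exists_path_through {S : Type*} {r : S → S → Prop} (a : ℕ → S)
    (h : ∀ k, TransGen r (a k) (a (k + 1))) :
    ∃ f : ℕ → S, (∀ i, r (f i) (f (i + 1))) ∧ ∀ k, ∃ i, k ≤ i ∧ f i = a k := by
  choose n p hn h0 h1 hp using fun k => exists_path_of_transGen_step (h k)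
  -- A clock `(k, j)`: the path is at position `j` of the segment from `a k` to `a (k + 1)`. The end
  -- of a segment is skipped, being the start of the next one.
  let nx : ℕ × ℕ → ℕ × ℕ := fun c => if c.2 + 1 < n c.1 then (c.1, c.2 + 1) else (c.1 + 1, 0)
  let st : ℕ → ℕ × ℕ := fun i => nx^[i] (0, 0)
  have hst : ∀ i, st (i + 1) = nx (st i) := fun i => Function.iterate_succ_apply' _ _ _
  have hlt : ∀ i, (st i).2 < n (st i).1 := by
    intro i
    induction i with
    | zero => exact hn 0
    | succ i ih =>
      rw [hst]
      by_cases hc : (st i).2 + 1 < n (st i).1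
      · simp [nx, hc]
      · simpa [nx, hc] using hn _
  refine ⟨fun i => p (st i).1 (st i).2, fun i => ?_, fun k => ?_⟩
  · have := hp _ _ (hlt i)
    simp only [hst]
    by_cases hc : (st i).2 + 1 < n (st i).1
    · simpa [nx, hc] using this
    · have he : (st i).2 + 1 = n (st i).1 := by have := hlt i; omega
      rw [he, h1] at this
      simpa [nx, hc, h0] using this
  · have key : ∃ i, k ≤ i ∧ st i = (k, 0) := by
      induction k with
      | zero => exact ⟨0, le_rfl, rfl⟩
      | succ k ih =>
        obtain ⟨i, hi, he⟩ := ih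
        have hj : ∀ j, j < n k → st (i + j) = (k, j) := by
          intro j
          induction j with
          | zero => intro _; simpa using he
          | succ j ihj =>
            intro hjn
            rw [← add_assoc, hst, ihj (by omega)]
            simp [nx, hjn]
        have hnk := hn k
        refine ⟨i + (n k - 1) + 1, by omega, ?_⟩
        rw [hst, hj _ (by omega)]
        simp only [nx]
        rw [if_neg (by omega)]
    obtain ⟨i, hi, he⟩ := key
    exact ⟨i, hi, by simp [he, h0]⟩

/-! ### Positional strategies for Rabin conditions -/

/-- The Rabin condition: for some `p`, all but finitely many members of the sequence are kept by
`p`, and infinitely many of them are progressing for `p`. -/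
def RabinAccepts {L P : Type*} (keep prog : P → L → Prop) (f : ℕ → L) : Prop :=
  ∃ p N, (∀ i, N ≤ i → keep p (f i)) ∧ ∀ M, ∃ i, M ≤ i ∧ prog p (f i)

theorem RabinAccepts.of_tail {L P : Type*} {keep prog : P → L → Prop} {f : ℕ → L} (k : ℕ)
    (h : RabinAccepts keep prog (fun i => f (k + i))) : RabinAccepts keep prog f := by
  obtain ⟨p, N, h1, h2⟩ := h
  refine ⟨p, k + N, fun i hi => ?_, fun M => ?_⟩
  · have : keep p (f (k + (i - k))) := h1 (i - k) (by omega)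
    rwa [show k + (i - k) = i by omega] at this
  · obtain ⟨i, hi, h⟩ := h2 M
    exact ⟨k + i, by omega, h⟩

/-- Transitions of a system at the states whose label lies in `F`; all other labels are treated as
terminal. -/
def SysStep {S L : Type*} (lab : S → L) (next : S → Bool → Option S) (F : Set L) (s t : S) : Prop :=
  lab s ∈ F ∧ ∃ b, next s b = some t

/-- The positional strategy `τ` imitates the system from the state `s`, with the labels outside of
`F` being terminal. -/
structure Wins {S L P : Type*} (lab : S → L) (next : S → Bool → Option S)
    (ok : L → (Bool → Option L) → Prop) (keep prog : P → L → Prop)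
    (F : Set L) (τ : L → Bool → Option L) (s : S) : Prop where
  reach : ∀ x, ReflTransGen (SysStep id τ F) (lab s) x →
    ∃ t, ReflTransGen (SysStep lab next F) s t ∧ lab t = x
  ok : ∀ x, ReflTransGen (SysStep id τ F) (lab s) x → x ∈ F → ok x (τ x)
  acc : ∀ f : ℕ → L, ReflTransGen (SysStep id τ F) (lab s) (f 0) →
    (∀ i, SysStep id τ F (f i) (f (i + 1))) → RabinAccepts keep prog f

section Rabin

variable {S L P : Type*} {lab : S → L} {next : S → Bool → Option S}
  {ok : L → (Bool → Option L) → Prop} {keep prog : P → L → Prop}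

theorem reach_of_reach_diff {F G : Set L} {s t : S}
    (h : ReflTransGen (SysStep lab next (F \ G)) s t) : ReflTransGen (SysStep lab next F) s t :=
  ReflTransGen.mono (fun _ _ h => ⟨h.1.1, h.2⟩) _ _ h

theorem reflTransGen_path {X : Type*} {r : X → X → Prop} {f : ℕ → X} {x : X}
    (h0 : ReflTransGen r x (f 0)) (h : ∀ i, r (f i) (f (i + 1))) (i : ℕ) :
    ReflTransGen r x (f i) := by
  induction i with
  | zero => exact h0
  | succ i ih => exact ih.tail (h i)

open Classical in
-- Play `τ₁` on the labels it reaches from `lab s'`, and `τ₀` elsewhere. The first set is closed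
-- under the moves, so a play either enters it and follows `τ₁` from then on, or avoids it, in
-- particular `lab s'`, and follows `τ₀` throughout.
theorem Wins.merge {F : Set L} {τ₀ τ₁ : L → Bool → Option L} {s s' : S}
    (hs : ReflTransGen (SysStep lab next F) s s')
    (h₁ : Wins lab next ok keep prog F τ₁ s')
    (h₀ : Wins lab next ok keep prog (F \ {lab s'}) τ₀ s) :
    ∃ τ, Wins lab next ok keep prog F τ s := by
  set R : Set L := {x | ReflTransGen (SysStep id τ₁ F) (lab s') x} with hR
  have hRa : lab s' ∈ R := ReflTransGen.refl
  let τ : L → Bool → Option L := fun x => if x ∈ R then τ₁ x else τ₀ x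
  have hin : ∀ x ∈ R, τ x = τ₁ x := fun x hx => if_pos hx
  have hout : ∀ x ∉ R, τ x = τ₀ x := fun x hx => if_neg hx
  have stepIn : ∀ x y, x ∈ R → SysStep id τ F x y → SysStep id τ₁ F x y := by
    rintro x y hx ⟨h, b, hb⟩
    exact ⟨h, b, by rw [← hin x hx]; exact hb⟩
  have stepOut : ∀ x y, x ∉ R → SysStep id τ F x y → SysStep id τ₀ (F \ {lab s'}) x y := by
    rintro x y hx ⟨h, b, hb⟩
    exact ⟨⟨h, fun e => hx (by rw [show x = lab s' from e]; exact hRa)⟩, b,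
      by rw [← hout x hx]; exact hb⟩
  have cover : ∀ x, ReflTransGen (SysStep id τ F) (lab s) x →
      x ∈ R ∨ ReflTransGen (SysStep id τ₀ (F \ {lab s'})) (lab s) x := by
    intro x hx
    induction hx with
    | refl => exact Or.inr .refl
    | @tail x y _ hxy ih =>
      by_cases hx : x ∈ R
      · exact Or.inl (ReflTransGen.tail hx (stepIn x y hx hxy))
      · exact Or.inr ((ih.resolve_left hx).tail (stepOut x y hx hxy))
  refine ⟨τ, ⟨fun x hx => ?_, fun x hx hxF => ?_, fun f h0 hf => ?_⟩⟩
  · rcases cover x hx with h | h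
    · obtain ⟨t, ht, e⟩ := h₁.reach x h
      exact ⟨t, hs.trans ht, e⟩
    · obtain ⟨t, ht, e⟩ := h₀.reach x h
      exact ⟨t, reach_of_reach_diff ht, e⟩
  · by_cases hxR : x ∈ R
    · rw [hin x hxR]; exact h₁.ok x hxR hxF
    · rw [hout x hxR]
      exact h₀.ok x ((cover x hx).resolve_left hxR)
        ⟨hxF, fun e => hxR (by rw [show x = lab s' from e]; exact hRa)⟩
  · by_cases hex : ∃ k, f k ∈ R
    · obtain ⟨k, hk⟩ := hex
      have hall : ∀ i, f (k + i) ∈ R := by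
        intro i
        induction i with
        | zero => exact hk
        | succ i ih => exact ReflTransGen.tail ih (stepIn _ _ ih (hf (k + i)))
      exact .of_tail k (h₁.acc _ hk fun i => stepIn _ _ (hall i) (hf (k + i)))
    · push Not at hex
      exact h₀.acc f ((cover _ h0).resolve_left (hex 0)) fun i => stepOut _ _ (hex i) (hf i)

/-- By the clause `reach`, plays of `τ` only meet labels of states that the system reaches. Hence
they never meet `g`, and it does not matter whether `g` is terminal. -/
theorem Wins.of_unreachable {F : Set L} {τ : L → Bool → Option L} {s : S} {g : L}
    (hg : ∀ t, ReflTransGen (SysStep lab next F) s t → lab t ≠ g)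
    (h : Wins lab next ok keep prog (F \ {g}) τ s) : Wins lab next ok keep prog F τ s := by
  have hne : ∀ x, ReflTransGen (SysStep id τ (F \ {g})) (lab s) x → x ≠ g := by
    intro x hx
    obtain ⟨t, ht, rfl⟩ := h.reach x hx
    exact hg t (reach_of_reach_diff ht)
  have hr : ∀ x, ReflTransGen (SysStep id τ F) (lab s) x →
      ReflTransGen (SysStep id τ (F \ {g})) (lab s) x := by
    intro x hx
    induction hx with
    | refl => exact .refl
    | tail _ hxy ih => exact ih.tail ⟨⟨hxy.1, hne _ ih⟩, hxy.2⟩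
  refine ⟨fun x hx => ?_, fun x hx hxF => h.ok x (hr x hx) ⟨hxF, hne x (hr x hx)⟩,
    fun f h0 hf => h.acc f (hr _ h0) fun i => ⟨⟨(hf i).1, ?_⟩, (hf i).2⟩⟩
  · obtain ⟨t, ht, e⟩ := h.reach x (hr x hx)
    exact ⟨t, reach_of_reach_diff ht, e⟩
  · exact hne _ (hr _ (reflTransGen_path h0 hf i))

open Classical in
/-- Strategies for the successors of `s` yield one for `s`, provided that the label of `s` either
cannot recur or is progressing for a pair that keeps all of `F`. -/
theorem Wins.loop {F : Set L} {s : S}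
    (hok : ok (lab s) fun b => (next s b).map lab) (hs : lab s ∈ F)
    (hloop : ∀ t, TransGen (SysStep lab next F) s t → lab t = lab s →
      ∃ p, (∀ x ∈ F, keep p x) ∧ prog p (lab s))
    (τs : Bool → L → Bool → Option L)
    (h : ∀ b c, next s b = some c → Wins lab next ok keep prog (F \ {lab s}) (τs b) c) :
    ∃ τ, Wins lab next ok keep prog F τ s := by
  set R : Bool → Set L := fun b => {x | ∃ c, next s b = some c ∧
    ReflTransGen (SysStep id (τs b) (F \ {lab s})) (lab c) x} with hR
  -- At the label of `s` the successors of `s` are imitated. Labels reached by both strategies are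
  -- given to the one for `false`.
  let τ : L → Bool → Option L := fun x =>
    if x = lab s then fun b => (next s b).map lab
    else if x ∈ R false then τs false x else τs true x
  have hτs : τ (lab s) = fun b => (next s b).map lab := if_pos rfl
  let side : L → Bool := fun x => if x ∈ R false then false else true
  have hτ : ∀ x, x ≠ lab s → τ x = τs (side x) x := by
    intro x hx
    by_cases hxR : x ∈ R false <;> simp [τ, side, hx, hxR]
  have hside : ∀ x, (∃ b, x ∈ R b) → x ∈ R (side x) := by
    rintro x ⟨b, hb⟩
    by_cases hxR : x ∈ R false
    · simp [side, hxR]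
    · cases b with
      | false => exact absurd hb hxR
      | true => simpa [side, hxR] using hb
  have stepIn : ∀ x y, x ≠ lab s → SysStep id τ F x y →
      SysStep id (τs (side x)) (F \ {lab s}) x y := by
    rintro x y hx ⟨h, b, hb⟩
    exact ⟨⟨h, hx⟩, b, by rw [← hτ x hx]; exact hb⟩
  have stepR : ∀ x y, x ∈ R (side x) → x ≠ lab s → SysStep id τ F x y → y ∈ R (side x) := by
    rintro x y ⟨c, hc, hx⟩ hne hxy
    exact ⟨c, hc, hx.tail (stepIn x y hne hxy)⟩
  have stepS : ∀ y, SysStep id τ F (lab s) y → ∃ b, y ∈ R b := by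
    rintro y ⟨-, b, hb⟩
    rw [hτs] at hb
    obtain ⟨c, hc, rfl⟩ := Option.map_eq_some_iff.1 hb
    exact ⟨b, c, hc, .refl⟩
  have step : ∀ x y, (x = lab s ∨ ∃ b, x ∈ R b) → SysStep id τ F x y → ∃ b, y ∈ R b := by
    intro x y hx hxy
    by_cases hxs : x = lab s
    · exact stepS y (hxs ▸ hxy)
    · exact ⟨_, stepR x y (hside x (hx.resolve_left hxs)) hxs hxy⟩
  have cover : ∀ x, ReflTransGen (SysStep id τ F) (lab s) x → x = lab s ∨ ∃ b, x ∈ R b := by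
    intro x hx
    induction hx with
    | refl => exact Or.inl rfl
    | tail _ hxy ih => exact Or.inr (step _ _ ih hxy)
  have sysR : ∀ x b, x ∈ R b → ∃ t, TransGen (SysStep lab next F) s t ∧ lab t = x := by
    rintro x b ⟨c, hc, hx⟩
    obtain ⟨t, ht, e⟩ := (h b c hc).reach x hx
    exact ⟨t, TransGen.head' ⟨hs, b, hc⟩ (reach_of_reach_diff ht), e⟩
  refine ⟨τ, ⟨fun x hx => ?_, fun x hx hxF => ?_, fun f h0 hf => ?_⟩⟩
  · rcases cover x hx with rfl | ⟨b, hb⟩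
    · exact ⟨s, .refl, rfl⟩
    · obtain ⟨t, ht, e⟩ := sysR x b hb
      exact ⟨t, ht.to_reflTransGen, e⟩
  · by_cases hxs : x = lab s
    · rw [hxs, hτs]; exact hok
    · obtain ⟨c, hc, hr⟩ := hside x ((cover x hx).resolve_left hxs)
      rw [hτ x hxs]
      exact (h _ c hc).ok x hr ⟨hxF, hxs⟩
  · have hcov : ∀ i, f i = lab s ∨ ∃ b, f i ∈ R b := fun i => cover _ (reflTransGen_path h0 hf i)
    by_cases hinf : ∀ M, ∃ i, M ≤ i ∧ f i = lab s
    -- A return to `lab s` corresponds to a recurrence of this label in the system, so `hloop`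
    -- supplies a pair. All labels of the play lie in `F`, hence are kept.
    · obtain ⟨i, hi, e⟩ := hinf 1
      obtain ⟨j, rfl⟩ : ∃ j, i = j + 1 := ⟨i - 1, by omega⟩
      obtain ⟨b, hb⟩ := step _ _ (hcov j) (hf j)
      obtain ⟨t, ht, et⟩ := sysR _ b hb
      obtain ⟨p, hp, hg⟩ := hloop t ht (et.trans e)
      refine ⟨p, 0, fun i _ => hp _ (hf i).1, fun M => ?_⟩
      obtain ⟨i, hi, e⟩ := hinf M
      exact ⟨i, hi, e ▸ hg⟩
    · push Not at hinf
      obtain ⟨M, hM⟩ := hinf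
      have hmem : ∀ i, M ≤ i → f i ∈ R (side (f i)) := fun i hi =>
        hside _ ((hcov i).resolve_left (hM i hi))
      -- Without further visits to `lab s`, a play that is in `R false` once stays there, so the
      -- side changes at most once.
      obtain ⟨k, hk, hconst⟩ : ∃ k, M ≤ k ∧ ∀ i, k ≤ i → side (f i) = side (f k) := by
        by_cases hex : ∃ k, M ≤ k ∧ side (f k) = false
        · obtain ⟨k, hk, e⟩ := hex
          refine ⟨k, hk, fun i hi => ?_⟩
          induction i, hi using Nat.le_induction with
          | base => rfl
          | succ i hi ih =>
            have := stepR _ _ (hmem i (hk.trans hi)) (hM i (hk.trans hi)) (hf i)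
            rw [ih, e] at this
            rw [e]
            exact if_pos this
        · push Not at hex
          exact ⟨M, le_rfl, fun i hi => by
            rw [Bool.eq_true_of_not_eq_false (hex i hi), Bool.eq_true_of_not_eq_false (hex M le_rfl)]⟩
      obtain ⟨c, hc, hr⟩ := hmem k hk
      refine .of_tail k ((h _ c hc).acc _ hr fun i => ?_)
      rw [← hconst (k + i) (by omega)]
      exact stepIn _ _ (hM _ (by omega)) (hf (k + i))

/-- A system with finitely many labels whose infinite paths satisfy a Rabin condition can be
imitated by a positional strategy on the labels. -/
theorem exists_wins (hok : ∀ s, ok (lab s) fun b => (next s b).map lab)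
    (hacc : ∀ f : ℕ → S, (∀ i, ∃ b, next (f i) b = some (f (i + 1))) →
      RabinAccepts keep prog (lab ∘ f)) (F : Set L) (hF : F.Finite) (s : S) :
    ∃ τ, Wins lab next ok keep prog F τ s := by
  induction hn : F.ncard using Nat.strong_induction_on generalizing F s with
  | _ n ih =>
  have ih' : ∀ g ∈ F, ∀ s, ∃ τ, Wins lab next ok keep prog (F \ {g}) τ s := fun g hg s =>
    ih _ (hn ▸ Set.ncard_sdiff_singleton_lt_of_mem hg hF) _ (hF.subset Set.sdiff_subset) s rfl
  by_cases hs : lab s ∈ F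
  swap
  · have hst : ∀ x, ReflTransGen (SysStep id (fun _ _ => none) F) (lab s) x → x = lab s := by
      intro x hx
      induction hx with
      | refl => rfl
      | tail _ h _ => obtain ⟨-, b, hb⟩ := h; simp at hb
    refine ⟨fun _ _ => none, ⟨fun x hx => ⟨s, .refl, (hst x hx).symm⟩,
      fun x hx hxF => absurd (hst x hx ▸ hxF) hs, fun f _ hf => ?_⟩⟩
    obtain ⟨-, b, hb⟩ := hf 0
    simp at hb
  -- It is enough to win from some reachable state: with its label made terminal, the induction
  -- hypothesis covers the way there.
  suffices ∃ s', ReflTransGen (SysStep lab next F) s s' ∧ lab s' ∈ F ∧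
      ∃ τ, Wins lab next ok keep prog F τ s' by
    obtain ⟨s', hss', hs', τ₁, h₁⟩ := this
    obtain ⟨τ₀, h₀⟩ := ih' _ hs' s
    exact h₁.merge hss' h₀
  have loop : ∀ s', lab s' ∈ F → (∀ t, TransGen (SysStep lab next F) s' t → lab t = lab s' →
      ∃ p, (∀ x ∈ F, keep p x) ∧ prog p (lab s')) →
      ∃ τ, Wins lab next ok keep prog F τ s' := by
    intro s' hs' hl
    have : ∀ b, ∃ τ, ∀ c, next s' b = some c →
        Wins lab next ok keep prog (F \ {lab s'}) τ c := by
      intro b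
      cases hc : next s' b with
      | none => exact ⟨fun _ _ => none, fun c h => by simp at h⟩
      | some c =>
        obtain ⟨τ, hτ⟩ := ih' _ hs' c
        exact ⟨τ, fun c' h => by obtain rfl := Option.some.inj h; exact hτ⟩
    choose τs hτs using this
    exact Wins.loop (hok s') hs' hl τs hτs
  -- Either every label of `F` can be visited again and again, and then a single Rabin pair serves
  -- all of `F`; or some label `g` is lost after some state, and `F` can be shrunk.
  by_cases hrec : ∀ s', ReflTransGen (SysStep lab next F) s s' → lab s' ∈ F → ∀ g ∈ F,
      ∃ t, TransGen (SysStep lab next F) s' t ∧ lab t = g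
  · have : Nonempty F := ⟨⟨_, hs⟩⟩
    have : Finite F := hF
    obtain ⟨e, he⟩ := exists_surjective_nat F
    let A := {s' : S // ReflTransGen (SysStep lab next F) s s' ∧ lab s' ∈ F}
    -- Stage `k` heads for the label numbered by the first component of `k` under unpairing, so that
    -- each label is the goal infinitely often.
    have hnx : ∀ (a : A) (k : ℕ), ∃ a' : A, TransGen (SysStep lab next F) a.1 a'.1 ∧
        lab a'.1 = e k.unpair.1 := by
      intro a k
      obtain ⟨t, ht, e'⟩ := hrec a.1 a.2.1 a.2.2 _ (e k.unpair.1).2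
      exact ⟨⟨t, a.2.1.trans ht.to_reflTransGen, by rw [e']; exact (e k.unpair.1).2⟩, ht, e'⟩
    choose nx hnx₁ hnx₂ using hnx
    let a : ℕ → A := fun k => Nat.rec ⟨s, .refl, hs⟩ (fun k a => nx a k) k
    obtain ⟨f, hf, hfa⟩ := exists_path_through (fun k => (a k).1)
      (fun k => hnx₁ (a k) k)
    have hvisit : ∀ g ∈ F, ∀ M, ∃ i, M ≤ i ∧ lab (f i) = g := by
      intro g hg M
      obtain ⟨j, hj⟩ := he ⟨g, hg⟩
      obtain ⟨i, hi, hia⟩ := hfa (Nat.pair j M + 1)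
      refine ⟨i, ?_, ?_⟩
      · have := Nat.right_le_pair j M; omega
      · rw [hia]
        have := hnx₂ (a (Nat.pair j M)) (Nat.pair j M)
        rw [Nat.unpair_pair, hj] at this
        exact this
    obtain ⟨p, N, hk, hp⟩ := hacc f fun i => (hf i).2
    have hkeep : ∀ x ∈ F, keep p x := by
      intro x hx
      obtain ⟨i, hi, e⟩ := hvisit x hx N
      exact e ▸ hk i hi
    obtain ⟨i, -, hpi⟩ := hp 0
    obtain ⟨s', hs', e⟩ : ∃ s', ReflTransGen (SysStep lab next F) s s' ∧ lab s' = lab (f i) := by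
      obtain ⟨t, ht, e⟩ := hrec s .refl hs _ (hf i).1
      exact ⟨t, ht.to_reflTransGen, e⟩
    -- The path visits all of `F` infinitely often, so its pair keeps `F`. The loop is placed at a
    -- state whose label progresses.
    exact ⟨s', hs', e ▸ (hf i).1, loop s' (e ▸ (hf i).1) fun _ _ _ => ⟨p, hkeep, e ▸ hpi⟩⟩
  · push Not at hrec
    obtain ⟨s', hss', hs', g, hg, hno⟩ := hrec
    refine ⟨s', hss', hs', ?_⟩
    by_cases hsg : lab s' = g
    · exact loop s' hs' fun t ht e => absurd (e.trans hsg) (hno t ht)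
    · obtain ⟨τ, hτ⟩ := ih' g hg s'
      refine ⟨τ, hτ.of_unreachable fun t ht => ?_⟩
      rcases (reflTransGen_iff_eq_or_transGen.1 ht) with rfl | ht
      · exact hsg
      · exact hno t ht

end Rabin

/-! ### Binary strings -/

/-- `x` and `y` branch, `x` to the left and `y` to the right. -/
def LeftOf (x y : List Bool) : Prop := ∃ w, w ++ [false] <+: x ∧ w ++ [true] <+: y

theorem prefix_total {x y z : List Bool} (hx : x <+: z) (hy : y <+: z) : x <+: y ∨ y <+: x :=
  (le_total x.length y.length).imp (List.prefix_of_prefix_length_le hx hy)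
    (List.prefix_of_prefix_length_le hy hx)

theorem not_prefix_of_prefix_append {w x : List Bool} {b : Bool} (h : w ++ [b] <+: x)
    (h' : w ++ [!b] <+: x) : False := by
  have := List.prefix_of_prefix_length_le h h' (by simp)
  have := this.eq_of_length (by simp)
  simp at this

/-- The branching point `w` is the longest common prefix of `x` and `y`. -/
theorem prefix_of_branch {z w x y : List Bool} {b : Bool} (hx : w ++ [b] <+: x)
    (hy : w ++ [!b] <+: y) (hzx : z <+: x) (hzy : z <+: y) : z <+: w := by
  rcases prefix_total hx hzx with h | h
  · exact (not_prefix_of_prefix_append (h.trans hzy) hy).elim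
  · rcases List.prefix_concat_iff.1 h with rfl | h
    · exact (not_prefix_of_prefix_append hzy hy).elim
    · exact h

theorem LeftOf.not_isPrefix {x y : List Bool} (h : LeftOf x y) : ¬ x <+: y := by
  obtain ⟨w, hx, hy⟩ := h
  exact fun h => not_prefix_of_prefix_append (hx.trans h) hy

theorem LeftOf.not_isPrefix_symm {x y : List Bool} (h : LeftOf x y) : ¬ y <+: x := by
  obtain ⟨w, hx, hy⟩ := h
  exact fun h => not_prefix_of_prefix_append hx (hy.trans h)

theorem LeftOf.irrefl (x : List Bool) : ¬ LeftOf x x := fun h => h.not_isPrefix (List.prefix_refl _)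

theorem LeftOf.asymm {x y : List Bool} (h : LeftOf x y) (h' : LeftOf y x) : False := by
  obtain ⟨w, hx, hy⟩ := h
  obtain ⟨v, hy', hx'⟩ := h'
  have h1 : w <+: v := prefix_of_branch (b := false) hy' hx'
    ((List.prefix_append _ _).trans hy) ((List.prefix_append _ _).trans hx)
  have h2 : v <+: w := prefix_of_branch (b := false) hx hy
    ((List.prefix_append _ _).trans hx') ((List.prefix_append _ _).trans hy')
  obtain rfl := h1.eq_of_length_le h2.length_le
  exact not_prefix_of_prefix_append hx hx'

theorem prefix_or_leftOf (x y : List Bool) : x <+: y ∨ y <+: x ∨ LeftOf x y ∨ LeftOf y x := by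
  induction x generalizing y with
  | nil => exact Or.inl ⟨_, rfl⟩
  | cons a x ih =>
    cases y with
    | nil => exact Or.inr (Or.inl ⟨_, rfl⟩)
    | cons c y =>
      by_cases hac : a = c
      · subst hac
        rcases ih y with h | h | ⟨w, h, h'⟩ | ⟨w, h, h'⟩
        · exact Or.inl (by simpa using h)
        · exact Or.inr (Or.inl (by simpa using h))
        · exact Or.inr (Or.inr (Or.inl ⟨a :: w, by simpa using h, by simpa using h'⟩))
        · exact Or.inr (Or.inr (Or.inr ⟨a :: w, by simpa using h, by simpa using h'⟩))
      · cases a <;> cases c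
        · simp at hac
        · exact Or.inr (Or.inr (Or.inl ⟨[], by simp, by simp⟩))
        · exact Or.inr (Or.inr (Or.inr ⟨[], by simp, by simp⟩))
        · simp at hac

theorem prefix_or_leftOf_of_lt {x y : List Bool} (h : x < y) : x <+: y ∨ LeftOf x y := by
  induction x generalizing y with
  | nil => exact Or.inl ⟨_, rfl⟩
  | cons a x ih =>
    cases y with
    | nil => exact absurd h (List.not_lt_nil _)
    | cons c y =>
      rcases List.cons_lt_cons_iff.1 h with h₁ | ⟨rfl, h₁⟩
      · obtain ⟨rfl, rfl⟩ := Bool.lt_iff.1 h₁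
        exact Or.inr ⟨[], by simp, by simp⟩
      · rcases ih h₁ with h | ⟨w, h, h'⟩
        · exact Or.inl (by simpa using h)
        · exact Or.inr ⟨a :: w, by simpa using h, by simpa using h'⟩

theorem compressString_append (u : List Bool) (b : Bool) (t : List Bool) :
    compressString u b (u ++ b :: t) = u ++ t := by
  have h : u ++ [b] <+: u ++ b :: t := ⟨t, by simp⟩
  simp [compressString]

theorem compressString_of_not_isPrefix {u : List Bool} {b : Bool} {x : List Bool}
    (h : ¬ u ++ [b] <+: x) : compressString u b x = x := if_neg h

theorem exists_eq_of_concat_isPrefix {u : List Bool} {b : Bool} {x : List Bool}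
    (h : u ++ [b] <+: x) : ∃ t, x = u ++ b :: t := by
  obtain ⟨t, rfl⟩ := h
  exact ⟨t, by simp⟩

/-! ### Rule instances -/

/-- Instances of the rules, without the context. -/
inductive Inst (α : Type*) (n : ℕ) where
  | ax
  | axTop
  | or (φ ψ : Formula α)
  | and (φ ψ : Formula α)
  | box (φ : Formula α)
  | mu (x : α) (φ : Formula α)
  | nu (x : α) (φ : Formula α) (l : Fin n)
  | resolve
  | compress (l : Fin n) (s : List Bool) (b : Bool)

/-- What a rule does to the strings at a fixed position. -/
inductive Act where
  | keep
  | split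
  | comp (s : List Bool) (b : Bool)

/-- In the case `split` the flag itself is the appended bit: `1` for the unfolded formula and `0`
for the context. -/
def Act.map : Act → Bool → List Bool → List Bool
  | keep, _, x => x
  | split, f, x => x ++ [f]
  | comp s b, _, x => compressString s b x

namespace Inst

variable {α : Type*} {n : ℕ}

def rule : Inst α n → Rule n
  | ax => .ax
  | axTop => .axTop
  | or _ _ => .or
  | and _ _ => .and
  | box _ => .box
  | mu _ _ => .mu
  | nu _ _ _ => .nu
  | resolve => .resolve
  | compress l s b => .compress l s b

/-- The instances that leave the formulas unchanged. -/
def Silent : Inst α n → Prop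
  | resolve => True
  | compress _ _ _ => True
  | _ => False

def arity : Inst α n → ℕ
  | ax => 0
  | axTop => 0
  | and _ _ => 2
  | _ => 1

/-- The instance is applicable to sequents with the set `Φ` of formulas. -/
def Avail (Ω : Formula α → ℕ) (Φ : Set (Formula α)) : Inst α n → Prop
  | ax => ∃ p, pos p ∈ Φ ∧ neg p ∈ Φ
  | axTop => top ∈ Φ
  | or φ ψ => φ.or ψ ∈ Φ
  | and φ ψ => φ.and ψ ∈ Φ
  | box φ => φ.box ∈ Φ
  | mu x φ => φ.mu x ∈ Φ
  | nu x φ l => φ.nu x ∈ Φ ∧ Ω (φ.nu x) = 2 * (l : ℕ)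
  | resolve => True
  | compress _ _ _ => True

def act (l : Fin n) : Inst α n → Act
  | nu _ _ l' => if l' = l then .split else .keep
  | compress l' s b => if l' = l then .comp s b else .keep
  | _ => .keep

/-- The value `0` is a placeholder: `Resets` asks for the flag `true`, which traces carry only at
fixpoint unfoldings. -/
def prio (Ω : Formula α → ℕ) : Inst α n → ℕ
  | mu x φ => Ω (φ.mu x)
  | nu x φ _ => Ω (φ.nu x)
  | _ => 0

/-- The strings at position `l` are reset. The flag `f` tells whether the fixpoint formula is
unfolded on the trace under consideration. -/
def Resets (Ω : Formula α → ℕ) (l : Fin n) (I : Inst α n) (f : Bool) : Prop :=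
  f = true ∧ I.prio Ω < 2 * (l : ℕ)

/-- A greatest fixpoint of priority `2 * l` is unfolded. -/
def Hits (l : Fin n) (I : Inst α n) (f : Bool) : Prop :=
  f = true ∧ I.act l = .split

end Inst

/-- `Trace I b χ ψ f`: the formula `ψ` in the `b`-th premise is a descendant of `χ` in the
conclusion; the flag `f` tells whether `χ` is a fixpoint formula that is unfolded. -/
inductive Trace {α : Type*} [DecidableEq α] {n : ℕ} :
    Inst α n → Bool → Formula α → Formula α → Bool → Prop
  | stay (I b χ) (h : ∀ φ, I ≠ .box φ) : Trace I b χ χ false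
  | or_left (φ ψ) : Trace (.or φ ψ) false (φ.or ψ) φ false
  | or_right (φ ψ) : Trace (.or φ ψ) false (φ.or ψ) ψ false
  | and_left (φ ψ) : Trace (.and φ ψ) false (φ.and ψ) φ false
  | and_right (φ ψ) : Trace (.and φ ψ) true (φ.and ψ) ψ false
  | box (φ) : Trace (.box φ) false φ.box φ false
  | dia (φ ψ) : Trace (.box φ) false ψ.dia ψ false
  | mu (x φ) : Trace (.mu x φ) false (φ.mu x) (subst x (φ.mu x) φ) true
  | nu (x φ l) : Trace (.nu x φ l) false (φ.nu x) (subst x (φ.nu x) φ) true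

open Classical in
/-- The annotation of a descendant in terms of that of its parent. -/
noncomputable def annMap {α : Type*} {n : ℕ} (Ω : Formula α → ℕ) (Θ : AnnSequent α n)
    (I : Inst α n) (f : Bool) (σ : Annotation n) : Annotation n :=
  fun l => if I.Resets Ω l f then minLeaf Θ l else (I.act l).map f (σ l)

/-- The formulas of an annotated sequent. -/
def supp {α : Type*} {n : ℕ} (Θ : AnnSequent α n) : Set (Formula α) := {χ | ∃ σ, (χ, σ) ∈ Θ}

section

variable {α : Type*} {n : ℕ} {Ω : Formula α → ℕ} {Θ : AnnSequent α n}

theorem annMap_false_keep {I : Inst α n} (h : ∀ l, I.act l = .keep) (σ : Annotation n) :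
    annMap Ω Θ I false σ = σ := by
  funext l; simp [annMap, Inst.Resets, h, Act.map]

theorem annMap_mu (x : α) (φ : Formula α) (σ : Annotation n) :
    annMap Ω Θ (.mu x φ) true σ = restrict Θ (Ω (φ.mu x)) σ := by
  funext l; simp [annMap, restrict, Inst.Resets, Inst.prio, Inst.act, Act.map]

theorem annMap_nu_true (x : α) (φ : Formula α) (l : Fin n) (hl : Ω (φ.nu x) = 2 * (l : ℕ))
    (σ : Annotation n) : annMap Ω Θ (.nu x φ l) true σ =
      appendBit l true (restrict Θ (Ω (φ.nu x)) σ) := by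
  funext l'
  by_cases h : l' = l
  · subst h; simp [annMap, restrict, Inst.Resets, Inst.prio, Inst.act, Act.map, appendBit, hl]
  · simp [annMap, restrict, Inst.Resets, Inst.prio, Inst.act, Act.map, appendBit, h, Ne.symm h]

theorem annMap_nu_false (x : α) (φ : Formula α) (l : Fin n) (σ : Annotation n) :
    annMap Ω Θ (.nu x φ l) false σ = appendBit l false σ := by
  funext l'
  by_cases h : l' = l
  · subst h; simp [annMap, Inst.Resets, Inst.act, Act.map, appendBit]
  · simp [annMap, Inst.Resets, Inst.act, Act.map, appendBit, h, Ne.symm h]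

theorem annMap_compress (l : Fin n) (s : List Bool) (b : Bool) (σ : Annotation n) :
    annMap Ω Θ (.compress l s b) false σ = compressAnn l s b σ := by
  funext l'
  by_cases h : l' = l
  · subst h; simp [annMap, Inst.Resets, Inst.act, Act.map, compressAnn]
  · simp [annMap, Inst.Resets, Inst.act, Act.map, compressAnn, h, Ne.symm h]

theorem annMap_of_not_resets {I : Inst α n} {l : Fin n} {f : Bool} (h : ¬ I.Resets Ω l f) (σ : Annotation n) :
    annMap Ω Θ I f σ l = (I.act l).map f (σ l) := if_neg h

theorem annMap_of_resets {I : Inst α n} {l : Fin n} {f : Bool} (h : I.Resets Ω l f) (σ : Annotation n) :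
    annMap Ω Θ I f σ l = minLeaf Θ l := if_pos h

/-! ### Prefix-freeness -/

/-- At each position, no string of the sequent is a proper prefix of another one. -/
def PrefixFree (Θ : AnnSequent α n) : Prop :=
  ∀ l, ∀ q ∈ Θ, ∀ q' ∈ Θ, q.2 l <+: q'.2 l → q.2 l = q'.2 l

theorem PrefixFree.leftOf {l : Fin n} (h : PrefixFree Θ) {q q' : Formula α × Annotation n}
    (hq : q ∈ Θ) (hq' : q' ∈ Θ) :
    q.2 l = q'.2 l ∨ LeftOf (q.2 l) (q'.2 l) ∨ LeftOf (q'.2 l) (q.2 l) := by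
  rcases prefix_or_leftOf (q.2 l) (q'.2 l) with h' | h' | hlt
  · exact Or.inl (h l q hq q' hq' h')
  · exact Or.inl (h l q' hq' q hq h').symm
  · exact Or.inr hlt

/-- The minimal leaf is the shortest string of zeros without a proper extension in play. -/
theorem exists_minLeaf (Θ : AnnSequent α n) (l : Fin n) :
    ∃ j, minLeaf Θ l = List.replicate j false ∧
      (∀ b, ¬ InPlay Θ l (List.replicate j false ++ [b])) ∧
      ∀ i, (∀ b, ¬ InPlay Θ l (List.replicate i false ++ [b])) → j ≤ i := by
  have hne : {j | ∀ b, ¬ InPlay Θ l (List.replicate j false ++ [b])}.Nonempty := by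
    refine ⟨Θ.sup fun q => (q.2 l).length, fun b ⟨q, hq, h⟩ => ?_⟩
    have h1 := h.length_le
    have h2 : (q.2 l).length ≤ Θ.sup fun q => (q.2 l).length :=
      Finset.le_sup (f := fun q : Formula α × Annotation n => (q.2 l).length) hq
    simp only [List.length_append, List.length_replicate, List.length_singleton] at h1
    omega
  exact ⟨_, rfl, Nat.sInf_mem hne, fun i hi => Nat.sInf_le hi⟩

theorem minLeaf_length_le {l : Fin n} {B : ℕ} (h : ∀ q ∈ Θ, (q.2 l).length ≤ B) :
    (minLeaf Θ l).length ≤ B := by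
  obtain ⟨j, hj, -, hmin⟩ := exists_minLeaf Θ l
  rw [hj, List.length_replicate]
  refine hmin B fun b ⟨q, hq, h'⟩ => ?_
  have h1 := h'.length_le
  have h2 := h q hq
  simp only [List.length_append, List.length_replicate, List.length_singleton] at h1
  omega

theorem true_not_mem_minLeaf (Θ : AnnSequent α n) (l : Fin n) : true ∉ minLeaf Θ l := by
  simp [minLeaf, List.mem_replicate]

theorem eq_of_minLeaf_isPrefix {l : Fin n} {q : Formula α × Annotation n} (hq : q ∈ Θ)
    (h : minLeaf Θ l <+: q.2 l) : minLeaf Θ l = q.2 l := by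
  obtain ⟨j, hj, hno, -⟩ := exists_minLeaf Θ l
  obtain ⟨t, ht⟩ := h
  cases t with
  | nil => simpa using ht
  | cons b t => exact (hno b ⟨q, hq, t, by rw [← hj, ← ht]; simp⟩).elim

/-- A string of zeros strictly shorter than the minimal leaf has a proper extension in play, by
minimality of the leaf; prefix-freeness forbids that for a string of the sequent. Together with
`eq_of_minLeaf_isPrefix`, resetting a string to the minimal leaf therefore preserves
prefix-freeness. -/
theorem eq_of_prefix_minLeaf (hpf : PrefixFree Θ) {l : Fin n} {q : Formula α × Annotation n}
    (hq : q ∈ Θ) (h : q.2 l <+: minLeaf Θ l) : q.2 l = minLeaf Θ l := by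
  obtain ⟨j, hj, -, hmin⟩ := exists_minLeaf Θ l
  rw [hj] at h ⊢
  obtain ⟨i, -, hi⟩ : ∃ i, i ≤ j ∧ q.2 l = List.replicate i false := by
    rw [List.prefix_iff_eq_take, List.take_replicate] at h
    exact ⟨_, by omega, h⟩
  have : j ≤ i := by
    refine hmin i fun b ⟨q', hq', h'⟩ => ?_
    rw [← hi] at h'
    have := hpf l q hq q' hq' ((List.prefix_append _ _).trans h')
    have := h'.length_le
    simp_all
  exact h.eq_of_length_le (by simpa [hi] using this)

/-- Compression acts on prefix-free sequents by shortening the strings through `u`. -/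
theorem compressString_cases (hpf : PrefixFree Θ) {l : Fin n} {u : List Bool} {b : Bool}
    (h : InPlay Θ l (u ++ [b])) (h' : ¬ InPlay Θ l (u ++ [!b]))
    {q : Formula α × Annotation n} (hq : q ∈ Θ) :
    (∃ t, q.2 l = u ++ b :: t ∧ compressString u b (q.2 l) = u ++ t) ∨
      (¬ u <+: q.2 l ∧ compressString u b (q.2 l) = q.2 l) := by
  by_cases hu : u <+: q.2 l
  · left
    obtain ⟨t, ht⟩ := hu
    cases t with
    | nil =>
      obtain ⟨z, hz, hz'⟩ := h
      rw [List.append_nil] at ht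
      have := hpf l q hq z hz (ht ▸ (List.prefix_append _ _).trans hz')
      have := hz'.length_le
      simp_all
    | cons c t =>
      by_cases hc : c = b
      · subst hc
        exact ⟨t, ht.symm, by rw [← ht, compressString_append]⟩
      · obtain rfl : c = !b := by cases c <;> cases b <;> simp_all
        exact (h' ⟨q, hq, t, by rw [← ht]; simp⟩).elim
  · exact Or.inr ⟨hu, compressString_of_not_isPrefix fun h => hu ((List.prefix_append _ _).trans h)⟩

theorem Inst.act_eq_split {l : Fin n} {I : Inst α n} (h : I.act l = .split) :
    ∃ x φ, I = .nu x φ l := by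
  cases I <;> simp only [Inst.act] at h <;> try simp at h
  · exact ⟨_, _, by rw [h]⟩
  · split at h <;> simp at h

theorem Inst.act_eq_comp {l : Fin n} {u : List Bool} {b : Bool} {I : Inst α n} :
    I.act l = .comp u b ↔ I = .compress l u b := by
  constructor
  · intro h
    cases I <;> simp only [Inst.act] at h <;> try simp at h
    · split at h <;> simp at h
    · split at h <;> simp_all
  · rintro rfl
    simp [Inst.act]

end

/-! ### Descent of formulas and annotations through rule instances -/

section

variable {α : Type*} [DecidableEq α] {n : ℕ} {Ω : Formula α → ℕ} {Θ : AnnSequent α n}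

theorem Trace.eq_of_silent {I : Inst α n} {b f : Bool} {χ χ' : Formula α}
    (h : Trace I b χ χ' f) (hI : I.Silent) : χ' = χ ∧ f = false := by
  cases h <;> simp_all [Inst.Silent]

theorem Trace.traceStep {I : Inst α n} {b f : Bool} {χ χ' : Formula α}
    (h : Trace I b χ χ' f) : χ' = χ ∨ TraceStep χ χ' := by
  cases h with
  | stay => exact Or.inl rfl
  | _ => exact Or.inr (by constructor)

/-- The instance `I` applied to `Θ` yields the premises `prem`, as far as the descent of formulas
is concerned. -/
structure Descends (Ω : Formula α → ℕ) (I : Inst α n) (Θ : AnnSequent α n)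
    (prem : List (AnnSequent α n)) : Prop where
  avail : I.Avail Ω (supp Θ)
  length : prem.length = I.arity
  parent : ∀ (b : Bool) Θ', prem[b.toNat]? = some Θ' → ∀ q' ∈ Θ', ∃ q ∈ Θ, ∃ f,
    Trace I b q.1 q'.1 f ∧ q'.2 = annMap Ω Θ I f q.2
  compress : ∀ l s b, I = .compress l s b →
    InPlay Θ l (s ++ [b]) ∧ ¬ InPlay Θ l (s ++ [!b]) ∧ (b = true → true ∈ s)

/-- The rules, indexed by their instances. -/
inductive InstStep (Ω : Formula α → ℕ) :
    Inst α n → AnnSequent α n → List (AnnSequent α n) → Prop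
  | ax (p : α) (σ τ : Annotation n) (Θ : AnnSequent α n) :
      InstStep Ω .ax (insert (pos p, σ) (insert (neg p, τ) Θ)) []
  | axTop (σ : Annotation n) (Θ : AnnSequent α n) :
      InstStep Ω .axTop (insert (top, σ) Θ) []
  | or (φ ψ : Formula α) (σ : Annotation n) (Θ : AnnSequent α n) :
      InstStep Ω (.or φ ψ) (insert (φ.or ψ, σ) Θ) [insert (φ, σ) (insert (ψ, σ) Θ)]
  | and (φ ψ : Formula α) (σ : Annotation n) (Θ : AnnSequent α n) :
      InstStep Ω (.and φ ψ) (insert (φ.and ψ, σ) Θ) [insert (φ, σ) Θ, insert (ψ, σ) Θ]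
  | box (φ : Formula α) (σ : Annotation n) (Θ Δ : AnnSequent α n) :
      InstStep Ω (.box φ) (insert (φ.box, σ) (Θ.image (fun q => (q.1.dia, q.2)) ∪ Δ))
        [insert (φ, σ) Θ]
  | mu (x : α) (φ : Formula α) (σ : Annotation n) (Θ : AnnSequent α n) :
      InstStep Ω (.mu x φ) (insert (φ.mu x, σ) Θ)
        [insert (subst x (φ.mu x) φ, restrict (insert (φ.mu x, σ) Θ) (Ω (φ.mu x)) σ) Θ]
  | nu (x : α) (φ : Formula α) (σ : Annotation n) (Θ : AnnSequent α n) (l : Fin n)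
      (hl : Ω (φ.nu x) = 2 * (l : ℕ)) :
      InstStep Ω (.nu x φ l) (insert (φ.nu x, σ) Θ)
        [insert (subst x (φ.nu x) φ,
          appendBit l true (restrict (insert (φ.nu x, σ) Θ) (Ω (φ.nu x)) σ))
          (Θ.image (fun q => (q.1, appendBit l false q.2)))]
  | resolve (φ : Formula α) (σ τ : Annotation n) (Θ : AnnSequent α n)
      (hσ : (φ, σ) ∈ Θ) (hτ : (φ, τ) ∈ Θ) (h : AnnLT σ τ) :
      InstStep Ω .resolve Θ [Θ.erase (φ, σ)]
  | compress_zero (l : Fin n) (s : List Bool) (Θ : AnnSequent α n)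
      (h : InPlay Θ l (s ++ [false])) (h' : ¬ InPlay Θ l (s ++ [true])) :
      InstStep Ω (.compress l s false) Θ [Θ.image (fun q => (q.1, compressAnn l s false q.2))]
  | compress_one (l : Fin n) (s : List Bool) (Θ : AnnSequent α n)
      (h : InPlay Θ l (s ++ [true])) (h' : ¬ InPlay Θ l (s ++ [false])) (hs : true ∈ s) :
      InstStep Ω (.compress l s true) Θ [Θ.image (fun q => (q.1, compressAnn l s true q.2))]

theorem InstStep.step {I : Inst α n} {prem : List (AnnSequent α n)} (h : InstStep Ω I Θ prem) :
    Step Ω I.rule Θ prem := by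
  cases h <;> constructor <;> assumption

theorem Step.exists_inst {r : Rule n} {prem : List (AnnSequent α n)} (h : Step Ω r Θ prem) :
    ∃ I : Inst α n, I.rule = r ∧ InstStep Ω I Θ prem := by
  cases h with
  | ax p σ τ Θ => exact ⟨_, rfl, .ax p σ τ Θ⟩
  | axTop σ Θ => exact ⟨_, rfl, .axTop σ Θ⟩
  | or φ ψ σ Θ => exact ⟨_, rfl, .or φ ψ σ Θ⟩
  | and φ ψ σ Θ => exact ⟨_, rfl, .and φ ψ σ Θ⟩
  | box φ σ Θ Δ => exact ⟨_, rfl, .box φ σ Θ Δ⟩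
  | mu x φ σ Θ => exact ⟨_, rfl, .mu x φ σ Θ⟩
  | nu x φ σ Θ l hl => exact ⟨_, rfl, .nu x φ σ Θ l hl⟩
  | resolve φ σ τ Θ hσ hτ h => exact ⟨_, rfl, .resolve φ σ τ Θ hσ hτ h⟩
  | compress_zero l s Θ h h' => exact ⟨_, rfl, .compress_zero l s Θ h h'⟩
  | compress_one l s Θ h h' hs => exact ⟨_, rfl, .compress_one l s Θ h h' hs⟩

theorem InstStep.descends {I : Inst α n} {prem : List (AnnSequent α n)}
    (h : InstStep Ω I Θ prem) : Descends Ω I Θ prem := by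
  cases h with
  | ax p σ τ Θ =>
    refine ⟨⟨p, ⟨σ, by simp⟩, ⟨τ, by simp⟩⟩, rfl, fun b Θ' h => by simp at h,
      fun l s b h => by simp at h⟩
  | axTop σ Θ =>
    exact ⟨⟨σ, by simp⟩, rfl, fun b Θ' h => by simp at h, fun l s b h => by simp at h⟩
  | or φ ψ σ Θ =>
    have hk : ∀ τ, annMap Ω (insert (φ.or ψ, σ) Θ) (.or φ ψ) false τ = τ :=
      annMap_false_keep fun _ => rfl
    refine ⟨⟨σ, by simp⟩, rfl, fun b Θ' h => ?_, fun l s b h => by simp at h⟩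
    cases b <;> simp at h
    subst h
    intro q' hq'
    simp only [Finset.mem_insert] at hq'
    rcases hq' with rfl | rfl | hq'
    · exact ⟨(φ.or ψ, σ), by simp, false, .or_left _ _, (hk _).symm⟩
    · exact ⟨(φ.or ψ, σ), by simp, false, .or_right _ _, (hk _).symm⟩
    · exact ⟨q', by simp [hq'], false, .stay _ _ _ (by simp), (hk _).symm⟩
  | and φ ψ σ Θ =>
    have hk : ∀ τ, annMap Ω (insert (φ.and ψ, σ) Θ) (.and φ ψ) false τ = τ :=
      annMap_false_keep fun _ => rfl
    refine ⟨⟨σ, by simp⟩, rfl, fun b Θ' h => ?_, fun l s b h => by simp at h⟩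
    cases b <;> simp at h <;> subst h <;> intro q' hq' <;> simp only [Finset.mem_insert] at hq' <;>
      rcases hq' with rfl | hq'
    · exact ⟨(φ.and ψ, σ), by simp, false, .and_left _ _, (hk _).symm⟩
    · exact ⟨q', by simp [hq'], false, .stay _ _ _ (by simp), (hk _).symm⟩
    · exact ⟨(φ.and ψ, σ), by simp, false, .and_right _ _, (hk _).symm⟩
    · exact ⟨q', by simp [hq'], false, .stay _ _ _ (by simp), (hk _).symm⟩
  | box φ σ Θ Δ =>
    have hk : ∀ Θ₀ τ, annMap Ω Θ₀ (.box φ : Inst α n) false τ = τ :=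
      fun _ => annMap_false_keep fun _ => rfl
    refine ⟨⟨σ, by simp⟩, rfl, fun b Θ' h => ?_, fun l s b h => by simp at h⟩
    cases b <;> simp at h
    subst h
    intro q' hq'
    simp only [Finset.mem_insert] at hq'
    rcases hq' with rfl | hq'
    · exact ⟨(φ.box, σ), by simp, false, .box _, (hk _ _).symm⟩
    · refine ⟨(q'.1.dia, q'.2), ?_, false, .dia _ _, (hk _ _).symm⟩
      simp only [Finset.mem_insert, Finset.mem_union, Finset.mem_image]
      exact Or.inr (Or.inl ⟨q', hq', rfl⟩)
  | mu x φ σ Θ =>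
    refine ⟨⟨σ, by simp⟩, rfl, fun b Θ' h => ?_, fun l s b h => by simp at h⟩
    cases b <;> simp at h
    subst h
    intro q' hq'
    simp only [Finset.mem_insert] at hq'
    rcases hq' with rfl | hq'
    · exact ⟨(φ.mu x, σ), by simp, true, .mu _ _, (annMap_mu _ _ _).symm⟩
    · exact ⟨q', by simp [hq'], false, .stay _ _ _ (by simp),
        (annMap_false_keep (fun _ => rfl) _).symm⟩
  | nu x φ σ Θ l hl =>
    refine ⟨⟨⟨σ, by simp⟩, hl⟩, rfl, fun b Θ' h => ?_, fun l s b h => by simp at h⟩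
    cases b <;> simp at h
    subst h
    intro q' hq'
    simp only [Finset.mem_insert, Finset.mem_image] at hq'
    rcases hq' with rfl | ⟨q, hq, rfl⟩
    · exact ⟨(φ.nu x, σ), by simp, true, .nu _ _ _, (annMap_nu_true _ _ _ hl _).symm⟩
    · exact ⟨q, by simp [hq], false, .stay _ _ _ (by simp), (annMap_nu_false _ _ _ _).symm⟩
  | resolve φ σ τ Θ hσ hτ h =>
    refine ⟨trivial, rfl, fun b Θ' h => ?_, fun l s b h => by simp at h⟩
    cases b <;> simp at h
    subst h
    intro q' hq'
    exact ⟨q', Finset.mem_of_mem_erase hq', false, .stay _ _ _ (by simp),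
      (annMap_false_keep (fun _ => rfl) _).symm⟩
  | compress_zero l s Θ h h' =>
    refine ⟨trivial, rfl, fun b Θ' h => ?_, fun l' s' b' e => ?_⟩
    · cases b <;> simp at h
      subst h
      intro q' hq'
      obtain ⟨q, hq, rfl⟩ := Finset.mem_image.1 hq'
      exact ⟨q, hq, false, .stay _ _ _ (by simp), (annMap_compress _ _ _ _).symm⟩
    · simp only [Inst.compress.injEq] at e
      obtain ⟨rfl, rfl, rfl⟩ := e
      exact ⟨h, h', by simp⟩
  | compress_one l s Θ h h' hs =>
    refine ⟨trivial, rfl, fun b Θ' h => ?_, fun l' s' b' e => ?_⟩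
    · cases b <;> simp at h
      subst h
      intro q' hq'
      obtain ⟨q, hq, rfl⟩ := Finset.mem_image.1 hq'
      exact ⟨q, hq, false, .stay _ _ _ (by simp), (annMap_compress _ _ _ _).symm⟩
    · simp only [Inst.compress.injEq] at e
      obtain ⟨rfl, rfl, rfl⟩ := e
      exact ⟨h, h', fun _ => hs⟩

variable {I : Inst α n} {prem : List (AnnSequent α n)}

/-- The unfolded formula has priority exactly `2 * l`, and only positions above the priority are
reset. -/
theorem Descends.not_resets_of_split (hd : Descends Ω I Θ prem) {l : Fin n}
    (h : I.act l = .split) (f : Bool) : ¬ I.Resets Ω l f := by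
  obtain ⟨x, φ, rfl⟩ := Inst.act_eq_split h
  rintro ⟨-, h⟩
  have := hd.avail.2
  simp only [Inst.prio] at h
  omega

theorem Trace.not_resets_of_comp {l : Fin n} {u : List Bool} {c b f : Bool} {χ χ' : Formula α}
    (ht : Trace I b χ χ' f) (h : I.act l = .comp u c) : ¬ I.Resets Ω l f := by
  rw [Inst.act_eq_comp] at h
  subst h
  rw [(ht.eq_of_silent trivial).2]
  simp [Inst.Resets]

theorem Descends.prefixFree (hd : Descends Ω I Θ prem) (hpf : PrefixFree Θ) {b : Bool}
    {Θ' : AnnSequent α n} (hb : prem[b.toNat]? = some Θ') : PrefixFree Θ' := by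
  intro l q₁' h₁' q₂' h₂' hp
  obtain ⟨q₁, h₁, f₁, t₁, e₁⟩ := hd.parent b Θ' hb q₁' h₁'
  obtain ⟨q₂, h₂, f₂, t₂, e₂⟩ := hd.parent b Θ' hb q₂' h₂'
  rw [e₁, e₂] at hp ⊢
  cases ha : I.act l with
  | keep =>
    by_cases r₁ : I.Resets Ω l f₁ <;> by_cases r₂ : I.Resets Ω l f₂
    · rw [annMap_of_resets r₁, annMap_of_resets r₂]
    · rw [annMap_of_resets r₁, annMap_of_not_resets r₂, ha] at hp ⊢
      exact eq_of_minLeaf_isPrefix h₂ hp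
    · rw [annMap_of_not_resets r₁, annMap_of_resets r₂, ha] at hp ⊢
      exact eq_of_prefix_minLeaf hpf h₁ hp
    · rw [annMap_of_not_resets r₁, annMap_of_not_resets r₂, ha] at hp ⊢
      exact hpf l q₁ h₁ q₂ h₂ hp
  | split =>
    rw [annMap_of_not_resets (hd.not_resets_of_split ha f₁),
      annMap_of_not_resets (hd.not_resets_of_split ha f₂), ha] at hp ⊢
    simp only [Act.map] at hp ⊢
    rcases List.prefix_concat_iff.1 hp with h | h
    · exact h
    · have := hpf l q₁ h₁ q₂ h₂ ((List.prefix_append _ _).trans h)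
      have := h.length_le
      simp_all
  | comp u c =>
    rw [annMap_of_not_resets (t₁.not_resets_of_comp ha),
      annMap_of_not_resets (t₂.not_resets_of_comp ha), ha] at hp ⊢
    simp only [Act.map] at hp ⊢
    obtain ⟨hc, hc', -⟩ := hd.compress l u c (Inst.act_eq_comp.1 ha)
    rcases compressString_cases hpf hc hc' h₁ with ⟨x, hx, ex⟩ | ⟨hx, ex⟩ <;>
      rcases compressString_cases hpf hc hc' h₂ with ⟨y, hy, ey⟩ | ⟨hy, ey⟩ <;>
      rw [ex, ey] at hp ⊢
    · rw [List.prefix_append_right_inj] at hp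
      have := hpf l q₁ h₁ q₂ h₂ (by rw [hx, hy]; simpa using hp)
      simp_all
    · exact (hy ((List.prefix_append _ _).trans hp)).elim
    · rcases prefix_total hp (List.prefix_append u y) with h | h
      · have := hpf l q₁ h₁ q₂ h₂ (h.trans (hy ▸ List.prefix_append _ _))
        exact (hx (this ▸ hy ▸ List.prefix_append _ _)).elim
      · exact (hx h).elim
    · exact hpf l q₁ h₁ q₂ h₂ hp

theorem Descends.supp_subset (hd : Descends Ω I Θ prem) (hI : I.Silent) {b : Bool}
    {Θ' : AnnSequent α n} (hb : prem[b.toNat]? = some Θ') : supp Θ' ⊆ supp Θ := by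
  rintro χ ⟨σ, hσ⟩
  obtain ⟨q, hq, f, ht, -⟩ := hd.parent b Θ' hb _ hσ
  obtain ⟨rfl : χ = q.1, -⟩ := ht.eq_of_silent hI
  exact ⟨q.2, hq⟩

end

/-! ### The lemma of König -/

/-- If each of the finitely many `x` failed at some stage, then all of them would fail at the
largest of these stages. -/
theorem exists_forall_of_antitone {X : Type*} {A : Set X} (hA : A.Finite) {D : ℕ → X → Prop}
    (hD : ∀ j x, D (j + 1) x → D j x) (h : ∀ j, ∃ x ∈ A, D j x) : ∃ x ∈ A, ∀ j, D j x := by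
  by_contra hcon
  push Not at hcon
  choose! j hj using hcon
  have hanti : ∀ x i k, i ≤ k → D k x → D i x := by
    intro x i k hik
    induction k, hik using Nat.le_induction with
    | base => exact id
    | succ k _ ih => exact fun h => ih (hD k x h)
  obtain ⟨m, hm⟩ := (hA.image j).bddAbove
  obtain ⟨x, hx, hDx⟩ := h m
  exact hj x hx (hanti x _ _ (hm ⟨x, hx, rfl⟩) hDx)

/-- A chain of length `j` in the layers `A i`, `A (i + 1)`, … starts at `x`. -/
def HasChain {X : Type*} (A : ℕ → Set X) (R : ℕ → X → X → Prop) : ℕ → ℕ → X → Prop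
  | 0, i, x => x ∈ A i
  | j + 1, i, x => x ∈ A i ∧ ∃ y, R i x y ∧ HasChain A R j (i + 1) y

/-- Following parents backwards gives chains of every length starting in layer `0`. By finiteness
some element starts arbitrarily long ones, and one of its successors again does. -/
theorem konig {X : Type*} (A : ℕ → Set X) (R : ℕ → X → X → Prop) (hfin : ∀ i, (A i).Finite)
    (hne : ∀ i, (A i).Nonempty) (hpar : ∀ i, ∀ y ∈ A (i + 1), ∃ x ∈ A i, R i x y) :
    ∃ f : ℕ → X, ∀ i, f i ∈ A i ∧ R i (f i) (f (i + 1)) := by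
  have hmem : ∀ j i x, HasChain A R j i x → x ∈ A i := by
    intro j i x h
    cases j with
    | zero => exact h
    | succ j => exact h.1
  have hanti : ∀ j i x, HasChain A R (j + 1) i x → HasChain A R j i x := by
    intro j
    induction j with
    | zero => exact fun i x h => h.1
    | succ j ih =>
      rintro i x ⟨hx, y, hxy, hy⟩
      exact ⟨hx, y, hxy, ih _ _ hy⟩
  have hex : ∀ j i, ∀ y ∈ A (i + j), ∃ x, HasChain A R j i x := by
    intro j
    induction j with
    | zero => exact fun i y hy => ⟨y, hy⟩
    | succ j ih =>
      intro i y hy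
      obtain ⟨x', hx'⟩ := ih (i + 1) y (by rwa [show i + 1 + j = i + (j + 1) by omega])
      obtain ⟨x, hx, hxx'⟩ := hpar i x' (hmem _ _ _ hx')
      exact ⟨x, hx, x', hxx', hx'⟩
  obtain ⟨x₀, -, hx₀⟩ := exists_forall_of_antitone (D := fun j x => HasChain A R j 0 x) (hfin 0)
    (fun j x => hanti j 0 x) fun j => by
      obtain ⟨y, hy⟩ := hne (0 + j)
      obtain ⟨x, hx⟩ := hex j 0 y hy
      exact ⟨x, hmem _ _ _ hx, hx⟩
  have hnext : ∀ i x, (∀ j, HasChain A R j i x) →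
      ∃ y, R i x y ∧ ∀ j, HasChain A R j (i + 1) y := by
    intro i x hx
    obtain ⟨y, -, hy⟩ := exists_forall_of_antitone
      (D := fun j y => R i x y ∧ HasChain A R j (i + 1) y) (hfin (i + 1))
      (fun j y h => ⟨h.1, hanti j _ y h.2⟩) fun j => by
        obtain ⟨-, y, hxy, hy⟩ := hx (j + 1)
        exact ⟨y, hmem _ _ _ hy, hxy, hy⟩
    exact ⟨y, (hy 0).1, fun j => (hy j).2⟩
  choose! nx hnx₁ hnx₂ using hnext
  let f : ℕ → X := fun i => Nat.rec x₀ (fun i x => nx i x) i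
  have hf : ∀ i j, HasChain A R j i (f i) := by
    intro i
    induction i with
    | zero => exact hx₀
    | succ i ih => exact hnx₂ i (f i) ih
  exact ⟨f, fun i => ⟨hf i 0, hnx₁ i (f i) (hf i)⟩⟩

/-! ### Action of the rules on strings -/

/-- Two copies of the same string can only be separated by appending different bits, and the right
copy is the one that receives `1`. -/
theorem Act.hit_of_leftOf_map {A : Act} {f₁ f₂ : Bool} {x : List Bool}
    (h : LeftOf (A.map f₁ x) (A.map f₂ x)) : f₂ = true ∧ A = .split := by
  cases A with
  | keep => exact (LeftOf.irrefl _ h).elim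
  | comp => exact (LeftOf.irrefl _ h).elim
  | split =>
    refine ⟨?_, rfl⟩
    by_contra hf
    obtain rfl : f₂ = false := by simpa using hf
    cases f₁ with
    | false => exact LeftOf.irrefl _ h
    | true => exact LeftOf.asymm h ⟨x, by simp [Act.map], by simp [Act.map]⟩

theorem Act.count_map_le {A : Act} {f : Bool} (x : List Bool) (h : ¬ (f = true ∧ A = .split)) :
    (A.map f x).count true ≤ x.count true := by
  cases A with
  | keep => exact le_rfl
  | split => cases f <;> simp_all [Act.map]
  | comp u b =>
    by_cases hu : u ++ [b] <+: x
    · obtain ⟨t, rfl⟩ := exists_eq_of_concat_isPrefix hu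
      simp only [Act.map, compressString_append, List.count_append, List.count_cons]
      omega
    · simp only [Act.map]
      rw [compressString_of_not_isPrefix hu]

section

variable {α : Type*} [DecidableEq α] {n : ℕ} {Ω : Formula α → ℕ} {Θ : AnnSequent α n}
  {I : Inst α n} {prem : List (AnnSequent α n)}

/-- Compression at `u` removes a bit at which no two strings branch, since the sibling of the
removed bit is not in play. Branchings strictly above or below it survive with their orientation. -/
theorem Descends.leftOf_map (hd : Descends Ω I Θ prem) (hpf : PrefixFree Θ) {l : Fin n}
    {q₁ q₂ : Formula α × Annotation n} (h₁ : q₁ ∈ Θ) (h₂ : q₂ ∈ Θ)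
    (h : LeftOf (q₁.2 l) (q₂.2 l)) (f₁ f₂ : Bool) :
    LeftOf ((I.act l).map f₁ (q₁.2 l)) ((I.act l).map f₂ (q₂.2 l)) := by
  cases ha : I.act l with
  | keep => exact h
  | split =>
    obtain ⟨w, hx, hy⟩ := h
    exact ⟨w, hx.trans (List.prefix_append _ _), hy.trans (List.prefix_append _ _)⟩
  | comp u c =>
    obtain ⟨hc, hc', -⟩ := hd.compress l u c (Inst.act_eq_comp.1 ha)
    obtain ⟨w, hw₁, hw₂⟩ := h
    have aux : ∀ (d : Bool) (t x y : List Bool), x = u ++ c :: t → w ++ [d] <+: x →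
        w ++ [!d] <+: y → ¬ u <+: y → w ++ [d] <+: u ++ t := by
      rintro d t x y rfl hx hy hu
      rcases prefix_total hx (List.prefix_append u (c :: t)) with h | h
      · exact h.trans (List.prefix_append _ _)
      · rcases List.prefix_concat_iff.1 h with rfl | h
        · exact List.prefix_append _ _
        · exact (hu (h.trans ((List.prefix_append _ _).trans hy))).elim
    simp only [Act.map]
    rcases compressString_cases hpf hc hc' h₁ with ⟨x, hx, ex⟩ | ⟨hx, ex⟩ <;>
      rcases compressString_cases hpf hc hc' h₂ with ⟨y, hy, ey⟩ | ⟨hy, ey⟩ <;>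
      rw [ex, ey]
    · rw [hx] at hw₁
      rw [hy] at hw₂
      obtain ⟨v, rfl⟩ : u ++ [c] <+: w := prefix_of_branch (b := false) hw₁ hw₂ ⟨x, by simp⟩
        ⟨y, by simp⟩
      simp only [List.append_assoc, List.prefix_append_right_inj, List.cons_append,
        List.nil_append, List.prefix_cons_inj] at hw₁ hw₂
      exact ⟨u ++ v, by simpa using hw₁, by simpa using hw₂⟩
    · exact ⟨w, aux false _ _ _ hx hw₁ hw₂ hy, hw₂⟩
    · exact ⟨w, hw₁, aux true _ _ _ hy hw₂ hw₁ hx⟩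
    · exact ⟨w, hw₁, hw₂⟩

/-- While `s` is preserved, no string enters the subtree of `s` from outside, except possibly by a
reset: a proper prefix of `s` is not itself a string, so appending a bit cannot produce `s`, and
compressions act at or beyond `s` or off its path. -/
theorem Descends.prefix_of_prefix_map (hd : Descends Ω I Θ prem) (hpf : PrefixFree Θ) {l : Fin n}
    {q : Formula α × Annotation n} (hq : q ∈ Θ) {s : List Bool} (hs : InPlay Θ l s)
    (hc : ∀ u c, I = .compress l u c → ¬ (u <+: s ∧ u ≠ s)) {f : Bool}
    (h : s <+: (I.act l).map f (q.2 l)) : s <+: q.2 l := by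
  cases ha : I.act l with
  | keep => rwa [ha] at h
  | split =>
    rw [ha] at h
    rcases List.prefix_concat_iff.1 h with rfl | h
    · obtain ⟨z, hz, hzs⟩ := hs
      have := hpf l q hq z hz ((List.prefix_append _ _).trans hzs)
      have := hzs.length_le
      simp_all
    · exact h
  | comp u c =>
    rw [ha] at h
    obtain ⟨h1, h1', -⟩ := hd.compress l u c (Inst.act_eq_comp.1 ha)
    simp only [Act.map] at h
    rcases compressString_cases hpf h1 h1' hq with ⟨x, hx, ex⟩ | ⟨hx, ex⟩
    · rw [ex] at h
      rw [hx]
      rcases prefix_total h (List.prefix_append u x) with h | h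
      · exact h.trans (List.prefix_append _ _)
      · have : u = s := by
          by_contra hne
          exact hc u c (Inst.act_eq_comp.1 ha) ⟨h, hne⟩
        subst this
        exact List.prefix_append _ _
    · rwa [ex] at h

/-! ### Successful branches carry good traces -/

/-- Follow the leftmost infinite trace through `s`. If it were hit only finitely often, everything
to its left would die out, since new strings on its left only split off at a hit. It then runs
through every string `s0…01` that is compressed, and each such compression deletes one of its `1`s.
But without hits the number of `1`s never grows. -/
theorem exists_trace_of_successful_aux {Θ : ℕ → AnnSequent α n} {I : ℕ → Inst α n} {b : ℕ → Bool}
    {prem : ℕ → List (AnnSequent α n)} (hd : ∀ i, Descends Ω (I i) (Θ i) (prem i))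
    (hb : ∀ i, (prem i)[(b i).toNat]? = some (Θ (i + 1))) (hpf : ∀ i, PrefixFree (Θ i))
    {l : Fin n} {s : List Bool} (hs : ∀ i, InPlay (Θ i) l s)
    (hc : ∀ i u c, I i = .compress l u c → ¬ (u <+: s ∧ u ≠ s))
    (hprog : ∀ M, ∃ i, M ≤ i ∧ ∃ j, I i = .compress l (s ++ List.replicate j false) true) :
    ∃ (χ : ℕ → Formula α) (f : ℕ → Bool),
      (∀ i, χ i ∈ supp (Θ i) ∧ Trace (I i) (b i) (χ i) (χ (i + 1)) (f i) ∧
        ¬ (I i).Resets Ω l (f i)) ∧ ∀ M, ∃ i, M ≤ i ∧ (I i).Hits l (f i) := by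
  -- The side condition of the compression of a `1` puts a `1` into `s0…0`, hence into `s`. The
  -- minimal leaf consists of zeros, so resets never lead into the subtree of `s`.
  have htrue : true ∈ s := by
    obtain ⟨i, -, j, e⟩ := hprog 0
    obtain ⟨-, -, h⟩ := (hd i).compress _ _ _ e
    simpa [List.mem_replicate] using h rfl
  let F : ℕ → Set (Formula α × Annotation n) := fun i => {q | q ∈ Θ i ∧ s <+: q.2 l}
  have hFfin : ∀ i, (F i).Finite := fun i => (Θ i).finite_toSet.subset fun q hq => hq.1
  let RR : ℕ → Formula α × Annotation n → Formula α × Annotation n → Bool → Prop :=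
    fun i q q' f => Trace (I i) (b i) q.1 q'.1 f ∧ ¬ (I i).Resets Ω l f ∧
      q'.2 l = ((I i).act l).map f (q.2 l)
  let R : ℕ → Formula α × Annotation n → Formula α × Annotation n → Prop :=
    fun i q q' => ∃ f, RR i q q' f
  have hpar : ∀ i, ∀ q' ∈ F (i + 1), ∃ q ∈ F i, R i q q' := by
    rintro i q' ⟨hq', hsq'⟩
    obtain ⟨q, hq, f, ht, e⟩ := (hd i).parent _ _ (hb i) q' hq'
    have hr : ¬ (I i).Resets Ω l f := by
      intro hr
      rw [e, annMap_of_resets hr] at hsq'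
      exact true_not_mem_minLeaf _ _ (hsq'.subset htrue)
    have e' : q'.2 l = ((I i).act l).map f (q.2 l) := by rw [e, annMap_of_not_resets hr]
    rw [e'] at hsq'
    exact ⟨q, ⟨hq, (hd i).prefix_of_prefix_map (hpf i) hq (hs i) (hc i) hsq'⟩, f, ht, hr, e'⟩
  have hFne : ∀ i, (F i).Nonempty := fun i => by
    obtain ⟨q, hq, h⟩ := hs i
    exact ⟨q, hq, h⟩
  have hleft : ∀ i q₁ q₂ q₁' q₂', q₁ ∈ Θ i → q₂ ∈ Θ i → R i q₁ q₁' → R i q₂ q₂' →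
      LeftOf (q₁.2 l) (q₂.2 l) → LeftOf (q₁'.2 l) (q₂'.2 l) := by
    rintro i q₁ q₂ q₁' q₂' h₁ h₂ ⟨f₁, -, -, e₁⟩ ⟨f₂, -, -, e₂⟩ h
    rw [e₁, e₂]
    exact (hd i).leftOf_map (hpf i) h₁ h₂ h _ _
  -- The formulas at which an infinite trace through `s` starts.
  let G : ℕ → Set (Formula α × Annotation n) := fun i =>
    {q | ∃ g : ℕ → Formula α × Annotation n, g 0 = q ∧
      ∀ k, g k ∈ F (i + k) ∧ R (i + k) (g k) (g (k + 1))}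
  have hGF : ∀ i, G i ⊆ F i := by
    rintro i q ⟨g, rfl, hg⟩
    exact (hg 0).1
  have hGne : ∀ i, (G i).Nonempty := by
    intro i
    obtain ⟨g, hg⟩ := konig (fun k => F (i + k)) (fun k => R (i + k)) (fun k => hFfin _)
      (fun k => hFne _) (fun k => hpar (i + k))
    exact ⟨g 0, g, rfl, hg⟩
  have hGchild : ∀ i, ∀ q ∈ G i, ∃ q' ∈ G (i + 1), R i q q' := by
    rintro i q ⟨g, rfl, hg⟩
    refine ⟨g 1, ⟨fun k => g (k + 1), rfl, fun k => ?_⟩, (hg 0).2⟩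
    have := hg (k + 1)
    rwa [show i + (k + 1) = i + 1 + k by omega] at this
  have hGpar : ∀ i, ∀ q' ∈ G (i + 1), ∃ q ∈ G i, R i q q' := by
    rintro i q' hq'
    obtain ⟨q, hq, hqq'⟩ := hpar i q' (hGF _ hq')
    obtain ⟨g, rfl, hg⟩ := hq'
    refine ⟨q, ⟨fun k => Nat.casesOn k q g, rfl, fun k => ?_⟩, hqq'⟩
    cases k with
    | zero => exact ⟨hq, hqq'⟩
    | succ k =>
      have := hg k
      rwa [show i + 1 + k = i + (k + 1) by omega] at this
  let Lm : ℕ → Set (Formula α × Annotation n) := fun i =>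
    {q | q ∈ G i ∧ ∀ q' ∈ G i, ¬ LeftOf (q'.2 l) (q.2 l)}
  have hLne : ∀ i, (Lm i).Nonempty := by
    intro i
    obtain ⟨q, hq, hmin⟩ := Set.exists_min_image (G i) (fun q => q.2 l)
      ((hFfin i).subset (hGF i)) (hGne i)
    refine ⟨q, hq, fun q' hq' h => ?_⟩
    rcases (hmin q' hq').lt_or_eq with hlt | heq
    · rcases prefix_or_leftOf_of_lt hlt with h' | h'
      · exact h.not_isPrefix_symm h'
      · exact h.asymm h'
    · rw [heq] at h
      exact LeftOf.irrefl _ h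
  -- Something infinite to the left of the parent would have an infinite child to the left of `q'`.
  have hLpar : ∀ i, ∀ q' ∈ Lm (i + 1), ∃ q ∈ Lm i, R i q q' := by
    rintro i q' ⟨hq', hmin⟩
    obtain ⟨q, hq, hqq'⟩ := hGpar i q' hq'
    refine ⟨q, ⟨hq, fun z hz hzq => ?_⟩, hqq'⟩
    obtain ⟨z', hz', hzz'⟩ := hGchild i z hz
    exact hmin z' hz' (hleft i z q z' q' (hGF _ hz).1 (hGF _ hq).1 hzz' hqq' hzq)
  obtain ⟨g, hg⟩ := konig Lm R (fun i => (hFfin i).subset fun q hq => hGF i hq.1) hLne hLpar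
  choose hgL f hf using hg
  have hgF : ∀ i, g i ∈ F i := fun i => hGF i (hgL i).1
  refine ⟨fun i => (g i).1, f, fun i => ⟨⟨(g i).2, (hgF i).1⟩, (hf i).1, (hf i).2.1⟩, ?_⟩
  by_contra hcon
  push Not at hcon
  obtain ⟨T, hT⟩ := hcon
  -- The formulas through `s` to the left of the chosen trace. If these layers never became empty,
  -- König's lemma would give an infinite trace further left.
  let Z : ℕ → Set (Formula α × Annotation n) := fun i =>
    {q | q ∈ F i ∧ LeftOf (q.2 l) ((g i).2 l)}
  have hZpar : ∀ i, T ≤ i → ∀ q' ∈ Z (i + 1), ∃ q ∈ Z i, R i q q' := by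
    rintro i hi q' ⟨hq', hlt⟩
    obtain ⟨q, hq, hqq'⟩ := hpar i q' hq'
    refine ⟨q, ⟨hq, ?_⟩, hqq'⟩
    rcases (hpf i).leftOf (l := l) hq.1 (hgF i).1 with h | h | h
    · obtain ⟨f', -, -, e'⟩ := hqq'
      rw [e', (hf i).2.2, h] at hlt
      exact (hT i hi (Act.hit_of_leftOf_map hlt)).elim
    · exact h
    · exact (hlt.asymm (hleft i _ _ _ _ (hgF i).1 hq.1 ⟨_, hf i⟩ hqq' h)).elim
  obtain ⟨k, hk⟩ : ∃ k, Z (T + k) = ∅ := by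
    by_contra hne
    push Not at hne
    obtain ⟨z, hz⟩ := konig (fun k => Z (T + k)) (fun k => R (T + k))
      (fun k => (hFfin _).subset fun q hq => hq.1) (fun k => hne k)
      (fun k => hZpar (T + k) (by omega))
    exact (hgL T).2 (z 0) ⟨z, rfl, fun k => ⟨(hz k).1.1, (hz k).2⟩⟩ (hz 0).1.2
  have hZ : ∀ i, T + k ≤ i → Z i = ∅ := by
    intro i hi
    induction i, hi using Nat.le_induction with
    | base => exact hk
    | succ i hi ih =>
      refine Set.eq_empty_of_forall_notMem fun q' hq' => ?_
      obtain ⟨q, hq, -⟩ := hZpar i (by omega) q' hq'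
      rw [ih] at hq
      exact hq
  let c : ℕ → ℕ := fun i => ((g i).2 l).count true
  have hanti : ∀ i, T ≤ i → c (i + 1) ≤ c i := by
    intro i hi
    simp only [c]
    rw [(hf i).2.2]
    exact Act.count_map_le _ (hT i hi)
  obtain ⟨i₀, hi₀, hmin⟩ := exists_minimalFor_of_wellFoundedLT (fun i => T + k ≤ i) c ⟨T + k, le_rfl⟩
  have hle : ∀ i, i₀ ≤ i → c i ≤ c i₀ := by
    intro i hi
    induction i, hi using Nat.le_induction with
    | base => exact le_rfl
    | succ i hi ih => exact (hanti i (by omega)).trans ih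
  obtain ⟨i, hi, j, e⟩ := hprog i₀
  obtain ⟨⟨q, hq, hqt⟩, hno, -⟩ := (hd i).compress _ _ _ e
  have hsq : s <+: q.2 l := (List.prefix_append _ _).trans ((List.prefix_append _ _).trans hqt)
  -- Some `q` runs through `s0…01`. It is not left of the trace, and if it is to the right, the two
  -- branch beyond this string: branching earlier would need a `1` among the zeros or the excluded
  -- sibling `s0…00`.
  have hpre : s ++ List.replicate j false ++ [true] <+: (g i).2 l := by
    rcases (hpf i).leftOf (l := l) hq (hgF i).1 with h | h | ⟨w, hw, hw'⟩
    · rwa [← h]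
    · have : q ∈ Z i := ⟨⟨hq, hsq⟩, h⟩
      rw [hZ i (by omega)] at this
      exact this.elim
    · obtain ⟨v, rfl⟩ : s <+: w := prefix_of_branch (b := false) hw hw' (hgF i).2 hsq
      rcases prefix_total hw' hqt with h | h
      · simp only [List.append_assoc, List.prefix_append_right_inj] at h
        rcases List.prefix_concat_iff.1 h with h | h
        · obtain rfl := List.append_inj_left' h rfl
          exact (hno ⟨g i, (hgF i).1, hw⟩).elim
        · have : true ∈ List.replicate j false := h.subset (by simp)
          simp [List.mem_replicate] at this
      · rcases List.prefix_concat_iff.1 h with h | h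
        · rw [List.append_inj_left' h rfl] at hno
          exact (hno ⟨g i, (hgF i).1, hw⟩).elim
        · exact h.trans ((List.prefix_append _ _).trans hw)
  have hlt : c (i + 1) < c i := by
    obtain ⟨t, ht⟩ := exists_eq_of_concat_isPrefix hpre
    simp only [c]
    rw [(hf i).2.2, Inst.act_eq_comp.2 e]
    simp only [Act.map]
    rw [ht, compressString_append]
    simp
  have hi' : T + k ≤ i + 1 := le_trans (le_trans hi₀ hi) (Nat.le_succ i)
  have h1 := hle i hi
  have h2 := hmin hi' (by omega)
  omega

/-- A branch on which `(l, s)` is eventually preserved and progresses infinitely often carries a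
trace on which eventually no fixpoint of priority below `2 * l`, and infinitely often a greatest
fixpoint of priority `2 * l`, is unfolded. -/
theorem exists_trace_of_successful {Θ : ℕ → AnnSequent α n} {I : ℕ → Inst α n} {b : ℕ → Bool}
    {prem : ℕ → List (AnnSequent α n)} (hd : ∀ i, Descends Ω (I i) (Θ i) (prem i))
    (hb : ∀ i, (prem i)[(b i).toNat]? = some (Θ (i + 1))) (hpf : ∀ i, PrefixFree (Θ i))
    {l : Fin n} {s : List Bool} {N : ℕ} (hs : ∀ i, N ≤ i → InPlay (Θ i) l s)
    (hc : ∀ i, N ≤ i → ∀ u c, I i = .compress l u c → ¬ (u <+: s ∧ u ≠ s))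
    (hprog : ∀ M, ∃ i, M ≤ i ∧ ∃ j, I i = .compress l (s ++ List.replicate j false) true) :
    ∃ (χ : ℕ → Formula α) (f : ℕ → Bool),
      (∀ i, N ≤ i → χ i ∈ supp (Θ i) ∧ Trace (I i) (b i) (χ i) (χ (i + 1)) (f i) ∧
        ¬ (I i).Resets Ω l (f i)) ∧ ∀ M, ∃ i, M ≤ i ∧ (I i).Hits l (f i) := by
  obtain ⟨χ, f, h, h'⟩ := exists_trace_of_successful_aux (Θ := fun i => Θ (N + i))
    (I := fun i => I (N + i)) (b := fun i => b (N + i)) (prem := fun i => prem (N + i))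
    (fun i => hd _) (fun i => hb _) (fun i => hpf _) (fun i => hs _ (by omega))
    (fun i => hc _ (by omega)) (fun M => by
      obtain ⟨i, hi, hj⟩ := hprog (N + M)
      exact ⟨i - N, by omega, by rwa [show N + (i - N) = i by omega]⟩)
  refine ⟨fun i => χ (i - N), fun i => f (i - N), fun i hi => ?_, fun M => ?_⟩
  · obtain ⟨k, rfl⟩ := Nat.exists_eq_add_of_le hi
    have := h k
    simpa [show N + k + 1 - N = k + 1 by omega] using this
  · obtain ⟨i, hi, hh⟩ := h' M
    exact ⟨N + i, by omega, by simpa using hh⟩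

end

/-! ### Evolution of a single string -/

/-- The string `y` has been obtained from `x` by moving to the right. -/
def MovesRight (x y : List Bool) : Prop :=
  ∃ w, w ++ [true] <+: y ∧ (x = w ∨ w ++ [false] <+: x)

theorem concat_prefix_replicate {v : List Bool} {b : Bool} {a : ℕ}
    (h : v ++ [b] <+: List.replicate a false) :
    v = List.replicate v.length false ∧ b = false ∧ v.length < a := by
  have hm : ∀ c ∈ v ++ [b], c = false := fun c hc => by
    simpa using (List.mem_replicate.1 (h.subset hc)).2
  refine ⟨List.eq_replicate_of_mem fun c hc => hm c (by simp [hc]), hm b (by simp), ?_⟩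
  have := h.length_le
  simpa using this

/-- The bit `b` after `v` lies before, at, or after the first `1` of `y`. -/
theorem concat_prefix_cases {v y : List Bool} {b : Bool} {a : ℕ} (h : v ++ [b] <+: y)
    (h' : List.replicate a false ++ [true] <+: y) :
    (v = List.replicate v.length false ∧ b = false ∧ v.length < a) ∨
      (v = List.replicate a false ∧ b = true) ∨ List.replicate a false ++ [true] <+: v := by
  rcases prefix_total h h' with h | h
  · rcases List.prefix_concat_iff.1 h with h | h
    · exact Or.inr (Or.inl ⟨List.append_inj_left' h rfl, by simpa using List.append_inj_right' h rfl⟩)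
    · exact Or.inl (concat_prefix_replicate h)
  · rcases List.prefix_concat_iff.1 h with h | h
    · exact Or.inr (Or.inl ⟨(List.append_inj_left' h rfl).symm,
        by simpa using (List.append_inj_right' h rfl).symm⟩)
    · exact Or.inr (Or.inr h)

theorem eq_replicate_of_no_true {y : List Bool}
    (h : ∀ a, ¬ List.replicate a false ++ [true] <+: y) : ∃ k, y = List.replicate k false := by
  induction y with
  | nil => exact ⟨0, rfl⟩
  | cons c y ih =>
    cases c with
    | true => exact (h 0 (by simp)).elim
    | false =>
      obtain ⟨k, rfl⟩ := ih fun a ha => h (a + 1) (by simpa [List.replicate_succ] using ha)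
      exact ⟨k + 1, rfl⟩

/-- A string of bounded length that evolves by appending bits, by compression, and by moving to the
right has a prefix that is eventually preserved and progresses infinitely often, or it eventually
stops moving to the right. -/
theorem exists_progress_or_not_movesRight {x : ℕ → List Bool} {A : ℕ → Act} {N B : ℕ}
    (hB : ∀ j, N ≤ j → (x j).length ≤ B)
    (hstep : ∀ j, N ≤ j → x (j + 1) = x j ∨ x (j + 1) = x j ++ [false] ∨
      (∃ u b, A j = .comp u b) ∨ MovesRight (x j) (x (j + 1)))
    (hcomp : ∀ j, N ≤ j → ∀ u b, A j = .comp u b →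
      x (j + 1) = compressString u b (x j) ∧ ¬ u ++ [!b] <+: x j) :
    (∃ s N', (∀ j, N' ≤ j → s <+: x j ∧ ∀ u b, A j = .comp u b → ¬ (u <+: s ∧ u ≠ s)) ∧
      ∀ M, ∃ j, M ≤ j ∧ ∃ i, A j = .comp (s ++ List.replicate i false) true) ∨
    ∃ N', ∀ j, N' ≤ j → ¬ MovesRight (x j) (x (j + 1)) := by
  let Stable : List Bool → Prop := fun s =>
    ∃ N', ∀ j, N' ≤ j → s <+: x j ∧ ∀ u b, A j = .comp u b → ¬ (u <+: s ∧ u ≠ s)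
  have hnil : Stable [] := ⟨0, fun j _ => ⟨⟨_, rfl⟩, fun u b _ h => h.2 (by simpa using h.1)⟩⟩
  -- Minimizing `B - s.length` selects a longest stable prefix, because stable prefixes have length
  -- at most `B`.
  obtain ⟨s, ⟨N₁, hs⟩, hmax⟩ :=
    exists_minimalFor_of_wellFoundedLT Stable (fun s => B - s.length) ⟨[], hnil⟩
  have hlen : ∀ s', Stable s' → s'.length ≤ B := by
    rintro s' ⟨N', h⟩
    exact (h (max N N') (le_max_right _ _)).1.length_le.trans (hB _ (le_max_left _ _))
  by_cases hprog : ∀ M, ∃ j, M ≤ j ∧ ∃ i, A j = .comp (s ++ List.replicate i false) true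
  · exact Or.inl ⟨s, N₁, hs, hprog⟩
  right
  push Not at hprog
  obtain ⟨N₂, hno⟩ := hprog
  let N₃ := max N (max N₁ N₂)
  have hN : N ≤ N₃ := le_max_left _ _
  have hN₁ : N₁ ≤ N₃ := (le_max_left _ _).trans (le_max_right _ _)
  have hN₂ : N₂ ≤ N₃ := (le_max_right _ _).trans (le_max_right _ _)
  -- The first `1` after `s` comes after exactly `a` zeros. Since no `1` in such a place is
  -- compressed any more, `a` can only decrease, by the deletion of a zero or by a move to the
  -- right.
  let Q : ℕ → List Bool → Prop := fun a y => s ++ (List.replicate a false ++ [true]) <+: y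
  have hQcomp : ∀ j, N₃ ≤ j → ∀ a, Q a (x j) → ∀ u b, A j = .comp u b →
      (Q a (x (j + 1)) ∨ ∃ a' < a, Q a' (x (j + 1))) ∧
        ∀ i < a, u = s ++ List.replicate i false → b = false → ∃ a' < a, Q a' (x (j + 1)) := by
    intro j hj a hQ u b hA
    obtain ⟨hx', -⟩ := hcomp j (hN.trans hj) u b hA
    by_cases hu : u ++ [b] <+: x j
    · obtain ⟨t, ht⟩ := exists_eq_of_concat_isPrefix hu
      have hux : u <+: x j := (List.prefix_append _ _).trans hu
      obtain ⟨hsx, hus⟩ := hs j (hN₁.trans hj)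
      have hsu : s <+: u := by
        rcases prefix_total hux hsx with h | h
        · by_cases he : u = s
          · rw [he]
          · exact (hus u b hA ⟨h, he⟩).elim
        · exact h
      obtain ⟨v, rfl⟩ := hsu
      obtain ⟨y, hy⟩ := hsx
      rw [ht, compressString_append] at hx'
      rw [← hy] at hu hQ
      simp only [Q, List.append_assoc, List.prefix_append_right_inj] at hu hQ
      rw [← hy, List.append_assoc, List.append_cancel_left_eq] at ht
      rcases concat_prefix_cases hu hQ with ⟨hv, rfl, hlt⟩ | ⟨hv, rfl⟩ | hv
      · obtain ⟨d, rfl⟩ : ∃ d, a = v.length + (d + 1) := ⟨a - v.length - 1, by omega⟩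
        have hdec : ∃ a' < v.length + (d + 1), Q a' (x (j + 1)) := by
          refine ⟨v.length + d, by omega, ?_⟩
          rw [hx']
          simp only [Q, List.append_assoc, List.prefix_append_right_inj]
          rw [ht, List.replicate_add, ← hv] at hQ
          rw [List.replicate_add, ← hv]
          simpa [List.replicate_succ] using hQ
        exact ⟨Or.inr hdec, fun _ _ _ _ => hdec⟩
      · exact (hno j (hN₂.trans hj) a (by rw [hA, hv])).elim
      · refine ⟨Or.inl ?_, fun i hi e => ?_⟩
        · rw [hx']
          simp only [Q, List.append_assoc, List.prefix_append_right_inj]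
          exact hv.trans (List.prefix_append _ _)
        · rw [List.append_cancel_left_eq] at e
          have := hv.subset (show true ∈ _ by simp)
          rw [e] at this
          simp [List.mem_replicate] at this
    · refine ⟨Or.inl ?_, fun i hi e e' => (hu ?_).elim⟩
      · rw [hx', compressString_of_not_isPrefix hu]; exact hQ
      · rw [e, e']
        refine List.IsPrefix.trans ?_ hQ
        obtain ⟨d, rfl⟩ : ∃ d, a = i + (d + 1) := ⟨a - i - 1, by omega⟩
        simp [List.replicate_add, List.replicate_succ]
  have hQstep : ∀ j, N₃ ≤ j → ∀ a, Q a (x j) →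
      Q a (x (j + 1)) ∨ ∃ a' < a, Q a' (x (j + 1)) := by
    intro j hj a hQ
    rcases hstep j (hN.trans hj) with h | h | ⟨u, b, hA⟩ | ⟨w, hw, h⟩
    · exact Or.inl (h ▸ hQ)
    · exact Or.inl (h ▸ hQ.trans (List.prefix_append _ _))
    · exact (hQcomp j hj a hQ u b hA).1
    · rcases h with h | h
      · exact Or.inl ((h ▸ hQ).trans ((List.prefix_append _ _).trans hw))
      · have hsx := (hs j (hN₁.trans hj)).1
        have hsx' := (hs (j + 1) (by omega)).1
        obtain ⟨v, rfl⟩ : s <+: w := prefix_of_branch (b := false) h hw hsx hsx'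
        obtain ⟨y, hy⟩ := hsx
        obtain ⟨z, hz⟩ := hsx'
        rw [← hz] at hw ⊢
        rw [← hy] at hQ h
        simp only [Q, List.append_assoc, List.prefix_append_right_inj] at hQ h hw ⊢
        rcases concat_prefix_cases h hQ with ⟨hv, -, hlt⟩ | ⟨-, hv⟩ | hv
        · exact Or.inr ⟨v.length, hlt, by rw [← hv]; exact hw⟩
        · simp at hv
        · exact Or.inl (hv.trans ((List.prefix_append _ _).trans hw))
  have hpure : ∀ j, N₃ ≤ j → ∀ a, ¬ Q a (x j) := by
    intro j hj a hQ
    let E : ℕ → Prop := fun a => ∃ j, N₃ ≤ j ∧ Q a (x j)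
    classical
    have hex : ∃ a, E a := ⟨a, j, hj, hQ⟩
    obtain ⟨j₀, hj₀, hQ₀⟩ := Nat.find_spec hex
    have hmin : ∀ a', E a' → Nat.find hex ≤ a' := fun a' h => Nat.find_min' hex h
    set a₀ := Nat.find hex
    have hall : ∀ j, j₀ ≤ j → Q a₀ (x j) := by
      intro j hj
      induction j, hj using Nat.le_induction with
      | base => exact hQ₀
      | succ j hj ih =>
        rcases hQstep j (hj₀.trans hj) _ ih with h | ⟨a', ha', h⟩
        · exact h
        · have := hmin a' ⟨j + 1, by omega, h⟩
          omega
    -- At the least `a₀` that ever occurs, the longer prefix `s0…01` is stable: a `1`-compression at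
    -- `s0…0` is excluded by `hno`, a `0`-compression before the `1` would lower `a₀`, and one at
    -- the place of the `1` violates its side condition. This contradicts the choice of `s`.
    have hstable : Stable (s ++ (List.replicate a₀ false ++ [true])) := by
      refine ⟨j₀, fun j hj => ⟨hall j hj, fun u b hA ⟨hu, hne⟩ => ?_⟩⟩
      have hj' := hj₀.trans hj
      have hus := (hs j (hN₁.trans hj')).2 u b hA
      have hsu : s <+: u := by
        rcases prefix_total hu (List.prefix_append s _) with h | h
        · by_cases he : u = s
          · rw [he]
          · exact (hus ⟨h, he⟩).elim
        · exact h
      obtain ⟨v, rfl⟩ := hsu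
      rw [List.prefix_append_right_inj] at hu
      rcases List.prefix_concat_iff.1 hu with rfl | hv
      · exact hne rfl
      · have hv' : v = List.replicate v.length false :=
          List.eq_replicate_of_mem fun c hc => (List.mem_replicate.1 (hv.subset hc)).2
        have hle : v.length ≤ a₀ := by simpa using hv.length_le
        cases b with
        | true => exact hno j (hN₂.trans hj') v.length (by rw [hA, ← hv'])
        | false =>
          rcases hle.lt_or_eq with hlt | heq
          · obtain ⟨a', ha', h⟩ := (hQcomp j hj' a₀ (hall j hj) _ _ hA).2 v.length hlt
              (by rw [← hv']) rfl
            have := hmin a' ⟨j + 1, by omega, h⟩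
            omega
          · refine (hcomp j (hN.trans hj') _ _ hA).2 ?_
            rw [heq] at hv'
            rw [hv', List.append_assoc]
            exact hall j hj
    have h1 := hlen _ hstable
    have h2 := hmax hstable
    simp only [List.length_append, List.length_replicate, List.length_singleton] at h1 h2
    omega
  refine ⟨N₃, fun j hj ⟨w, hw, h⟩ => ?_⟩
  have hsx := (hs j (hN₁.trans hj)).1
  obtain ⟨z, hz⟩ := (hs (j + 1) (by omega)).1
  obtain ⟨k, rfl⟩ := eq_replicate_of_no_true (y := z) fun a ha =>
    hpure (j + 1) (by omega) a (by rw [← hz]; simpa [Q] using ha)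
  -- By `hpure` only zeros follow `s`, so the `1` gained by the move lies inside `s`; but `s` was
  -- already a prefix before the move.
  have hws : w ++ [true] <+: s := by
    rcases prefix_total hw (show s <+: x (j + 1) from ⟨_, hz⟩) with h | h
    · exact h
    · rcases List.prefix_concat_iff.1 h with h | ⟨v, rfl⟩
      · rw [h]
      · rw [← hz, List.append_assoc, List.prefix_append_right_inj] at hw
        have := hw.subset (show true ∈ _ by simp)
        simp [List.mem_replicate] at this
  rcases h with rfl | h
  · have := (hws.trans hsx).length_le
    simp at this
  · exact not_prefix_of_prefix_append h (hws.trans hsx)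

/-! ### Good traces make branches successful -/

section

variable {α : Type*} [DecidableEq α] {n : ℕ} {Ω : Formula α → ℕ}

/-- If no pair were successful, then, position by position up to `l`, the string on the trace would
eventually stop moving to the right. Hits at `l` append a `1`, which is such a move, and they never
cease. Resolutions increase the annotation lexicographically, so once all earlier positions are at
rest, they affect position `l'` only by moving it to the right. -/
theorem exists_progress_of_trace {Θ : ℕ → AnnSequent α n} {I : ℕ → Inst α n}
    {prem : ℕ → List (AnnSequent α n)} (hd : ∀ j, Descends Ω (I j) (Θ j) (prem j))
    (hpf : ∀ j, PrefixFree (Θ j)) {l : Fin n} {N B : ℕ} {χ : ℕ → Formula α} {f : ℕ → Bool}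
    {σ : ℕ → Annotation n} (hB : ∀ j, ∀ q ∈ Θ j, ∀ l, (q.2 l).length ≤ B)
    (hmem : ∀ j, N ≤ j → (χ j, σ j) ∈ Θ j)
    (hr : ∀ j, N ≤ j → ¬ (I j).Resets Ω l (f j))
    (hσ : ∀ j, N ≤ j → σ (j + 1) = annMap Ω (Θ j) (I j) (f j) (σ j) ∨
      (I j = .resolve ∧ f j = false ∧ (χ j, σ (j + 1)) ∈ Θ j ∧ AnnLT (σ j) (σ (j + 1))))
    (hhit : ∀ M, ∃ j, M ≤ j ∧ (I j).Hits l (f j)) :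
    ∃ (l' : Fin n) (s : List Bool) (N' : ℕ), (∀ j, N' ≤ j → InPlay (Θ j) l' s ∧
        ∀ u b, I j = .compress l' u b → ¬ (u <+: s ∧ u ≠ s)) ∧
      ∀ M, ∃ j, M ≤ j ∧ ∃ i, I j = .compress l' (s ++ List.replicate i false) true := by
  by_contra hcon
  have key : ∀ l' : Fin n, l' ≤ l →
      ∃ N', ∀ j, N' ≤ j → ¬ MovesRight (σ j l') (σ (j + 1) l') := by
    intro l'
    induction l' using WellFoundedLT.induction with
    | ind l' ih =>
    intro hl'
    have : ∀ k : Fin n, ∃ N', k < l' → ∀ j, N' ≤ j → ¬ MovesRight (σ j k) (σ (j + 1) k) := by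
      intro k
      by_cases hk : k < l'
      · obtain ⟨N', h⟩ := ih k hk (hk.le.trans hl')
        exact ⟨N', fun _ => h⟩
      · exact ⟨0, fun h => (hk h).elim⟩
    choose Nk hNk using this
    let N₁ := max N (Finset.univ.sup Nk)
    have hN₁ : ∀ k, k < l' → ∀ j, N₁ ≤ j → ¬ MovesRight (σ j k) (σ (j + 1) k) := fun k hk j hj =>
      hNk k hk j (((Finset.le_sup (Finset.mem_univ k)).trans (le_max_right _ _)).trans hj)
    -- A reset at `l' ≤ l` would also reset position `l`.
    have hr' : ∀ j, N₁ ≤ j → ¬ (I j).Resets Ω l' (f j) := fun j hj h =>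
      hr j ((le_max_left _ _).trans hj) ⟨h.1, lt_of_lt_of_le h.2 (by
        have : (l' : ℕ) ≤ l := hl'
        omega)⟩
    have hst : ∀ j, N₁ ≤ j → σ (j + 1) l' = σ j l' ∨ σ (j + 1) l' = σ j l' ++ [false] ∨
        (∃ u b, (I j).act l' = .comp u b) ∨ MovesRight (σ j l') (σ (j + 1) l') := by
      intro j hj
      have hjN : N ≤ j := (le_max_left _ _).trans hj
      rcases hσ j hjN with e | ⟨hI, -, hm, k, heq, hlt⟩
      · simp only [e]
        rw [annMap_of_not_resets (hr' j hj)]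
        cases ha : (I j).act l' with
        | keep => exact Or.inl rfl
        | comp u b => exact Or.inr (Or.inr (Or.inl ⟨u, b, rfl⟩))
        | split =>
          cases f j with
          | false => exact Or.inr (Or.inl rfl)
          | true =>
            exact Or.inr (Or.inr (Or.inr ⟨σ j l', by simp [Act.map], Or.inl rfl⟩))
      · have hmv : MovesRight (σ j k) (σ (j + 1) k) := by
          -- Both annotations belong to the same sequent, so prefix-freeness leaves only a genuine
          -- branching.
          rcases prefix_or_leftOf_of_lt hlt with h | ⟨w, h, h'⟩
          · have := hpf j k _ (hmem j hjN) _ hm h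
            exact (hlt.ne this).elim
          · exact ⟨w, h', Or.inr h⟩
        rcases lt_trichotomy k l' with hk | rfl | hk
        · exact (hN₁ k hk j hj hmv).elim
        · exact Or.inr (Or.inr (Or.inr hmv))
        · exact Or.inl (heq l' hk).symm
    have hco : ∀ j, N₁ ≤ j → ∀ u b, (I j).act l' = .comp u b →
        σ (j + 1) l' = compressString u b (σ j l') ∧ ¬ u ++ [!b] <+: σ j l' := by
      intro j hj u b hA
      have hI := Inst.act_eq_comp.1 hA
      have hjN : N ≤ j := (le_max_left _ _).trans hj
      obtain ⟨-, hno, -⟩ := (hd j).compress _ _ _ hI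
      refine ⟨?_, fun h => hno ⟨_, hmem j hjN, h⟩⟩
      rcases hσ j hjN with e | ⟨hI', -⟩
      · simp only [e]
        rw [annMap_of_not_resets (hr' j hj), hA]
        rfl
      · rw [hI] at hI'
        simp at hI'
    rcases exists_progress_or_not_movesRight (x := fun j => σ j l') (A := fun j => (I j).act l')
      (N := N₁) (B := B) (fun j hj => hB j _ (hmem j ((le_max_left _ _).trans hj)) l') hst hco
      with h | h
    · obtain ⟨s, N', h1, h2⟩ := h
      refine (hcon ⟨l', s, max N N', fun j hj => ⟨⟨(χ j, σ j), hmem j ?_, (h1 j ?_).1⟩,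
        fun u b e => (h1 j ?_).2 u b (Inst.act_eq_comp.2 e)⟩, fun M => ?_⟩).elim
      · exact (le_max_left _ _).trans hj
      · exact (le_max_right _ _).trans hj
      · exact (le_max_right _ _).trans hj
      · obtain ⟨j, hj, i, e⟩ := h2 M
        exact ⟨j, hj, i, Inst.act_eq_comp.1 e⟩
    · exact h
  obtain ⟨N', hN'⟩ := key l le_rfl
  obtain ⟨j, hj, hf, ha⟩ := hhit (max N N')
  have hjN : N ≤ j := (le_max_left _ _).trans hj
  refine hN' j ((le_max_right _ _).trans hj) ?_
  rcases hσ j hjN with e | ⟨-, hff, -⟩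
  · rw [e, annMap_of_not_resets (hr j hjN), ha, hf]
    exact ⟨σ j l, by simp [Act.map], Or.inl rfl⟩
  · rw [hf] at hff
    simp at hff

end

/-! ### Finiteness of the closure -/

namespace Formula

theorem WellFormed.negVars_subset {α : Type*} {φ : Formula α} (h : φ.WellFormed) :
    negVars φ ⊆ freeVars φ := by
  induction φ with
  | pos | bot | top => exact Set.empty_subset _
  | neg => exact subset_rfl
  | or φ ψ ih₁ ih₂ | and φ ψ ih₁ ih₂ => exact Set.union_subset_union (ih₁ h.1) (ih₂ h.2)
  | dia φ ih | box φ ih => exact ih h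
  | mu x φ ih | nu x φ ih => exact fun p hp => ⟨ih h.2 hp, fun e => h.1 (e ▸ hp)⟩

variable {α : Type*} [DecidableEq α]

/-- Simultaneous substitution for the positive literals of free variables. -/
def msubst (σ : α → Formula α) : Formula α → Formula α
  | pos p => σ p
  | neg p => neg p
  | bot => bot
  | top => top
  | or φ ψ => or (msubst σ φ) (msubst σ ψ)
  | and φ ψ => and (msubst σ φ) (msubst σ ψ)
  | dia φ => dia (msubst σ φ)
  | box φ => box (msubst σ φ)
  | mu x φ => mu x (msubst (Function.update σ x (pos x)) φ)
  | nu x φ => nu x (msubst (Function.update σ x (pos x)) φ)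

/-- The formulas reachable from `φ.msubst σ` without passing through the formulas `σ z`. -/
def preClos (σ : α → Formula α) : Formula α → Set (Formula α)
  | pos p => {σ p}
  | neg p => {neg p}
  | bot => {bot}
  | top => {top}
  | or φ ψ => insert (msubst σ (or φ ψ)) (preClos σ φ ∪ preClos σ ψ)
  | and φ ψ => insert (msubst σ (and φ ψ)) (preClos σ φ ∪ preClos σ ψ)
  | dia φ => insert (msubst σ (dia φ)) (preClos σ φ)
  | box φ => insert (msubst σ (box φ)) (preClos σ φ)
  | mu x φ => insert (msubst σ (mu x φ)) (preClos (Function.update σ x (msubst σ (mu x φ))) φ)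
  | nu x φ => insert (msubst σ (nu x φ)) (preClos (Function.update σ x (msubst σ (nu x φ))) φ)

theorem preClos_finite (σ : α → Formula α) (φ : Formula α) : (preClos σ φ).Finite := by
  induction φ generalizing σ with
  | pos | neg | bot | top => exact Set.finite_singleton _
  | or φ ψ ih₁ ih₂ | and φ ψ ih₁ ih₂ => exact ((ih₁ σ).union (ih₂ σ)).insert _
  | dia φ ih | box φ ih => exact (ih σ).insert _
  | mu x φ ih | nu x φ ih => exact (ih _).insert _

theorem msubst_mem_preClos (σ : α → Formula α) (φ : Formula α) : msubst σ φ ∈ preClos σ φ := by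
  cases φ <;> simp [preClos, msubst]

theorem msubst_pos (φ : Formula α) : msubst pos φ = φ := by
  induction φ <;> simp_all [msubst]

theorem subst_of_not_mem_freeVars {x : α} {ψ φ : Formula α} (h : x ∉ freeVars φ) :
    subst x ψ φ = φ := by
  induction φ with
  | pos p => simp [freeVars] at h; simp [subst, Ne.symm h]
  | neg | bot | top => rfl
  | or φ χ ih₁ ih₂ | and φ χ ih₁ ih₂ =>
    simp only [freeVars, Set.mem_union, not_or] at h
    simp [subst, ih₁ h.1, ih₂ h.2]
  | dia φ ih | box φ ih => simp [subst, ih h]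
  | mu y φ ih | nu y φ ih =>
    by_cases hy : y = x
    · simp [subst, hy]
    · simp only [freeVars, Set.mem_sdiff, Set.mem_singleton_iff, not_and, not_not] at h
      simp only [subst, hy, if_false]
      rw [ih fun hx => hy (h hx).symm]

/-- Unfolding a substituted fixpoint formula amounts to updating the substitution at the bound
variable. The hypothesis ensures that the inner substitution brings in no further free occurrences
of `x`. -/
theorem subst_msubst {x : α} {ψ φ : Formula α} {σ : α → Formula α}
    (h : ∀ z ∈ freeVars φ, z ≠ x → x ∉ freeVars (σ z)) :
    subst x ψ (msubst (Function.update σ x (pos x)) φ) = msubst (Function.update σ x ψ) φ := by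
  induction φ generalizing σ with
  | pos p =>
    by_cases hp : p = x
    · subst hp; simp [msubst, subst]
    · simpa [msubst, hp] using subst_of_not_mem_freeVars (h p (by simp [freeVars]) hp)
  | neg | bot | top => rfl
  | or φ χ ih₁ ih₂ | and φ χ ih₁ ih₂ =>
    simp [msubst, subst, ih₁ fun z hz => h z (Or.inl hz), ih₂ fun z hz => h z (Or.inr hz)]
  | dia φ ih | box φ ih => simp [msubst, subst, ih h]
  | mu y φ ih | nu y φ ih =>
    by_cases hy : y = x
    · subst hy; simp [msubst, subst]
    · simp only [msubst, subst, hy, if_false]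
      rw [Function.update_comm (Ne.symm hy), ih, Function.update_comm (Ne.symm hy)]
      intro z hz hzx
      by_cases hzy : z = y
      · subst hzy; simpa [freeVars] using Ne.symm hzx
      · simpa [hzy] using h z ⟨hz, hzy⟩ hzx

theorem mem_freeVars_msubst {σ : α → Formula α} {φ : Formula α} {p : α}
    (h : p ∈ freeVars (msubst σ φ)) :
    (∃ z ∈ freeVars φ, p ∈ freeVars (σ z)) ∨ p ∈ negVars φ := by
  induction φ generalizing σ with
  | pos q => exact Or.inl ⟨q, rfl, h⟩
  | neg q => exact Or.inr h
  | bot | top => exact h.elim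
  | or φ ψ ih₁ ih₂ | and φ ψ ih₁ ih₂ =>
    rcases h with h | h
    · rcases ih₁ h with ⟨z, hz, hp⟩ | hp
      · exact Or.inl ⟨z, Or.inl hz, hp⟩
      · exact Or.inr (Or.inl hp)
    · rcases ih₂ h with ⟨z, hz, hp⟩ | hp
      · exact Or.inl ⟨z, Or.inr hz, hp⟩
      · exact Or.inr (Or.inr hp)
  | dia φ ih | box φ ih => exact ih h
  | mu x φ ih | nu x φ ih =>
    rcases ih h.1 with ⟨z, hz, hp⟩ | hp
    · by_cases hzx : z = x
      · subst hzx
        simp only [Function.update_self, freeVars] at hp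
        exact (h.2 hp).elim
      · rw [Function.update_of_ne hzx] at hp
        exact Or.inl ⟨z, ⟨hz, hzx⟩, hp⟩
    · exact Or.inr hp

/-- The common step for both fixpoints, with `M` the substituted fixpoint formula. A trace inside
the body that ends at the value of `x` has arrived at `M`, whose unfolding is the starting point of
the body. -/
theorem preClos_closed_binder {B : Set α} {x : α} {φ M : Formula α} {σ : α → Formula α}
    (hM : ∀ p ∈ freeVars M, p ∉ B)
    (hstep : ∀ χ', TraceStep M χ' → χ' = msubst (Function.update σ x M) φ)
    (hσ : ∀ z ∈ freeVars φ \ {x}, ∀ p ∈ freeVars (σ z), p ∉ B) {χ : Formula α}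
    (ih : (∀ z ∈ freeVars φ, ∀ p ∈ freeVars (Function.update σ x M z), p ∉ B) →
      χ ∈ preClos (Function.update σ x M) φ →
      (∃ z ∈ freeVars φ, χ = Function.update σ x M z) ∨
        ∀ χ', TraceStep χ χ' → χ' ∈ preClos (Function.update σ x M) φ)
    (hχ : χ ∈ insert M (preClos (Function.update σ x M) φ)) :
    (∃ z ∈ freeVars φ \ {x}, χ = σ z) ∨
      ∀ χ', TraceStep χ χ' → χ' ∈ insert M (preClos (Function.update σ x M) φ) := by
  have hfix : ∀ χ', TraceStep M χ' → χ' ∈ insert M (preClos (Function.update σ x M) φ) :=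
    fun χ' h => Or.inr (hstep χ' h ▸ msubst_mem_preClos _ _)
  rcases hχ with rfl | hχ
  · exact Or.inr hfix
  · have hσ' : ∀ z ∈ freeVars φ, ∀ p ∈ freeVars (Function.update σ x M z), p ∉ B := by
      intro z hz p hp
      by_cases hzx : z = x
      · subst hzx
        rw [Function.update_self] at hp
        exact hM p hp
      · rw [Function.update_of_ne hzx] at hp
        exact hσ z ⟨hz, hzx⟩ p hp
    rcases ih hσ' hχ with ⟨z, hz, e⟩ | h
    · by_cases hzx : z = x
      · subst hzx
        rw [Function.update_self] at e
        exact Or.inr (e ▸ hfix)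
      · rw [Function.update_of_ne hzx] at e
        exact Or.inl ⟨z, ⟨hz, hzx⟩, e⟩
    · exact Or.inr fun χ' hs => Or.inr (h χ' hs)

/-- `B` collects bound variables. Keeping it apart from the free variables of the values of `σ` and
from the negative literals rules out capture, so `subst_msubst` computes all unfoldings. -/
theorem preClos_closed {B : Set α} {φ : Formula α} {σ : α → Formula α} (hB : boundVars φ ⊆ B)
    (hn : ∀ p ∈ negVars φ, p ∉ B) (hσ : ∀ z ∈ freeVars φ, ∀ p ∈ freeVars (σ z), p ∉ B)
    {χ : Formula α} (hχ : χ ∈ preClos σ φ) :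
    (∃ z ∈ freeVars φ, χ = σ z) ∨ ∀ χ', TraceStep χ χ' → χ' ∈ preClos σ φ := by
  induction φ generalizing σ with
  | pos p => exact Or.inl ⟨p, rfl, hχ⟩
  | neg | bot | top => obtain rfl := hχ; exact Or.inr fun χ' h => by cases h
  | or φ ψ ih₁ ih₂ | and φ ψ ih₁ ih₂ =>
    simp only [boundVars, Set.union_subset_iff] at hB
    rcases hχ with rfl | hχ | hχ
    · refine Or.inr fun χ' h => ?_
      cases h
      · exact Or.inr (Or.inl (msubst_mem_preClos _ _))
      · exact Or.inr (Or.inr (msubst_mem_preClos _ _))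
    · rcases ih₁ hB.1 (fun p hp => hn p (Or.inl hp)) (fun z hz => hσ z (Or.inl hz)) hχ with
        ⟨z, hz, e⟩ | h
      · exact Or.inl ⟨z, Or.inl hz, e⟩
      · exact Or.inr fun χ' hs => Or.inr (Or.inl (h χ' hs))
    · rcases ih₂ hB.2 (fun p hp => hn p (Or.inr hp)) (fun z hz => hσ z (Or.inr hz)) hχ with
        ⟨z, hz, e⟩ | h
      · exact Or.inl ⟨z, Or.inr hz, e⟩
      · exact Or.inr fun χ' hs => Or.inr (Or.inr (h χ' hs))
  | dia φ ih | box φ ih =>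
    rcases hχ with rfl | hχ
    · refine Or.inr fun χ' h => ?_
      cases h
      exact Or.inr (msubst_mem_preClos _ _)
    · rcases ih hB hn hσ hχ with h | h
      · exact Or.inl h
      · exact Or.inr fun χ' hs => Or.inr (h χ' hs)
  | mu x φ ih =>
    simp only [boundVars, Set.insert_subset_iff] at hB
    refine preClos_closed_binder (fun p hp => ?_) (fun χ' h => ?_) hσ
      (fun hσ' => ih hB.2 hn hσ') hχ
    · rcases mem_freeVars_msubst hp with ⟨y, hy, h⟩ | h
      · exact hσ y hy p h
      · exact hn p h
    · cases h
      exact subst_msubst fun z hz hzx hx => hσ z ⟨hz, hzx⟩ x hx hB.1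
  | nu x φ ih =>
    simp only [boundVars, Set.insert_subset_iff] at hB
    refine preClos_closed_binder (fun p hp => ?_) (fun χ' h => ?_) hσ
      (fun hσ' => ih hB.2 hn hσ') hχ
    · rcases mem_freeVars_msubst hp with ⟨y, hy, h⟩ | h
      · exact hσ y hy p h
      · exact hn p h
    · cases h
      exact subst_msubst fun z hz hzx hx => hσ z ⟨hz, hzx⟩ x hx hB.1

/-- For the identity substitution `pos`, the traces that leave `preClos` could only do so at
literals, which have no successors. Tidiness and well-formedness give the separation of variables.
-/
theorem clos_finite {Γ : Finset (Formula α)} (hwf : ∀ φ ∈ Γ, φ.WellFormed)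
    (htidy : ∀ φ ∈ Γ, φ.Tidy) : (Clos Γ).Finite := by
  refine (Γ.finite_toSet.biUnion fun φ _ => preClos_finite pos φ).subset ?_
  rintro ψ ⟨φ, hφ, h⟩
  refine Set.mem_biUnion hφ ?_
  induction h with
  | refl => simpa [msubst_pos] using msubst_mem_preClos pos φ
  | tail _ hs ih =>
    have hdis := Set.disjoint_left.1 (htidy φ hφ)
    rcases preClos_closed (B := boundVars φ) subset_rfl
      (fun p hp => hdis ((hwf φ hφ).negVars_subset hp))
      (fun z hz p hp => by obtain rfl : p = z := hp; exact hdis hz) ih with ⟨z, -, rfl⟩ | h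
    · cases hs
    · exact h _ hs

end Formula

/-! ### Normal sequents -/

/-- Neither a resolution nor a compression is applicable. -/
structure Normal {α : Type*} {n : ℕ} (Θ : AnnSequent α n) : Prop where
  unique : ∀ φ σ τ, (φ, σ) ∈ Θ → (φ, τ) ∈ Θ → σ = τ
  one : ∀ l s, InPlay Θ l (s ++ [false]) → InPlay Θ l (s ++ [true])
  zero : ∀ l s, true ∈ s → InPlay Θ l (s ++ [true]) → InPlay Θ l (s ++ [false])

/-- The number of symbols in a sequent. -/
def weight {α : Type*} {n : ℕ} (Θ : AnnSequent α n) : ℕ :=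
  ∑ q ∈ Θ, (1 + ∑ l, (q.2 l).length)

theorem sum_image_le_sum_comp {X Y : Type*} [DecidableEq X] [DecidableEq Y] (s : Finset X)
    (g : X → Y) (w : Y → ℕ) : ∑ y ∈ s.image g, w y ≤ ∑ x ∈ s, w (g x) := by
  induction s using Finset.induction_on with
  | empty => simp
  | insert a s ha ih =>
    rw [Finset.image_insert, Finset.sum_insert ha]
    by_cases h : g a ∈ s.image g
    · rw [Finset.insert_eq_of_mem h]; omega
    · rw [Finset.sum_insert h]; omega

theorem compressString_length_le (u : List Bool) (b : Bool) (x : List Bool) :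
    (compressString u b x).length ≤ x.length := by
  by_cases h : u ++ [b] <+: x
  · obtain ⟨t, rfl⟩ := exists_eq_of_concat_isPrefix h
    rw [compressString_append]
    simp
  · rw [compressString_of_not_isPrefix h]

theorem compressString_length_lt {u : List Bool} {b : Bool} {x : List Bool} (h : u ++ [b] <+: x) :
    (compressString u b x).length < x.length := by
  obtain ⟨t, rfl⟩ := exists_eq_of_concat_isPrefix h
  rw [compressString_append]
  simp

theorem annLT_or_annLT {n : ℕ} {σ τ : Annotation n} (h : σ ≠ τ) : AnnLT σ τ ∨ AnnLT τ σ := by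
  obtain ⟨l, hl, hmin⟩ : ∃ l, σ l ≠ τ l ∧ ∀ j < l, σ j = τ j := by
    have hne : ∃ l, σ l ≠ τ l := by
      by_contra hcon
      push Not at hcon
      exact h (funext hcon)
    obtain ⟨l, hl, hmin⟩ := exists_minimal_of_wellFoundedLT (fun l => σ l ≠ τ l) hne
    exact ⟨l, hl, fun j hj => by
      by_contra hcon
      exact absurd (hmin hcon hj.le) (not_le.2 hj)⟩
  rcases lt_or_gt_of_ne hl with h | h
  · exact Or.inl ⟨l, hmin, h⟩
  · exact Or.inr ⟨l, fun j hj => (hmin j hj).symm, h⟩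

section

variable {α : Type*} [DecidableEq α] {n : ℕ} {Ω : Formula α → ℕ} {Θ : AnnSequent α n}

theorem weight_compress_lt {l : Fin n} {s : List Bool} {b : Bool} (h : InPlay Θ l (s ++ [b])) :
    weight (Θ.image fun q => (q.1, compressAnn l s b q.2)) < weight Θ := by
  have hle : ∀ (σ : Annotation n) (l' : Fin n),
      (compressAnn l s b σ l').length ≤ (σ l').length := by
    intro σ l'
    by_cases h : l' = l
    · subst h
      simpa [compressAnn] using compressString_length_le _ _ _
    · simp [compressAnn, h]
  refine lt_of_le_of_lt (sum_image_le_sum_comp _ _ _) (Finset.sum_lt_sum (fun q _ => ?_) ?_)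
  · exact Nat.add_le_add_left (Finset.sum_le_sum fun l' _ => hle q.2 l') 1
  · obtain ⟨q, hq, hs⟩ := h
    refine ⟨q, hq, Nat.add_lt_add_left (Finset.sum_lt_sum (fun l' _ => hle q.2 l')
      ⟨l, Finset.mem_univ _, ?_⟩) 1⟩
    simpa [compressAnn] using compressString_length_lt hs

/-- Resolution takes precedence over compression. A resolved formula survives with a larger
annotation, so every trace can be continued. -/
theorem exists_normalizing_step (Ω : Formula α → ℕ) (h : ¬ Normal Θ) :
    ∃ (I : Inst α n) (Θ' : AnnSequent α n), I.Silent ∧ InstStep Ω I Θ [Θ'] ∧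
      weight Θ' < weight Θ ∧ ∀ χ σ, (χ, σ) ∈ Θ → ∃ σ', (χ, σ') ∈ Θ' ∧
        (σ' = annMap Ω Θ I false σ ∨ (I = .resolve ∧ (χ, σ') ∈ Θ ∧ AnnLT σ σ')) := by
  by_cases h₁ : ∀ φ σ τ, (φ, σ) ∈ Θ → (φ, τ) ∈ Θ → σ = τ
  · have hcomp : ∀ l s b, InPlay Θ l (s ++ [b]) → InstStep Ω (.compress l s b) Θ
        [Θ.image (fun q => (q.1, compressAnn l s b q.2))] →
        ∃ (I : Inst α n) (Θ' : AnnSequent α n), I.Silent ∧ InstStep Ω I Θ [Θ'] ∧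
          weight Θ' < weight Θ ∧ ∀ χ σ, (χ, σ) ∈ Θ → ∃ σ', (χ, σ') ∈ Θ' ∧
            (σ' = annMap Ω Θ I false σ ∨ (I = .resolve ∧ (χ, σ') ∈ Θ ∧ AnnLT σ σ')) := by
      intro l s b hs hst
      refine ⟨.compress l s b, _, trivial, hst, weight_compress_lt hs, fun χ σ hσ => ⟨compressAnn l s b σ, ?_,
        Or.inl (annMap_compress _ _ _ _).symm⟩⟩
      exact Finset.mem_image.2 ⟨_, hσ, rfl⟩
    by_cases h₂ : ∀ l s, InPlay Θ l (s ++ [false]) → InPlay Θ l (s ++ [true])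
    · have h₃ : ¬ ∀ l s, true ∈ s → InPlay Θ l (s ++ [true]) → InPlay Θ l (s ++ [false]) :=
        fun h₃ => h ⟨h₁, h₂, h₃⟩
      push Not at h₃
      obtain ⟨l, s, hs, hp, hn⟩ := h₃
      exact hcomp l s true hp (.compress_one l s Θ hp hn hs)
    · push Not at h₂
      obtain ⟨l, s, hp, hn⟩ := h₂
      exact hcomp l s false hp (.compress_zero l s Θ hp hn)
  · push Not at h₁
    obtain ⟨φ, σ, τ, hσ, hτ, hne⟩ := h₁
    obtain ⟨σ, τ, hσ, hτ, hlt⟩ : ∃ σ τ, (φ, σ) ∈ Θ ∧ (φ, τ) ∈ Θ ∧ AnnLT σ τ := by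
      rcases annLT_or_annLT hne with h | h
      · exact ⟨σ, τ, hσ, hτ, h⟩
      · exact ⟨τ, σ, hτ, hσ, h⟩
    have hne : τ ≠ σ := by
      rintro rfl
      obtain ⟨l, -, hl⟩ := hlt
      exact lt_irrefl _ hl
    refine ⟨.resolve, _, trivial, .resolve φ σ τ Θ hσ hτ hlt, ?_, fun χ ρ hρ => ?_⟩
    · exact Finset.sum_lt_sum_of_subset (Finset.erase_subset _ _) hσ (Finset.notMem_erase _ _)
        (by omega) fun _ _ _ => Nat.zero_le _
    · by_cases he : (χ, ρ) = (φ, σ)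
      · simp only [Prod.mk.injEq] at he
        obtain ⟨rfl, rfl⟩ := he
        exact ⟨τ, Finset.mem_erase.2 ⟨by simpa using hne, hτ⟩, Or.inr ⟨rfl, hτ, hlt⟩⟩
      · exact ⟨ρ, Finset.mem_erase.2 ⟨he, hρ⟩, Or.inl (annMap_false_keep (fun _ => rfl) _).symm⟩

/-- A logical rule instance can be applied to a sequent with all its formulas kept. -/
theorem exists_instStep {I : Inst α n} (hI : ¬ I.Silent) (ha : I.Avail Ω (supp Θ))
    (hu : ∀ φ σ τ, (φ, σ) ∈ Θ → (φ, τ) ∈ Θ → σ = τ) :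
    ∃ prem, InstStep Ω I Θ prem ∧ ∀ (b : Bool) Θ', prem[b.toNat]? = some Θ' →
      ∀ χ χ' f σ, (χ, σ) ∈ Θ → Trace I b χ χ' f → (χ', annMap Ω Θ I f σ) ∈ Θ' := by
  cases I with
  | resolve => exact (hI trivial).elim
  | compress => exact (hI trivial).elim
  | ax =>
    obtain ⟨p, ⟨σ, hσ⟩, ⟨τ, hτ⟩⟩ := ha
    have h := InstStep.ax (Ω := Ω) p σ τ Θ
    rw [Finset.insert_eq_of_mem hτ, Finset.insert_eq_of_mem hσ] at h
    exact ⟨_, h, fun b Θ' h => by simp at h⟩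
  | axTop =>
    obtain ⟨σ, hσ⟩ := ha
    have h := InstStep.axTop (Ω := Ω) σ Θ
    rw [Finset.insert_eq_of_mem hσ] at h
    exact ⟨_, h, fun b Θ' h => by simp at h⟩
  | or φ ψ =>
    obtain ⟨σ, hσ⟩ := ha
    -- The context is all of `Θ`, including the principal formula, so that a trace staying at that
    -- formula can be continued too.
    have h := InstStep.or (Ω := Ω) φ ψ σ Θ
    rw [Finset.insert_eq_of_mem hσ] at h
    refine ⟨_, h, fun b Θ' hb χ χ' f τ hτ ht => ?_⟩
    cases b <;> simp at hb
    subst hb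
    cases ht with
    | stay => rw [annMap_false_keep fun _ => rfl]; simp [hτ]
    | or_left => rw [annMap_false_keep fun _ => rfl, hu _ _ _ hτ hσ]; simp
    | or_right => rw [annMap_false_keep fun _ => rfl, hu _ _ _ hτ hσ]; simp
  | and φ ψ =>
    obtain ⟨σ, hσ⟩ := ha
    have h := InstStep.and (Ω := Ω) φ ψ σ Θ
    rw [Finset.insert_eq_of_mem hσ] at h
    refine ⟨_, h, fun b Θ' hb χ χ' f τ hτ ht => ?_⟩
    cases b <;> simp at hb <;> subst hb <;> cases ht with
    | stay => rw [annMap_false_keep fun _ => rfl]; simp [hτ]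
    | _ => rw [annMap_false_keep fun _ => rfl, hu _ _ _ hτ hσ]; simp
  | box φ =>
    obtain ⟨σ, hσ⟩ := ha
    have hinj : Function.Injective fun q : Formula α × Annotation n => (q.1.dia, q.2) := by
      rintro ⟨φ, σ⟩ ⟨ψ, τ⟩ h
      simpa using h
    -- The diamonds in `Θ` form the modal context, and all of `Θ` is the side context, so the
    -- conclusion is `Θ` itself.
    have h := InstStep.box (Ω := Ω) φ σ (Θ.preimage _ hinj.injOn) Θ
    have hsub : (Θ.preimage _ hinj.injOn).image (fun q => (q.1.dia, q.2)) ∪ Θ = Θ := by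
      refine Finset.union_eq_right.2 fun q hq => ?_
      obtain ⟨q', hq', rfl⟩ := Finset.mem_image.1 hq
      exact (Finset.mem_preimage (hf := hinj.injOn)).1 hq'
    rw [hsub, Finset.insert_eq_of_mem hσ] at h
    refine ⟨_, h, fun b Θ' hb χ χ' f τ hτ ht => ?_⟩
    cases b <;> simp at hb
    subst hb
    cases ht with
    | stay _ _ _ hne => exact (hne φ rfl).elim
    | box => rw [annMap_false_keep fun _ => rfl, hu _ _ _ hτ hσ]; simp
    | dia => rw [annMap_false_keep fun _ => rfl]; simp [hτ]
  | mu x φ =>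
    obtain ⟨σ, hσ⟩ := ha
    have h := InstStep.mu (Ω := Ω) x φ σ Θ
    rw [Finset.insert_eq_of_mem hσ] at h
    refine ⟨_, h, fun b Θ' hb χ χ' f τ hτ ht => ?_⟩
    cases b <;> simp at hb
    subst hb
    cases ht with
    | stay => rw [annMap_false_keep fun _ => rfl]; simp [hτ]
    | mu => rw [annMap_mu, hu _ _ _ hτ hσ]; simp
  | nu x φ l =>
    obtain ⟨⟨σ, hσ⟩, hl⟩ := ha
    have h := InstStep.nu (Ω := Ω) x φ σ Θ l hl
    rw [Finset.insert_eq_of_mem hσ] at h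
    refine ⟨_, h, fun b Θ' hb χ χ' f τ hτ ht => ?_⟩
    cases b <;> simp at hb
    subst hb
    cases ht with
    | stay =>
      rw [annMap_nu_false]
      exact Finset.mem_insert_of_mem (Finset.mem_image.2 ⟨_, hτ, rfl⟩)
    | nu => rw [annMap_nu_true _ _ _ hl, hu _ _ _ hτ hσ]; simp

end

/-! ### Bounds -/

/-- All formulas belong to `C` and all strings have length at most `B`. -/
def Bounded {α : Type*} {n : ℕ} (C : Set (Formula α)) (B : ℕ) (Θ : AnnSequent α n) : Prop :=
  ∀ q ∈ Θ, q.1 ∈ C ∧ ∀ l, (q.2 l).length ≤ B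

/-- At each position of the string the sibling bit is in play as well, except possibly at the first
`1`. Strings leaving at different positions are different, so there are at most `Θ.card` ordinary
positions and one exceptional one. -/
theorem Normal.length_le {α : Type*} {n : ℕ} {Θ : AnnSequent α n} (h : Normal Θ)
    {q : Formula α × Annotation n} (hq : q ∈ Θ) (l : Fin n) : (q.2 l).length ≤ Θ.card + 1 := by
  classical
  set w := q.2 l with hw
  let bad : ℕ → Prop := fun i => true ∉ w.take i ∧ w.take i ++ [true] <+: w
  have htake : ∀ i (hi : i < w.length), w.take i ++ [w[i]] <+: w := fun i hi => by
    rw [List.take_append_getElem hi]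
    exact ⟨_, List.take_append_drop _ _⟩
  have hmono : ∀ i j (hi : i < w.length), i < j → w.take i ++ [w[i]] <+: w.take j := by
    intro i j hi hij
    rw [List.take_append_getElem hi]
    exact List.take_prefix_take_left (by omega)
  -- A second exceptional position would have a `1` before it.
  have hbad : ((Finset.range w.length).filter bad).card ≤ 1 := by
    have key : ∀ i j, i < w.length → bad i → bad j → ¬ i < j := by
      intro i j hi hbi hbj hij
      have e : w[i] = true := by
        by_contra hne
        have := htake i hi
        rw [Bool.eq_false_of_not_eq_true hne] at this
        exact not_prefix_of_prefix_append this hbi.2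
      have := hmono i j hi hij
      rw [e] at this
      exact hbj.1 (this.subset (by simp))
    refine Finset.card_le_one.2 fun i hi j hj => ?_
    simp only [Finset.mem_filter, Finset.mem_range] at hi hj
    have h1 := key i j hi.1 hi.2 hj.2
    have h2 := key j i hj.1 hj.2 hi.2
    omega
  -- `g i` will be a formula whose string leaves `w` exactly at position `i`.
  have hsib : ∀ i, ∃ q', i < w.length ∧ ¬ bad i → q' ∈ Θ ∧
      ∀ hi : i < w.length, w.take i ++ [!w[i]] <+: q'.2 l := by
    intro i
    by_cases hi : i < w.length ∧ ¬ bad i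
    · obtain ⟨hi, hb⟩ := hi
      have hp : InPlay Θ l (w.take i ++ [w[i]]) := ⟨q, hq, htake i hi⟩
      have : InPlay Θ l (w.take i ++ [!w[i]]) := by
        cases e : w[i] with
        | false => rw [e] at hp; exact h.one l _ hp
        | true =>
          rw [e] at hp
          refine h.zero l _ ?_ hp
          by_contra hmem
          exact hb ⟨hmem, by have := htake i hi; rwa [e] at this⟩
      obtain ⟨q', hq', h'⟩ := this
      exact ⟨q', fun _ => ⟨hq', fun _ => h'⟩⟩
    · exact ⟨q, fun h => (hi h).elim⟩
  choose g hg using hsib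
  have hgood : ((Finset.range w.length).filter fun i => ¬ bad i).card ≤ Θ.card := by
    have key : ∀ i j, i < w.length → j < w.length → ¬ bad i → ¬ bad j → g i = g j → ¬ i < j := by
      intro i j hi hj hbi hbj e hij
      have h1 := (hg i ⟨hi, hbi⟩).2 hi
      have h2 := (hg j ⟨hj, hbj⟩).2 hj
      rw [e] at h1
      exact not_prefix_of_prefix_append
        ((hmono i j hi hij).trans ((List.prefix_append _ _).trans h2)) h1
    refine Finset.card_le_card_of_injOn g (fun i hi => ?_) (fun i hi j hj e => ?_)
    · simp only [Finset.coe_filter, Finset.mem_range, Set.mem_ofPred_eq] at hi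
      exact (hg i ⟨hi.1, hi.2⟩).1
    · simp only [Finset.coe_filter, Finset.mem_range, Set.mem_ofPred_eq] at hi hj
      have h1 := key i j hi.1 hj.1 hi.2 hj.2 e
      have h2 := key j i hj.1 hi.1 hj.2 hi.2 e.symm
      omega
  have := Finset.card_filter_add_card_filter_not (s := Finset.range w.length) bad
  rw [Finset.card_range] at this
  omega

/-- Formulas have unique annotations, so there are at most as many annotated formulas as elements of
`C`. The bound does not depend on `B`: normalization brings the lengths back to a fixed size. -/
theorem Normal.bounded {α : Type*} {n : ℕ} {Θ : AnnSequent α n} (h : Normal Θ)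
    {C : Set (Formula α)} (hC : C.Finite) {B : ℕ} (hb : Bounded C B Θ) :
    Bounded C (C.ncard + 1) Θ := by
  classical
  have hcard : Θ.card ≤ C.ncard := by
    rw [← Set.ncard_coe_finset]
    refine Set.ncard_le_ncard_of_injOn Prod.fst (fun q hq => (hb q hq).1) ?_ hC
    rintro ⟨φ, σ⟩ hq ⟨ψ, τ⟩ hq' (rfl : φ = ψ)
    rw [h.unique φ σ τ hq hq']
  exact fun q hq => ⟨(hb q hq).1, fun l => (h.length_le hq l).trans (by omega)⟩

section

variable {α : Type*} [DecidableEq α] {n : ℕ} {Ω : Formula α → ℕ} {Θ : AnnSequent α n}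
  {I : Inst α n} {prem : List (AnnSequent α n)} {C : Set (Formula α)} {B : ℕ}

theorem Descends.bounded (hd : Descends Ω I Θ prem)
    (hC : ∀ φ ∈ C, ∀ ψ, TraceStep φ ψ → ψ ∈ C) (hb : Bounded C B Θ) {b : Bool}
    {Θ' : AnnSequent α n} (h : prem[b.toNat]? = some Θ') : Bounded C (B + 1) Θ' := by
  intro q' hq'
  obtain ⟨q, hq, f, ht, e⟩ := hd.parent b Θ' h q' hq'
  refine ⟨?_, fun l => ?_⟩
  · rcases ht.traceStep with e | hs
    · rw [e]; exact (hb q hq).1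
    · exact hC _ (hb q hq).1 _ hs
  · rw [e]
    by_cases hr : I.Resets Ω l f
    · rw [annMap_of_resets hr]
      exact (minLeaf_length_le fun q hq => (hb q hq).2 l).trans (Nat.le_succ _)
    · rw [annMap_of_not_resets hr]
      have := (hb q hq).2 l
      cases I.act l with
      | keep => exact this.trans (Nat.le_succ _)
      | split => simpa [Act.map] using this
      | comp u c => exact ((compressString_length_le _ _ _).trans this).trans (Nat.le_succ _)

theorem Descends.bounded_of_silent (hd : Descends Ω I Θ prem) (hI : I.Silent)
    (hb : Bounded C B Θ) {b : Bool} {Θ' : AnnSequent α n} (h : prem[b.toNat]? = some Θ') :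
    Bounded C B Θ' := by
  intro q' hq'
  obtain ⟨q, hq, f, ht, e⟩ := hd.parent b Θ' h q' hq'
  obtain ⟨e', rfl⟩ := ht.eq_of_silent hI
  refine ⟨e' ▸ (hb q hq).1, fun l => ?_⟩
  rw [e, annMap_of_not_resets (by simp [Inst.Resets])]
  have := (hb q hq).2 l
  cases ha : I.act l with
  | keep => exact this
  | split =>
    obtain ⟨x, φ, rfl⟩ := Inst.act_eq_split ha
    exact hI.elim
  | comp u c => exact (compressString_length_le _ _ _).trans this

end

/-- The labels with bounded sequents and bounded compressions. -/
def boundedLabels {α : Type*} (n : ℕ) (C : Set (Formula α)) (B : ℕ) :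
    Set (AnnSequent α n × Rule n) :=
  {x | Bounded C B x.1 ∧ ∀ l s b, x.2 = .compress l s b → s.length ≤ B}

theorem boundedLabels_finite {α : Type*} (n : ℕ) {C : Set (Formula α)} (hC : C.Finite) (B : ℕ) :
    (boundedLabels n C B).Finite := by
  classical
  have hstr : {s : List Bool | s.length ≤ B}.Finite := List.finite_length_le Bool B
  have hann : {σ : Annotation n | ∀ l, (σ l).length ≤ B}.Finite := Set.Finite.pi' fun _ => hstr
  have hseq : {Θ : AnnSequent α n | Bounded C B Θ}.Finite := by
    refine (hC.prod hann).finite_subsets.preimage Finset.coe_injective.injOn |>.subset ?_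
    exact fun Θ hΘ q hq => ⟨(hΘ q hq).1, (hΘ q hq).2⟩
  have hrule : {r : Rule n | ∀ l s b, r = .compress l s b → s.length ≤ B}.Finite := by
    refine ((Set.toFinite ({.ax, .axTop, .or, .and, .box, .mu, .nu, .resolve} : Set (Rule n))).union
      (((Set.finite_univ (α := Fin n × Bool)).prod hstr).image
        fun p => Rule.compress p.1.1 p.2 p.1.2)).subset ?_
    intro r hr
    cases r with
    | compress l s b => exact Or.inr ⟨((l, b), s), ⟨trivial, hr l s b rfl⟩, rfl⟩
    | _ => left; simp
  exact (hseq.prod hrule).subset fun x hx => ⟨hx.1, hx.2⟩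

/-! ### Branches -/

theorem pathNode_succ (β : ℕ → Bool) (i : ℕ) : pathNode β (i + 1) = pathNode β i ++ [β i] := by
  simp [pathNode, List.range_succ]

theorem length_pathNode (β : ℕ → Bool) (i : ℕ) : (pathNode β i).length = i := by
  simp [pathNode]

theorem pathNode_isPrefix (β : ℕ → Bool) {i j : ℕ} (h : i ≤ j) : pathNode β i <+: pathNode β j := by
  induction j, h using Nat.le_induction with
  | base => exact List.prefix_refl _
  | succ j _ ih => exact ih.trans (pathNode_succ β j ▸ List.prefix_append _ _)

theorem eq_pathNode_of_isPrefix {β : ℕ → Bool} {w : List Bool} {i : ℕ} (h : w <+: pathNode β i) :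
    pathNode β w.length = w := by
  have hle : w.length ≤ i := by simpa [length_pathNode] using h.length_le
  have := List.prefix_of_prefix_length_le h (pathNode_isPrefix β hle) (by simp [length_pathNode])
  exact (this.eq_of_length (by simp [length_pathNode])).symm

/-- An ascending chain of nodes of unbounded length determines an infinite branch. -/
theorem exists_branch {w : ℕ → List Bool} (hw : ∀ j, w j <+: w (j + 1))
    (hlen : ∀ M, ∃ j, M ≤ (w j).length) : ∃ β : ℕ → Bool, ∀ j, pathNode β (w j).length = w j := by
  have hmono : ∀ i j, i ≤ j → w i <+: w j := by
    intro i j h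
    induction j, h using Nat.le_induction with
    | base => exact List.prefix_refl _
    | succ j _ ih => exact ih.trans (hw j)
  choose J hJ using fun i => hlen (i + 1)
  refine ⟨fun i => (w (J i)).getD i false, fun j => ?_⟩
  refine List.ext_getElem (by simp [pathNode]) fun i h1 h2 => ?_
  have hi : i < (w (J i)).length := hJ i
  simp only [pathNode, List.getElem_map, List.getElem_range]
  rw [List.getD_eq_getElem _ _ hi]
  rcases le_total (J i) j with h | h
  · exact (hmono _ _ h).getElem hi
  · exact ((hmono _ _ h).getElem h2).symm

theorem Inst.eq_compress_of_rule {α : Type*} {n : ℕ} {I : Inst α n} {l : Fin n} {s : List Bool}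
    {b : Bool} (h : I.rule = .compress l s b) : I = .compress l s b := by
  cases I <;> simp_all [Inst.rule]

theorem Inst.Hits.not_silent {α : Type*} {n : ℕ} {I : Inst α n} {l : Fin n} {f : Bool}
    (h : I.Hits l f) : ¬ I.Silent := by
  obtain ⟨x, φ, rfl⟩ := Inst.act_eq_split h.2
  exact id

theorem Inst.Silent.arity_eq {α : Type*} {n : ℕ} {I : Inst α n} (h : I.Silent) : I.arity = 1 := by
  cases I <;> first | rfl | exact h.elim

theorem Inst.Avail.mono {α : Type*} {n : ℕ} {Ω : Formula α → ℕ} {I : Inst α n}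
    {Φ Ψ : Set (Formula α)} (h : I.Avail Ω Φ) (hs : Φ ⊆ Ψ) : I.Avail Ω Ψ := by
  cases I with
  | ax => obtain ⟨p, h1, h2⟩ := h; exact ⟨p, hs h1, hs h2⟩
  | nu => exact ⟨hs h.1, h.2⟩
  | resolve | compress => trivial
  | _ => exact hs h

/-- The functions `sq`, `ins` and `prem` describe the sequents, the rule instances, and the premises
of a successful derivation. -/
structure Describes {α : Type*} [DecidableEq α] {n : ℕ} (Ω : Formula α → ℕ) (π : ProofTree α n)
    (sq : List Bool → AnnSequent α n) (ins : List Bool → Inst α n)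
    (prem : List Bool → List (AnnSequent α n)) : Prop where
  label : ∀ v, π v ≠ none → π v = some (sq v, (ins v).rule)
  descends : ∀ v, π v ≠ none → Descends Ω (ins v) (sq v) (prem v)
  child : ∀ v b, π v ≠ none → (π (v ++ [b])).map Prod.fst = (prem v)[b.toNat]?
  closed : ∀ v b, π v = none → π (v ++ [b]) = none
  prefixFree : ∀ v, π v ≠ none → PrefixFree (sq v)
  successful : ∀ β : ℕ → Bool, (∀ i, π (pathNode β i) ≠ none) → Successful π β

section

variable {α : Type*} [DecidableEq α] {n : ℕ} {Ω : Formula α → ℕ} {π : ProofTree α n}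

theorem exists_describes {Θ₀ : AnnSequent α n} (hπ : IsDerivation Ω Θ₀ π) (h₀ : PrefixFree Θ₀)
    (hs : ∀ β : ℕ → Bool, (∀ i, π (pathNode β i) ≠ none) → Successful π β) :
    ∃ sq ins prem, Describes Ω π sq ins prem := by
  have : ∀ v, ∃ (Θ : AnnSequent α n) (I : Inst α n) (prem : List (AnnSequent α n)), π v ≠ none →
      π v = some (Θ, I.rule) ∧ Descends Ω I Θ prem ∧
        ∀ b : Bool, (π (v ++ [b])).map Prod.fst = prem[b.toNat]? := by
    intro v
    cases hv : π v with
    | none => exact ⟨∅, .ax, [], fun h => (h rfl).elim⟩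
    | some x =>
      obtain ⟨Θ, r⟩ := x
      obtain ⟨prem, hst, hch⟩ := hπ.step v Θ r hv
      obtain ⟨I, rfl, hI⟩ := hst.exists_inst
      exact ⟨Θ, I, prem, fun _ => ⟨rfl, hI.descends, hch⟩⟩
  choose sq ins prem h using this
  refine ⟨sq, ins, prem, fun v hv => (h v hv).1, fun v hv => (h v hv).2.1,
    fun v b hv => (h v hv).2.2 b, hπ.closed, fun v => ?_, hs⟩
  induction v using List.reverseRecOn with
  | nil =>
    intro hv
    have h1 := hπ.root
    rw [(h [] hv).1] at h1
    obtain rfl := Option.some.inj h1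
    exact h₀
  | append_singleton v b ih =>
    intro hv
    have hv' : π v ≠ none := fun e => hv (hπ.closed v b e)
    have hc := (h v hv').2.2 b
    rw [(h _ hv).1] at hc
    exact (h v hv').2.1.prefixFree (ih hv') hc.symm

variable {sq : List Bool → AnnSequent α n} {ins : List Bool → Inst α n}
  {prem : List Bool → List (AnnSequent α n)}

theorem Describes.premise (D : Describes Ω π sq ins prem) {v : List Bool} {b : Bool}
    (hv : π v ≠ none) (hb : π (v ++ [b]) ≠ none) : (prem v)[b.toNat]? = some (sq (v ++ [b])) := by
  rw [← D.child v b hv, D.label _ hb]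
  rfl

theorem Describes.ne_none_of_isPrefix (D : Describes Ω π sq ins prem) {v w : List Bool}
    (h : v <+: w) (hw : π w ≠ none) : π v ≠ none := by
  obtain ⟨t, rfl⟩ := h
  induction t using List.reverseRecOn with
  | nil => simpa using hw
  | append_singleton t b ih =>
    refine ih fun e => hw ?_
    rw [← List.append_assoc]
    exact D.closed _ b e

theorem Describes.exists_trace (D : Describes Ω π sq ins prem) {β : ℕ → Bool}
    (hβ : ∀ i, π (pathNode β i) ≠ none) :
    ∃ (l : Fin n) (N : ℕ) (χ : ℕ → Formula α) (f : ℕ → Bool),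
      (∀ i, N ≤ i → χ i ∈ supp (sq (pathNode β i)) ∧
        Trace (ins (pathNode β i)) (β i) (χ i) (χ (i + 1)) (f i) ∧
        ¬ (ins (pathNode β i)).Resets Ω l (f i)) ∧
      ∀ M, ∃ i, M ≤ i ∧ (ins (pathNode β i)).Hits l (f i) := by
  obtain ⟨l, s, N, hpre, hprog⟩ := D.successful β hβ
  have key : ∀ i, N ≤ i → InPlay (sq (pathNode β i)) l s ∧
      ∀ u c, ins (pathNode β i) = .compress l u c → ¬ (u <+: s ∧ u ≠ s) := by
    intro i hi
    obtain ⟨Θ, r, e, h1, h2⟩ := hpre _ ⟨i, hi, rfl⟩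
    rw [D.label _ (hβ i)] at e
    simp only [Option.some.injEq, Prod.mk.injEq] at e
    obtain ⟨rfl, rfl⟩ := e
    exact ⟨h1, fun u c hI => h2 u c (by rw [hI]; rfl)⟩
  obtain ⟨χ, f, h1, h2⟩ := exists_trace_of_successful (Θ := fun i => sq (pathNode β i))
    (I := fun i => ins (pathNode β i)) (b := β) (prem := fun i => prem (pathNode β i))
    (l := l) (s := s) (N := N) (fun i => D.descends _ (hβ i))
    (fun i => by
      have := hβ (i + 1)
      rw [pathNode_succ] at this ⊢
      exact D.premise (hβ i) this)
    (fun i => D.prefixFree _ (hβ i)) (fun i hi => (key i hi).1) (fun i hi => (key i hi).2)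
    (fun M => by
      obtain ⟨i, hi, Θ, j, e⟩ := hprog M
      rw [D.label _ (hβ i)] at e
      simp only [Option.some.injEq, Prod.mk.injEq] at e
      exact ⟨i, hi, j, Inst.eq_compress_of_rule e.2⟩)
  exact ⟨l, N, χ, f, h1, h2⟩

/-- From each node, the silent steps lead to a node at which a logical rule is applied. -/
theorem Describes.exists_logical (D : Describes Ω π sq ins prem) {v : List Bool}
    (hv : π v ≠ none) : ∃ k, π (v ++ List.replicate k false) ≠ none ∧
      ¬ (ins (v ++ List.replicate k false)).Silent ∧
      (∀ j < k, (ins (v ++ List.replicate j false)).Silent) ∧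
      supp (sq (v ++ List.replicate k false)) ⊆ supp (sq v) := by
  have hlive : ∀ k, (∀ j < k, (ins (v ++ List.replicate j false)).Silent) →
      π (v ++ List.replicate k false) ≠ none ∧
        supp (sq (v ++ List.replicate k false)) ⊆ supp (sq v) := by
    intro k
    induction k with
    | zero => intro _; simpa using hv
    | succ k ih =>
      intro h
      obtain ⟨h1, h2⟩ := ih fun j hj => h j (by omega)
      have hsil := h k (by omega)
      have hd := D.descends _ h1
      have e : v ++ List.replicate (k + 1) false = v ++ List.replicate k false ++ [false] := by
        rw [List.replicate_succ', List.append_assoc]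
      have hne : π (v ++ List.replicate k false ++ [false]) ≠ none := by
        intro hnone
        have := D.child _ false h1
        rw [hnone] at this
        have hlen := hd.length
        rw [hsil.arity_eq] at hlen
        rw [Option.map_none, eq_comm, List.getElem?_eq_none_iff] at this
        simp only [Bool.toNat_false] at this
        omega
      rw [e]
      exact ⟨hne, (hd.supp_subset hsil (D.premise h1 hne)).trans h2⟩
  by_cases hex : ∃ k, ¬ (ins (v ++ List.replicate k false)).Silent
  · classical
    have hmin : ∀ j < Nat.find hex, (ins (v ++ List.replicate j false)).Silent := fun j hj => by
      simpa using Nat.find_min hex hj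
    obtain ⟨h1, h2⟩ := hlive _ hmin
    exact ⟨Nat.find hex, h1, Nat.find_spec hex, hmin, h2⟩
  · exfalso
    push Not at hex
    obtain ⟨β, hβ⟩ := exists_branch (w := fun j => v ++ List.replicate j false)
      (fun j => by simp [List.replicate_succ']) (fun M => ⟨M, by simp⟩)
    have hnode : ∀ j, pathNode β (v.length + j) = v ++ List.replicate j false := fun j => by
      simpa using hβ j
    have hne : ∀ i, π (pathNode β i) ≠ none := fun i => D.ne_none_of_isPrefix
      (pathNode_isPrefix β (Nat.le_add_left i v.length)) (by
        rw [hnode]; exact (hlive i fun j _ => hex j).1)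
    obtain ⟨l, N, χ, f, -, hhit⟩ := D.exists_trace hne
    obtain ⟨i, hi, h⟩ := hhit v.length
    obtain ⟨k, rfl⟩ := Nat.exists_eq_add_of_le hi
    rw [hnode] at h
    exact h.not_silent (hex k)

/-! ### Eager normalization -/

/-- A node of `π` at which a logical rule is applied, with an annotated sequent that contains all
formulas of that node. -/
structure Config (π : ProofTree α n) (sq : List Bool → AnnSequent α n) (ins : List Bool → Inst α n)
    (C : Set (Formula α)) (B : ℕ) where
  node : List Bool
  seq : AnnSequent α n
  live : π node ≠ none
  logical : ¬ (ins node).Silent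
  supp_subset : supp (sq node) ⊆ supp seq
  prefixFree : PrefixFree seq
  bounded : Bounded C B seq

/-- The configuration `t` arises from `c` by a silent step of the instance `I` that decreases the
weight. -/
structure Config.Normalizes {C : Set (Formula α)} {B : ℕ} (Ω : Formula α → ℕ)
    (c : Config π sq ins C B) (I : Inst α n) (t : Config π sq ins C B) : Prop where
  silent : I.Silent
  node : t.node = c.node
  weight : weight t.seq < weight c.seq
  lift : ∀ χ σ, (χ, σ) ∈ c.seq → ∃ τ, (χ, τ) ∈ t.seq ∧
    (τ = annMap Ω c.seq I false σ ∨ (I = .resolve ∧ (χ, τ) ∈ c.seq ∧ AnnLT σ τ))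

/-- The configuration `t` arises from `c` by simulating the logical rule at the node of `c`. -/
structure Config.Simulates {C : Set (Formula α)} {B : ℕ} (Ω : Formula α → ℕ)
    (c : Config π sq ins C B) (I : Inst α n) (b : Bool) (t : Config π sq ins C B) : Prop where
  inst : I = ins c.node
  node : ∃ k, t.node = c.node ++ [b] ++ List.replicate k false ∧
    ∀ j < k, (ins (c.node ++ [b] ++ List.replicate j false)).Silent
  lift : ∀ χ χ' f σ, (χ, σ) ∈ c.seq → Trace I b χ χ' f → (χ', annMap Ω c.seq I f σ) ∈ t.seq

/-- At a normal sequent the instance used in `π` is replayed, and the silent steps of `π` after it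
are skipped. Otherwise one silent step is made and the node stays. The bound `C.ncard + 2` consists
of the bound for normal sequents and the single bit that a logical rule can append. -/
theorem Config.exists_next (D : Describes Ω π sq ins prem) {C : Set (Formula α)} (hC : C.Finite)
    (hcl : ∀ φ ∈ C, ∀ ψ, TraceStep φ ψ → ψ ∈ C) (c : Config π sq ins C (C.ncard + 2)) :
    ∃ (I : Inst α n) (prem' : List (AnnSequent α n))
      (next : Bool → Option (Config π sq ins C (C.ncard + 2))),
      InstStep Ω I c.seq prem' ∧ (∀ b, (next b).map Config.seq = prem'[b.toNat]?) ∧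
      ∀ b t, next b = some t → c.Normalizes Ω I t ∨ c.Simulates Ω I b t := by
  by_cases hn : Normal c.seq
  · have hd := D.descends _ c.live
    obtain ⟨prem', hst, hlift⟩ := exists_instStep c.logical (hd.avail.mono c.supp_subset) hn.unique
    have hd' := hst.descends
    have hnext : ∀ b : Bool, ∃ o : Option (Config π sq ins C (C.ncard + 2)),
        o.map Config.seq = prem'[b.toNat]? ∧
          ∀ t, o = some t → c.Simulates Ω (ins c.node) b t := by
      intro b
      cases hb : prem'[b.toNat]? with
      | none => exact ⟨none, rfl, fun t h => by simp at h⟩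
      | some Θ' =>
        -- The number of premises depends only on the instance, so `π` has a child wherever the
        -- replayed instance has a premise.
        have hlt : b.toNat < (prem c.node).length := by
          rw [hd.length, ← hd'.length]
          exact (List.getElem?_eq_some_iff.1 hb).1
        have hne : π (c.node ++ [b]) ≠ none := by
          intro e
          have := D.child _ b c.live
          rw [e, Option.map_none, eq_comm, List.getElem?_eq_none_iff] at this
          omega
        obtain ⟨k, hk, hlog, hsil, hsupp⟩ := D.exists_logical hne
        refine ⟨some ⟨_, Θ', hk, hlog, hsupp.trans ?_, hd'.prefixFree c.prefixFree hb,
          hd'.bounded hcl (hn.bounded hC c.bounded) hb⟩, rfl, ?_⟩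
        · rintro χ' ⟨τ, hτ⟩
          obtain ⟨q, hq, f, ht, -⟩ := hd.parent b _ (D.premise c.live hne) _ hτ
          obtain ⟨σ, hσ⟩ := c.supp_subset ⟨q.2, hq⟩
          exact ⟨_, hlift b Θ' hb _ _ _ _ hσ ht⟩
        · rintro t ht
          obtain rfl := Option.some.inj ht
          exact ⟨rfl, ⟨k, rfl, hsil⟩, hlift b Θ' hb⟩
    choose next h1 h2 using hnext
    exact ⟨_, prem', next, hst, h1, fun b t h => Or.inr (h2 b t h)⟩
  · obtain ⟨I, Θ', hI, hst, hw, hlift⟩ := exists_normalizing_step Ω hn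
    have hd := hst.descends
    have h0 : ([Θ'] : List (AnnSequent α n))[false.toNat]? = some Θ' := rfl
    let t : Config π sq ins C (C.ncard + 2) := ⟨c.node, Θ', c.live, c.logical, fun χ hχ => by
      obtain ⟨σ, hσ⟩ := c.supp_subset hχ
      obtain ⟨σ', hσ', -⟩ := hlift χ σ hσ
      exact ⟨σ', hσ'⟩, hd.prefixFree c.prefixFree h0, hd.bounded_of_silent hI c.bounded h0⟩
    refine ⟨I, [Θ'], fun b => if b then none else some t, hst, fun b => ?_, fun b t' h => ?_⟩
    · cases b <;> rfl
    · cases b <;> simp at h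
      subst h
      exact Or.inl ⟨hI, rfl, hw, hlift⟩

/-- The Rabin pairs for the success of a branch. -/
def LabelKeeps (p : Fin n × List Bool) (x : AnnSequent α n × Rule n) : Prop :=
  InPlay x.1 p.1 p.2 ∧ ∀ u b, x.2 = .compress p.1 u b → ¬ (u <+: p.2 ∧ u ≠ p.2)

def LabelProgresses (p : Fin n × List Bool) (x : AnnSequent α n × Rule n) : Prop :=
  ∃ j, x.2 = .compress p.1 (p.2 ++ List.replicate j false) true

/-- The configurations follow an infinite branch of `π`, because the weight allows only finitely
many consecutive normalizing steps. The good trace of that branch is lifted: constant during silent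
steps, and along the replayed instances otherwise. -/
theorem Config.rabinAccepts (D : Describes Ω π sq ins prem) {C : Set (Formula α)} {B : ℕ}
    {c : ℕ → Config π sq ins C B} {I : ℕ → Inst α n} {b : ℕ → Bool}
    {prem' : ℕ → List (AnnSequent α n)} (hst : ∀ j, InstStep Ω (I j) (c j).seq (prem' j))
    (hc : ∀ j, (c j).Normalizes Ω (I j) (c (j + 1)) ∨ (c j).Simulates Ω (I j) (b j) (c (j + 1))) :
    RabinAccepts LabelKeeps LabelProgresses fun j => ((c j).seq, (I j).rule) := by
  have hinf : ∀ M, ∃ j, M ≤ j ∧ (c j).Simulates Ω (I j) (b j) (c (j + 1)) := by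
    intro M
    by_contra hcon
    push Not at hcon
    have hw : ∀ k, weight (c (M + k)).seq + k ≤ weight (c M).seq := by
      intro k
      induction k with
      | zero => simp
      | succ k ih =>
        have := ((hc (M + k)).resolve_right (hcon _ (by omega))).weight
        rw [← add_assoc M k 1]
        omega
    have := hw (weight (c M).seq + 1)
    omega
  let w : ℕ → List Bool := fun j => (c j).node
  have hpre : ∀ j, w j <+: w (j + 1) := by
    intro j
    rcases hc j with h | h
    · simp only [w]; rw [h.node]
    · obtain ⟨k, hk, -⟩ := h.node
      simp only [w]
      rw [hk, List.append_assoc]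
      exact List.prefix_append _ _
  have hmono : ∀ i j, i ≤ j → (w i).length ≤ (w j).length := fun i j h =>
    monotone_nat_of_le_succ (f := fun j => (w j).length) (fun j => (hpre j).length_le) h
  have hlen : ∀ M, ∃ j, M ≤ (w j).length := by
    intro M
    induction M with
    | zero => exact ⟨0, Nat.zero_le _⟩
    | succ M ih =>
      obtain ⟨j, hj⟩ := ih
      obtain ⟨i, hi, h⟩ := hinf j
      obtain ⟨k, hk, -⟩ := h.node
      refine ⟨i + 1, ?_⟩
      have h1 := hmono j i hi
      have h2 : (w (i + 1)).length = (w i).length + 1 + k := by simp [w, hk]; omega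
      omega
  obtain ⟨β, hβ⟩ := exists_branch hpre hlen
  have hne : ∀ i, π (pathNode β i) ≠ none := by
    intro i
    obtain ⟨j, hj⟩ := hlen i
    have := pathNode_isPrefix β hj
    rw [hβ] at this
    exact D.ne_none_of_isPrefix this (c j).live
  obtain ⟨l, N, χ, f, htr, hhit⟩ := D.exists_trace hne
  obtain ⟨j₀, hj₀⟩ := hlen N
  have hN : ∀ j, j₀ ≤ j → N ≤ (w j).length := fun j hj => hj₀.trans (hmono _ _ hj)
  have hnode : ∀ j k, (w (j + 1)) = w j ++ [b j] ++ List.replicate k false → ∀ m ≤ k,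
      pathNode β ((w j).length + 1 + m) = w j ++ [b j] ++ List.replicate m false := by
    intro j k hk m hm
    have hp : w j ++ [b j] ++ List.replicate m false <+: pathNode β (w (j + 1)).length := by
      rw [hβ, hk, List.prefix_append_right_inj, List.prefix_iff_eq_take, List.length_replicate,
        List.take_replicate, min_eq_left hm]
    have := eq_pathNode_of_isPrefix hp
    rwa [List.length_append, List.length_append, List.length_replicate] at this
  -- The unfolding flag of the lifted trace: silent steps unfold nothing, and a replayed instance
  -- inherits the flag at its node.
  let f' : ℕ → Bool := by
    classical
    exact fun j => if (I j).Silent then false else f (w j).length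
  have hf'sil : ∀ j, (I j).Silent → f' j = false := fun j h => if_pos h
  have hf'log : ∀ j, ¬ (I j).Silent → f' j = f (w j).length := fun j h => if_neg h
  have hsim : ∀ j, (c j).Simulates Ω (I j) (b j) (c (j + 1)) → ¬ (I j).Silent := fun j h => by
    rw [h.inst]; exact (c j).logical
  have htrace : ∀ j, j₀ ≤ j → (c j).Simulates Ω (I j) (b j) (c (j + 1)) →
      Trace (I j) (b j) (χ (w j).length) (χ (w (j + 1)).length) (f' j) ∧
        ¬ (I j).Resets Ω l (f' j) := by
    intro j hj h
    obtain ⟨k, hk, hsil⟩ := h.node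
    have hn := hnode j k hk
    have hb : β (w j).length = b j := by
      have := hn 0 (Nat.zero_le _)
      rw [add_zero, pathNode_succ, hβ] at this
      simpa using this
    -- The trace does not change its formula at the skipped silent nodes of `π`.
    have hχ : ∀ m ≤ k, χ ((w j).length + 1 + m) = χ ((w j).length + 1) := by
      intro m
      induction m with
      | zero => intro _; rfl
      | succ m ih =>
        intro hm
        have ht := (htr ((w j).length + 1 + m) (by have := hN j hj; omega)).2.1
        rw [hn m (by omega)] at ht
        rw [← add_assoc, (ht.eq_of_silent (hsil m (by omega))).1, ih (by omega)]
    have ht := htr (w j).length (hN j hj)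
    rw [hβ, hb] at ht
    have hlen' : (w (j + 1)).length = (w j).length + 1 + k := by simp [w, hk]; omega
    rw [hlen', hχ k le_rfl, hf'log j (hsim j h), h.inst]
    exact ht.2
  have hstep : ∀ j, j₀ ≤ j → ∀ σ, (χ (w j).length, σ) ∈ (c j).seq →
      ∃ σ', (χ (w (j + 1)).length, σ') ∈ (c (j + 1)).seq ∧
        (σ' = annMap Ω (c j).seq (I j) (f' j) σ ∨ (I j = .resolve ∧ f' j = false ∧
          (χ (w j).length, σ') ∈ (c j).seq ∧ AnnLT σ σ')) := by
    intro j hj σ hσ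
    rcases hc j with h | h
    · obtain ⟨σ', h1, h2⟩ := h.lift _ _ hσ
      have : w (j + 1) = w j := h.node
      rw [this, hf'sil j h.silent]
      refine ⟨σ', h1, h2.imp id fun h2 => ⟨h2.1, rfl, h2.2⟩⟩
    · exact ⟨_, h.lift _ _ _ _ hσ (htrace j hj h).1, Or.inl rfl⟩
  obtain ⟨σ₀, hσ₀⟩ : ∃ σ, (χ (w j₀).length, σ) ∈ (c j₀).seq := by
    have := (htr _ (hN j₀ le_rfl)).1
    rw [hβ] at this
    exact (c j₀).supp_subset this
  choose! nx hnx₁ hnx₂ using hstep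
  let σ : ℕ → Annotation n := fun j => Nat.rec σ₀ (fun k σ => nx (j₀ + k) σ) (j - j₀)
  have hσs : ∀ j, j₀ ≤ j → σ (j + 1) = nx j (σ j) := by
    intro j hj
    obtain ⟨k, rfl⟩ := Nat.exists_eq_add_of_le hj
    simp only [σ, Nat.add_sub_cancel_left, add_assoc]
  have hmem : ∀ j, j₀ ≤ j → (χ (w j).length, σ j) ∈ (c j).seq := by
    intro j hj
    induction j, hj using Nat.le_induction with
    | base => simpa [σ] using hσ₀
    | succ j hj ih => rw [hσs j hj]; exact hnx₁ j hj _ ih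
  obtain ⟨l', s, N', h1, h2⟩ := exists_progress_of_trace (Ω := Ω) (Θ := fun j => (c j).seq)
    (I := I) (prem := prem') (l := l) (N := j₀) (B := B) (χ := fun j => χ (w j).length) (f := f')
    (σ := σ) (fun j => (hst j).descends) (fun j => (c j).prefixFree)
    (fun j q hq l => ((c j).bounded q hq).2 l) hmem
    (fun j hj => by
      rcases hc j with h | h
      · rw [hf'sil j h.silent]; simp [Inst.Resets]
      · exact (htrace j hj h).2)
    (fun j hj => by rw [hσs j hj]; exact hnx₂ j hj _ (hmem j hj))
    -- The first configuration whose node is longer than `i` identifies the step `j` that passes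
    -- position `i`. A hit cannot occur at a skipped node, since those are silent, so it occurs at
    -- the node of `c j`.
    (fun M => by
      obtain ⟨i, hi, h⟩ := hhit (w (max M j₀)).length
      classical
      have hex : ∃ j, i < (w j).length := by
        obtain ⟨j, hj⟩ := hlen (i + 1)
        exact ⟨j, hj⟩
      have hlt : max M j₀ < Nat.find hex := by
        by_contra hcon
        have := hmono _ _ (not_lt.1 hcon)
        have := Nat.find_spec hex
        omega
      obtain ⟨j, hj⟩ : ∃ j, Nat.find hex = j + 1 := ⟨Nat.find hex - 1, by omega⟩
      have hi1 : i < (w (j + 1)).length := hj ▸ Nat.find_spec hex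
      have hi2 : (w j).length ≤ i := not_lt.1 (Nat.find_min hex (by omega))
      have hs : (c j).Simulates Ω (I j) (b j) (c (j + 1)) := by
        refine (hc j).resolve_left fun h => ?_
        have : w (j + 1) = w j := h.node
        rw [this] at hi1
        omega
      obtain ⟨k, hk, hsil⟩ := hs.node
      rcases hi2.eq_or_lt with e | hlt'
      · refine ⟨j, by omega, ?_⟩
        rw [← e, hβ] at h
        rw [hf'log j (hsim j hs), hs.inst]
        exact h
      · obtain ⟨m, rfl⟩ : ∃ m, i = (w j).length + 1 + m := ⟨i - ((w j).length + 1), by omega⟩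
        have hlen' : (w (j + 1)).length = (w j).length + 1 + k := by simp [w, hk]; omega
        rw [hnode j k hk m (by omega)] at h
        exact (h.not_silent (hsil m (by omega))).elim)
  refine ⟨(l', s), N', fun j hj => ⟨(h1 j hj).1, fun u b e =>
    (h1 j hj).2 u b (Inst.eq_compress_of_rule e)⟩, fun M => ?_⟩
  obtain ⟨j, hj, i, e⟩ := h2 M
  exact ⟨j, hj, i, by simp only [e]; rfl⟩

end

/-! ### Trees generated by positional strategies -/

/-- The tree generated from the root label `a` by a positional strategy. -/
def unfoldTree {L : Type*} (τ : L → Bool → Option L) (a : L) (v : List Bool) : Option L :=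
  v.foldl (fun o b => o.bind fun x => τ x b) (some a)

section

variable {L : Type*} {τ : L → Bool → Option L} {a : L}

theorem unfoldTree_concat (v : List Bool) (b : Bool) :
    unfoldTree τ a (v ++ [b]) = (unfoldTree τ a v).bind fun x => τ x b := by
  simp [unfoldTree]

theorem unfoldTree_append {v : List Bool} {x : L} (h : unfoldTree τ a v = some x) (u : List Bool) :
    unfoldTree τ a (v ++ u) = unfoldTree τ x u := by
  unfold unfoldTree at h ⊢
  rw [List.foldl_append, h]

theorem reach_of_unfoldTree {F : Set L} (hF : ∀ x, ReflTransGen (SysStep id τ F) a x → x ∈ F)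
    {v : List Bool} {x : L} (h : unfoldTree τ a v = some x) :
    ReflTransGen (SysStep id τ F) a x := by
  induction v using List.reverseRecOn generalizing x with
  | nil => obtain rfl := Option.some.inj h; exact .refl
  | append_singleton v b ih =>
    rw [unfoldTree_concat] at h
    obtain ⟨y, hy, hyx⟩ := Option.bind_eq_some_iff.1 h
    exact (ih hy).tail ⟨hF y (ih hy), b, hyx⟩

end

/-- The local condition on the labels of a derivation. -/
def LabelOk {α : Type*} [DecidableEq α] {n : ℕ} (Ω : Formula α → ℕ)
    (x : AnnSequent α n × Rule n) (c : Bool → Option (AnnSequent α n × Rule n)) : Prop :=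
  ∃ prem, Step Ω x.2 x.1 prem ∧ ∀ b : Bool, (c b).map Prod.fst = prem[b.toNat]?

/-- The strategy never leaves `F`, as each label it reaches is the label of a state. The subtree at
a node is the unfolding from its label, so there are no more subtrees than labels in `F`. -/
theorem exists_regular_of_wins {α S : Type*} [DecidableEq α] {n : ℕ} {Ω : Formula α → ℕ}
    {lab : S → AnnSequent α n × Rule n} {next : S → Bool → Option S}
    {F : Set (AnnSequent α n × Rule n)} (hF : F.Finite) (hlab : ∀ s, lab s ∈ F)
    {τ : AnnSequent α n × Rule n → Bool → Option (AnnSequent α n × Rule n)} {s : S}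
    (h : Wins lab next (LabelOk Ω) LabelKeeps LabelProgresses F τ s) :
    ∃ π : ProofTree α n, IsDerivation Ω (lab s).1 π ∧
      (∀ β : ℕ → Bool, (∀ i, π (pathNode β i) ≠ none) → Successful π β) ∧ π.Regular := by
  have hmem : ∀ x, ReflTransGen (SysStep id τ F) (lab s) x → x ∈ F := fun x hx => by
    obtain ⟨t, -, rfl⟩ := h.reach x hx
    exact hlab t
  refine ⟨unfoldTree τ (lab s), ⟨rfl, fun v b e => ?_, fun v Θ r e => ?_⟩, fun β hβ => ?_, ?_⟩
  · rw [unfoldTree_concat, e]; rfl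
  · have hr := reach_of_unfoldTree hmem e
    obtain ⟨prem, hst, hp⟩ := h.ok _ hr (hmem _ hr)
    refine ⟨prem, hst, fun b => ?_⟩
    rw [unfoldTree_concat, e]
    exact hp b
  · choose f hf using fun i => Option.ne_none_iff_exists'.1 (hβ i)
    have hstep : ∀ i, SysStep id τ F (f i) (f (i + 1)) := by
      intro i
      have := hf (i + 1)
      rw [pathNode_succ, unfoldTree_concat, hf i] at this
      exact ⟨hmem _ (reach_of_unfoldTree hmem (hf i)), β i, this⟩
    obtain ⟨⟨l, u⟩, N, hk, hp⟩ := h.acc f (reach_of_unfoldTree hmem (hf 0)) hstep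
    refine ⟨l, u, N, ?_, fun M => ?_⟩
    · rintro v ⟨i, hi, rfl⟩
      exact ⟨(f i).1, (f i).2, hf i, hk i hi⟩
    · obtain ⟨i, hi, j, e⟩ := hp M
      exact ⟨i, hi, (f i).1, j, by rw [hf i, ← e]⟩
  · refine (hF.image (unfoldTree τ)).subset ?_
    rintro ρ ⟨v, hv, rfl⟩
    obtain ⟨x, hx⟩ := Option.ne_none_iff_exists'.1 hv
    exact ⟨x, hmem _ (reach_of_unfoldTree hmem hx), funext fun u => (unfoldTree_append hx u).symm⟩

end MuBT

/-! ### Existence of regular proofs -/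

theorem mainTheorem6 {α : Type*} [DecidableEq α] (Γ : Finset (MuBT.Formula α))
    (hwf : ∀ φ ∈ Γ, φ.WellFormed) (htidy : ∀ φ ∈ Γ, φ.Tidy)
    (Ω : MuBT.Formula α → ℕ) (hΩ : MuBT.IsPriorityFunction Γ Ω) :
    (∃ π, MuBT.IsProof Ω Γ π) ↔ (∃ π, MuBT.IsProof Ω Γ π ∧ π.Regular) := by
  open MuBT in
  refine ⟨?_, fun ⟨π, hπ, _⟩ => ⟨π, hπ⟩⟩
  rintro ⟨π, hπ⟩
  set Θ₀ : AnnSequent α (numEven Ω Γ) := Γ.image fun φ => (φ, fun _ => []) with hΘ₀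
  have hnil : ∀ q ∈ Θ₀, q.1 ∈ Γ ∧ q.2 = fun _ => [] := by
    intro q hq
    obtain ⟨φ, hφ, rfl⟩ := Finset.mem_image.1 hq
    exact ⟨hφ, rfl⟩
  have hpf : PrefixFree Θ₀ := fun l q hq q' hq' _ => by rw [(hnil q hq).2, (hnil q' hq').2]
  obtain ⟨sq, ins, prem, D⟩ := exists_describes hπ.derivation hpf hπ.successful
  let C := Formula.Clos Γ
  have hC : C.Finite := Formula.clos_finite hwf htidy
  have hcl : ∀ φ ∈ C, ∀ ψ, Formula.TraceStep φ ψ → ψ ∈ C := by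
    rintro φ ⟨χ, hχ, h⟩ ψ hs
    exact ⟨χ, hχ, h.tail hs⟩
  have hroot : π [] ≠ none := fun e => by
    have := hπ.derivation.root
    rw [e] at this
    simp at this
  have hsq : sq [] = Θ₀ := by
    have := hπ.derivation.root
    rw [D.label _ hroot] at this
    exact Option.some.inj this
  choose I prem' next hst hnext htrans using fun c => Config.exists_next D hC hcl c
  obtain ⟨k, hk, hlog, -, hsupp⟩ := D.exists_logical hroot
  -- The initial configuration keeps the root sequent and moves on to the first logical node of `π`;
  -- the silent steps before it introduce no formulas.
  let c₀ : Config π sq ins C (C.ncard + 2) := ⟨_, Θ₀, hk, hlog, hsq ▸ hsupp, hpf, fun q hq =>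
    ⟨⟨q.1, (hnil q hq).1, .refl⟩, fun l => by rw [(hnil q hq).2]; exact Nat.zero_le _⟩⟩
  let lab : Config π sq ins C (C.ncard + 2) → AnnSequent α (numEven Ω Γ) × Rule (numEven Ω Γ) :=
    fun c => (c.seq, (I c).rule)
  have hfin := boundedLabels_finite (numEven Ω Γ) hC (C.ncard + 2)
  obtain ⟨τ, hτ⟩ := exists_wins (lab := lab) (next := next) (ok := LabelOk Ω) (keep := LabelKeeps)
    (prog := LabelProgresses)
    (fun c => ⟨prem' c, (hst c).step, fun b => by rw [← hnext c b, Option.map_map]; rfl⟩)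
    (fun f hf => by
      choose b hb using hf
      exact Config.rabinAccepts D (fun j => hst (f j)) fun j => htrans (f j) (b j) _ (hb j))
    _ hfin c₀
  -- A string `s` that is compressed extends by a bit to a string in play, which bounds its length.
  obtain ⟨π', h1, h2, h3⟩ := exists_regular_of_wins hfin (fun c => ⟨c.bounded, fun l s b e => by
    obtain ⟨⟨q, hq, hp⟩, -⟩ := (hst c).descends.compress l s b (Inst.eq_compress_of_rule e)
    have := hp.length_le.trans ((c.bounded q hq).2 l)
    rw [List.length_append] at this
    omega⟩) hτ
  exact ⟨π', ⟨h1, h2⟩, h3⟩
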